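/- **Model.** Access points (APs) form a homogeneous Poisson point process $\Phi=\{X_1,X_2,\dots\}$ of density $\lambda>0$ in $\mathbb R^2$, indexed by increasing distance $r_k=|X_k|$ to the user at the origin. The $K\ge1$ nearest APs serve the user; all others interfere. Let $p:[0,\infty)\to[0,1]$ be a measurable LOS probability function (for instance $p(r)=e^{-\beta r}$). Given $\Phi$, the links of the interfering APs are independent: link $l$ is LOS with probability $p(r_l)$ and NLOS otherwise; its antenna gain $G_l$ is independent of the link state, with $\mathbb P(G_l=a_n)=b_n$, $n=1,2$, where $a_1=M>0$, $b_1=\theta_b/2\pi$, $a_2=m\ge0$, $b_2=1-\theta_b/2\pi$, $0\le\theta_b\le2\pi$; and, independently of $G_l$, its power fading $|\xi_l|^2$ is $\Gamma(N_L,1/N_L)$ (shape, scale) if the link is LOS and $\Gamma(N_N,1/N_N)$ if it is NLOS (Nakagami fading). Thus the LOS and the NLOS interferers are the points outside the disc of radius $r_K$ of two independent Poisson processes with densities $\lambda p(|x|)$ and $\lambda(1-p(|x|))$. Serving links are LOS with gain $M$, and their power fadings $|\xi_1|^2,\dots,|\xi_K|^2$ are i.i.d. $\Gamma(N_L,1/N_L)$,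 independent of everything else. With path loss constants $C_L,C_N,\alpha_L,\alpha_N>0$, Nakagami parameters $N_L,N_N>0$ and noise power $\sigma^2>0$, the SINR is $$\gamma=\frac{\sum_{k=1}^K M C_L r_k^{-\alpha_L}|\xi_k|^2}{I_L+I_N+\sigma^2},\qquad I_L=\sum_{l>K,\ l\text{ LOS}}G_lC_Lr_l^{-\alpha_L}|\xi_l|^2,\quad I_N=\sum_{l>K,\ l\text{ NLOS}}G_lC_Nr_l^{-\alpha_N}|\xi_l|^2,$$ with $\gamma=0$ where $I_L+I_N=\infty$. The ergodic capacity is $C=\mathbb E[\log_2(1+\gamma)]$. For fixed $\boldsymbol r\in\mathcal D=\{0<r_1\le\dots\le r_K\}$, $C_{\rm cond}(\boldsymbol r)$ is the expectation of $\log_2(1+\gamma)$ when the serving APs are placed at the distances $r_1,\dots,r_K$ and the interferers are the APs of $\Phi$ at distance greater than $r_K$. **Theorem.** Let $F(N,x)=1-(1+x/N)^{-N}$ and, with values in $[0,\infty]$ and $e^{-\infty}=0$, $$Q_L(s)=2\pi\lambda\sum_{n=1}^2b_n\int_{r_K}^\infty F(N_L,sa_nC_Lx^{-\alpha_L})\,p(x)\,x\,dx,\qquad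 Q_N(s)=2\pi\lambda\sum_{n=1}^2b_n\int_{r_K}^\infty F(N_N,sa_nC_Nx^{-\alpha_N})(1-p(x))\,x\,dx .$$ 1. For every $\boldsymbol r\in\mathcal D$, the expectation and the integral below are finite and $$C_{\rm cond}(\boldsymbol r)=\frac1{\ln2}\int_0^\infty\frac{e^{-s\sigma^2}}{s}e^{-(Q_L(s)+Q_N(s))}\Bigl(1-\prod_{k=1}^K\bigl(1-F(N_L,sMC_Lr_k^{-\alpha_L})\bigr)\Bigr)ds .$$ 2. $\log_2(1+\gamma)$ is integrable, and its conditional expectation given the distances $r_1,\dots,r_K$ of the $K$ nearest APs is almost surely the right-hand side of 1 evaluated at these distances. 3. The distances of the $K$ nearest APs have joint density $(2\pi\lambda)^Kr_1\cdots r_Ke^{-\pi\lambda r_K^2}$ on $\mathcal D$, and $$C=\frac{(2\pi\lambda)^K}{\ln2}\int_{\mathcal D}r_1\cdots r_Ke^{-\pi\lambda r_K^2}\int_0^\infty\frac{e^{-s\sigma^2}}{s}e^{-(Q_L(s)+Q_N(s))}\Bigl(1-\prod_{k=1}^K\bigl(1-F(N_L,sMC_Lr_k^{-\alpha_L})\bigr)\Bigr)ds\,d\boldsymbol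 r,$$ where the outer integral converges absolutely. -/

import Mathlib

open MeasureTheory ProbabilityTheory Set
open scoped ENNReal

noncomputable section

/-- The plane `ℝ²` with its Euclidean norm; the typical user sits at the origin. -/
abbrev Plane : Type := EuclideanSpace ℝ (Fin 2)

/-- The number of points of the family `X` lying in `B`, with values in `[0, ∞]`. -/
def pointCount {Ω : Type*} (X : ℕ → Ω → Plane) (B : Set Plane) (ω : Ω) : ℝ≥0∞ :=
  ∑' l, B.indicator 1 (X l ω)

/-- `{X l}` is a homogeneous Poisson point process of density `lam` on the plane: the number of
points in a Borel set of finite area is Poisson with mean `lam * area`, and the numbers of points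
in finitely many pairwise disjoint Borel sets are independent. -/
structure IsHomogeneousPPP {Ω : Type*} [MeasurableSpace Ω] (P : Measure Ω) (lam : ℝ)
    (X : ℕ → Ω → Plane) : Prop where
  measurable : ∀ l, Measurable (X l)
  hasLaw_count : ∀ B : Set Plane, MeasurableSet B → volume B ≠ ∞ →
    HasLaw (pointCount X B)
      ((poissonMeasure (ENNReal.ofReal lam * volume B).toNNReal).map (Nat.cast : ℕ → ℝ≥0∞)) P
  indep_count : ∀ (n : ℕ) (B : Fin n → Set Plane), (∀ i, MeasurableSet (B i)) →
    Pairwise (fun i j => Disjoint (B i) (B j)) → iIndepFun (fun i => pointCount X (B i)) P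

/-- `mark l` are independent marks of the points `X l`: given all the points, the marks are
independent and the mark of a point located at `x` has law `κ x`. -/
structure IsIndependentMarking {Ω E : Type*} [MeasurableSpace Ω] [MeasurableSpace E]
    (P : Measure Ω) (κ : Plane → Measure E) (X : ℕ → Ω → Plane) (mark : ℕ → Ω → E) : Prop where
  measurable : ∀ l, Measurable (mark l)
  law : ∀ (A : Set (ℕ → Plane)) (s : Finset ℕ) (B : ℕ → Set E), MeasurableSet A →
    (∀ l, MeasurableSet (B l)) →
    P ({ω | (fun l => X l ω) ∈ A} ∩ ⋂ l ∈ s, mark l ⁻¹' B l) =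
      ∫⁻ ω in {ω | (fun l => X l ω) ∈ A}, ∏ l ∈ s, κ (X l ω) (B l) ∂P

/-- The parameters of the network. -/
structure NetworkParams where
  /-- density of the access points -/
  lam : ℝ
  /-- probability that a link of length `r` is line-of-sight -/
  losProb : ℝ → ℝ
  /-- LOS path loss exponent and intercept, LOS Nakagami parameter -/
  alphaL : ℝ
  CL : ℝ
  NL : ℝ
  /-- NLOS path loss exponent and intercept, NLOS Nakagami parameter -/
  alphaN : ℝ
  CN : ℝ
  NN : ℝ
  /-- main lobe gain, side lobe gain and beamwidth of the access points -/
  mainGain : ℝ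
  sideGain : ℝ
  beamwidth : ℝ
  /-- noise power `σ²` -/
  noise : ℝ
  lam_pos : 0 < lam
  measurable_losProb : Measurable losProb
  losProb_mem : ∀ r, 0 ≤ r → losProb r ∈ Icc (0 : ℝ) 1
  alphaL_pos : 0 < alphaL
  CL_pos : 0 < CL
  NL_pos : 0 < NL
  alphaN_pos : 0 < alphaN
  CN_pos : 0 < CN
  NN_pos : 0 < NN
  mainGain_pos : 0 < mainGain
  sideGain_nonneg : 0 ≤ sideGain
  beamwidth_mem : beamwidth ∈ Icc 0 (2 * Real.pi)
  noise_pos : 0 < noise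

namespace NetworkParams

variable (c : NetworkParams)

/-- The values of the gain of an interfering link. -/
def a : Fin 2 → ℝ := ![c.mainGain, c.sideGain]

/-- The probabilities of these values. -/
def b : Fin 2 → ℝ := ![c.beamwidth / (2 * Real.pi), 1 - c.beamwidth / (2 * Real.pi)]

/-- The law of the antenna gain of an interfering link. -/
def gainLaw : Measure ℝ := ∑ n, ENNReal.ofReal (c.b n) • Measure.dirac (c.a n)

/-- The law of the triple (LOS indicator, antenna gain, power fading) of the link to an
interfering access point located at `x`. A Gamma law of shape `N` and scale `1/N` has rate `N`. -/
def linkLaw (x : Plane) : Measure (Bool × ℝ × ℝ) :=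
  ENNReal.ofReal (c.losProb ‖x‖) •
      (Measure.dirac true).prod (c.gainLaw.prod (gammaMeasure c.NL c.NL)) +
    ENNReal.ofReal (1 - c.losProb ‖x‖) •
      (Measure.dirac false).prod (c.gainLaw.prod (gammaMeasure c.NN c.NN))

end NetworkParams

/-- The probabilistic model on `(Ω, P)` with `K` serving access points. The `(l+1)`-st nearest
access point is at `X l`. As interferer, access point `l` has link `link l` = (LOS indicator,
gain, power fading); as serving access point, `k < K` has a LOS link with
power fading `servingFading k` and main lobe gain. -/
structure NetworkModel (c : NetworkParams) (K : ℕ) {Ω : Type*} [MeasurableSpace Ω]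
    (P : Measure Ω) where
  X : ℕ → Ω → Plane
  link : ℕ → Ω → Bool × ℝ × ℝ
  servingFading : Fin K → Ω → ℝ
  ordered : ∀ᵐ ω ∂P, StrictMono (fun l => ‖X l ω‖)
  ppp : IsHomogeneousPPP P c.lam X
  marking : IsIndependentMarking P c.linkLaw X link
  measurable_servingFading : ∀ k, Measurable (servingFading k)
  servingFading_law : ∀ k, HasLaw (servingFading k) (gammaMeasure c.NL c.NL) P
  servingFading_indep : iIndepFun servingFading P
  servingFading_indep_links : IndepFun (fun ω k => servingFading k ω)
    (fun ω => ((fun l => X l ω), (fun l => link l ω))) P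

namespace NetworkModel

variable {c : NetworkParams} {K : ℕ} {Ω : Type*} [MeasurableSpace Ω] {P : Measure Ω}

/-- The distances of the `K` serving (that is, nearest) access points. -/
def servingDist (N : NetworkModel c K P) (ω : Ω) : Fin K → ℝ := fun k => ‖N.X k ω‖

/-- The received signal power when the serving access points are at distances `r k`. -/
def signal (N : NetworkModel c K P) (r : Fin K → ℝ) (ω : Ω) : ℝ :=
  ∑ k, c.mainGain * c.CL * r k ^ (-c.alphaL) * N.servingFading k ω

/-- The interference power from the LOS access points with index in `S`. -/
def losInterference (N : NetworkModel c K P) (S : Set ℕ) (ω : Ω) : ℝ≥0∞ :=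
  ∑' l, {l | l ∈ S ∧ (N.link l ω).1 = true}.indicator (fun l => ENNReal.ofReal
    ((N.link l ω).2.1 * c.CL * ‖N.X l ω‖ ^ (-c.alphaL) * (N.link l ω).2.2)) l

/-- The interference power from the NLOS access points with index in `S`. -/
def nlosInterference (N : NetworkModel c K P) (S : Set ℕ) (ω : Ω) : ℝ≥0∞ :=
  ∑' l, {l | l ∈ S ∧ (N.link l ω).1 = false}.indicator (fun l => ENNReal.ofReal
    ((N.link l ω).2.1 * c.CN * ‖N.X l ω‖ ^ (-c.alphaN) * (N.link l ω).2.2)) l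

/-- The SINR when the serving access points are at distances `r k` and the interferers are the
access points with index in `S`; it is `0` when the interference is infinite. -/
def sinrOf (N : NetworkModel c K P) (r : Fin K → ℝ) (S : Set ℕ) (ω : Ω) : ℝ :=
  (ENNReal.ofReal (N.signal r ω) /
    (N.losInterference S ω + N.nlosInterference S ω + ENNReal.ofReal c.noise)).toReal

/-- The SINR of the typical user: the `K` nearest access points serve, all others interfere. -/
def sinr (N : NetworkModel c K P) (ω : Ω) : ℝ := N.sinrOf (N.servingDist ω) {l | K ≤ l} ω

/-- The SINR with the serving access points at the deterministic distances `r 0 ≤ … ≤ r (K-1)`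
and the access points outside the disc of radius `r (K-1)` interfering. -/
def sinrGiven [NeZero K] (N : NetworkModel c K P) (r : Fin K → ℝ) (ω : Ω) : ℝ :=
  N.sinrOf r {l | r ⟨K - 1, Nat.sub_one_lt (NeZero.ne K)⟩ < ‖N.X l ω‖} ω

/-- The rate `log₂ (1 + SINR)`. -/
def rate (N : NetworkModel c K P) (ω : Ω) : ℝ := Real.logb 2 (1 + N.sinr ω)

/-- The rate with the serving access points at the distances `r`. -/
def rateGiven [NeZero K] (N : NetworkModel c K P) (r : Fin K → ℝ) (ω : Ω) : ℝ :=
  Real.logb 2 (1 + N.sinrGiven r ω)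

/-- The ergodic capacity `C` (bps/Hz) of the typical user. -/
def capacity (N : NetworkModel c K P) : ℝ := ∫ ω, N.rate ω ∂P

/-- The conditional ergodic capacity given the distances `r` of the serving access points. -/
def condCapacity [NeZero K] (N : NetworkModel c K P) (r : Fin K → ℝ) : ℝ :=
  ∫ ω, N.rateGiven r ω ∂P

end NetworkModel

/-- `F(N, x) = 1 - 1 / (1 + x/N)^N`. -/
def nakagamiF (N x : ℝ) : ℝ := 1 - 1 / (1 + x / N) ^ N

/-- `e^{-x}` for `x ∈ [0, ∞]`, with `e^{-∞} = 0`. -/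
def expNeg (x : ℝ≥0∞) : ℝ := if x = ∞ then 0 else Real.exp (-x.toReal)

namespace NetworkParams

variable (c : NetworkParams)

/-- `Q_L(s)` for the outer radius `ρ = r_K`. -/
def QL (ρ s : ℝ) : ℝ≥0∞ :=
  ENNReal.ofReal (2 * Real.pi * c.lam) * ∑ n, ENNReal.ofReal (c.b n) *
    ∫⁻ x in Ioi ρ, ENNReal.ofReal
      (nakagamiF c.NL (s * c.a n * c.CL * x ^ (-c.alphaL)) * c.losProb x * x)

/-- `Q_N(s)` for the outer radius `ρ = r_K`. -/
def QN (ρ s : ℝ) : ℝ≥0∞ :=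
  ENNReal.ofReal (2 * Real.pi * c.lam) * ∑ n, ENNReal.ofReal (c.b n) *
    ∫⁻ x in Ioi ρ, ENNReal.ofReal
      (nakagamiF c.NN (s * c.a n * c.CN * x ^ (-c.alphaN)) * (1 - c.losProb x) * x)

/-- The integrand in `s` of the conditional capacity, for serving distances `r`. -/
def capacityIntegrand {K : ℕ} [NeZero K] (r : Fin K → ℝ) (s : ℝ) : ℝ :=
  Real.exp (-s * c.noise) / s *
    expNeg (c.QL (r ⟨K - 1, Nat.sub_one_lt (NeZero.ne K)⟩) s +
      c.QN (r ⟨K - 1, Nat.sub_one_lt (NeZero.ne K)⟩) s) *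
    (1 - ∏ k, (1 - nakagamiF c.NL (s * c.mainGain * c.CL * r k ^ (-c.alphaL))))

/-- The joint density of the `K` nearest distances on `0 < r 0 ≤ … ≤ r (K-1)`. -/
def distDensity {K : ℕ} [NeZero K] (r : Fin K → ℝ) : ℝ :=
  (2 * Real.pi * c.lam) ^ K * (∏ k, r k) *
    Real.exp (-Real.pi * c.lam * r ⟨K - 1, Nat.sub_one_lt (NeZero.ne K)⟩ ^ 2)

end NetworkParams

/-- The domain `0 < r 0 ≤ … ≤ r (K-1)`. -/
def orderedDistances (K : ℕ) : Set (Fin K → ℝ) := {r | (∀ k, 0 < r k) ∧ Monotone r}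

end

/-!
The rate is an integral of Laplace transforms. For a signal power `S ≥ 0`, an interference power
`I ∈ [0, ∞]` and noise `σ² > 0`, Frullani's integral gives
`log (1 + S / (I + σ²)) = ∫_0^∞ (e^{-sσ²} / s) e^{-sI} (1 - e^{-sS}) ds`, with the value `0` for
`I = ∞` (`ofReal_log_one_add_sinr`). All integrands are nonnegative, so by Tonelli's theorem the
expectation can be taken inside the integral over `s` before anything is known to be finite; the
argument runs in `[0, ∞]`, with `negExp x = e^{-x}`.

Averaging over the serving fadings turns `1 - e^{-sS}` into `1 - ∏ (1 - F)`, by the Laplace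
transform of the Gamma law. Averaging over the marks, which are independent given the points, turns
`e^{-sI}` into `e^{-∑ f(‖X_l‖)}`, where `e^{-f(r)}` is the Laplace transform of the power of one link
of length `r`. The result is `NetworkModel.lintegral_mul_log_sinrOf`; it leaves only the distances
`‖X_l‖` of the access points, which form a Poisson process on the half-line of intensity
`2πλ r dr` (`IsHomogeneousPPP.isPoissonProcess_norm`).

For fixed serving distances the remaining expectation is the Laplace functional of this process
restricted to `(r_K, ∞)`, which is `e^{-(Q_L + Q_N)}`. When the `K` nearest access points serve, a
form of the strong Markov property is needed: the joint law of the first `K` points of a Poisson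
process, weighted by `e^{-∑ f}` over the later points, has density `exp (-η(-∞, t] - ∫_{(t, ∞)} (1 -
e^{-f}) dη)` at `t = r_K` with respect to `η^K` on increasing vectors
(`IsPoissonProcess.lintegral_first_mul_negExp`). The two measures are compared with the `K`-th point
counted among the later ones: they then agree on products of separated intervals with a half-line,
where the event is one about the counts of the process and the Laplace functional applies, and these
boxes cover the increasing vectors. The case `f = 0` is the joint density of the serving distances,
and comparison of the two cases identifies the conditional expectation of the rate.

Finiteness comes from `F(N, x) ≤ x^δ` with `δ = 1 / (1 + α_L)`: the integral over `s` is at most a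
constant times `∑ r_k^{-α_L δ}` (`NetworkParams.exists_capacityLIntegral_le`), and since `α_L δ < 1`
this has a finite mean under the law of the nearest distance.
-/

/-! ### The exponential `e^{-x}` on `[0, ∞]` -/

/-- `e^{-x}` for `x ∈ [0, ∞]`, as an element of `[0, ∞]`. -/
noncomputable def negExp (x : ℝ≥0∞) : ℝ≥0∞ := ENNReal.ofReal (expNeg x)

lemma negExp_eq_exp (x : ℝ≥0∞) : negExp x = EReal.exp (-(x : EReal)) := by
  induction x with
  | top => simp [negExp, expNeg]
  | coe x =>
    simp only [negExp, expNeg, ENNReal.coe_ne_top, if_false, ENNReal.coe_toReal]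
    rw [show ((x : ℝ≥0∞) : EReal) = ((x : ℝ) : EReal) from rfl, ← EReal.coe_neg, EReal.exp_coe]

lemma negExp_ofReal {x : ℝ} (hx : 0 ≤ x) :
    negExp (ENNReal.ofReal x) = ENNReal.ofReal (Real.exp (-x)) := by
  simp [negExp, expNeg, ENNReal.toReal_ofReal hx]

@[simp] lemma negExp_zero : negExp 0 = 1 := by simp [negExp, expNeg]

@[simp] lemma negExp_top : negExp ∞ = 0 := by simp [negExp, expNeg]

lemma negExp_add (x y : ℝ≥0∞) : negExp (x + y) = negExp x * negExp y := by
  induction x with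
  | top => simp
  | coe x =>
    induction y with
    | top => simp
    | coe y =>
      rw [negExp, negExp, negExp, ← ENNReal.ofReal_mul (by simp [expNeg, Real.exp_nonneg])]
      simp only [expNeg, ← ENNReal.coe_add, ENNReal.coe_ne_top, if_false, ENNReal.coe_toReal]
      rw [← Real.exp_add]
      simp [add_comm]

lemma continuous_negExp : Continuous negExp := by
  have h : negExp = fun x : ℝ≥0∞ => EReal.expHomeomorph (-(x : EReal)) := by
    ext x; rw [negExp_eq_exp]; rfl
  rw [h]
  exact EReal.expHomeomorph.continuous.comp continuous_coe_ennreal_ereal.neg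

lemma measurable_negExp : Measurable negExp := continuous_negExp.measurable

lemma negExp_antitone : Antitone negExp := fun x y h => by
  rw [negExp_eq_exp, negExp_eq_exp]
  exact EReal.exp_monotone (EReal.neg_le_neg_iff.2 (by exact_mod_cast h))

lemma negExp_le_one (x : ℝ≥0∞) : negExp x ≤ 1 := by
  simpa using negExp_antitone (zero_le (a := x))

lemma negExp_ne_top (x : ℝ≥0∞) : negExp x ≠ ∞ := ENNReal.ofReal_ne_top

lemma negExp_ne_zero {x : ℝ≥0∞} (hx : x ≠ ∞) : negExp x ≠ 0 := by
  simp [negExp, expNeg, hx, Real.exp_pos]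

lemma toReal_negExp (x : ℝ≥0∞) : (negExp x).toReal = expNeg x := by
  rw [negExp, ENNReal.toReal_ofReal]
  unfold expNeg; split_ifs <;> positivity

lemma negExp_sum {ι : Type*} (s : Finset ι) (f : ι → ℝ≥0∞) :
    negExp (∑ i ∈ s, f i) = ∏ i ∈ s, negExp (f i) := by
  classical
  induction s using Finset.induction_on with
  | empty => simp
  | insert i s hi ih => rw [Finset.sum_insert hi, Finset.prod_insert hi, negExp_add, ih]

lemma tendsto_prod_negExp (f : ℕ → ℝ≥0∞) :
    Filter.Tendsto (fun n => ∏ l ∈ Finset.range n, negExp (f l)) Filter.atTop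
      (nhds (negExp (∑' l, f l))) := by
  simp_rw [← negExp_sum]
  exact (continuous_negExp.tendsto _).comp ENNReal.summable.hasSum.tendsto_sum_nat

/-! ### Poisson processes on the line and their Laplace functional -/

/-- The points `ρ l` form a Poisson process on the line with intensity measure `η`. -/
structure IsPoissonProcess {Ω : Type*} [MeasurableSpace Ω] (P : Measure Ω) (η : Measure ℝ)
    (ρ : ℕ → Ω → ℝ) : Prop where
  measurable : ∀ l, Measurable (ρ l)
  hasLaw_count : ∀ B : Set ℝ, MeasurableSet B → η B ≠ ∞ →
    HasLaw (fun ω => ∑' l, B.indicator (1 : ℝ → ℝ≥0∞) (ρ l ω))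
      ((poissonMeasure (η B).toNNReal).map (Nat.cast : ℕ → ℝ≥0∞)) P
  indep_count : ∀ (n : ℕ) (B : Fin n → Set ℝ), (∀ i, MeasurableSet (B i)) →
    Pairwise (fun i j => Disjoint (B i) (B j)) →
    iIndepFun (fun i ω => ∑' l, (B i).indicator (1 : ℝ → ℝ≥0∞) (ρ l ω)) P

/-- The probability generating function of the Poisson distribution, at `z = e^{-a}`. -/
lemma lintegral_negExp_poisson (a : ℝ≥0∞) (r : NNReal) :
    ∫⁻ x, negExp (a * x) ∂((poissonMeasure r).map (Nat.cast : ℕ → ℝ≥0∞)) =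
      negExp (r * (1 - negExp a)) := by
  have hz : negExp a ≠ ∞ := negExp_ne_top a
  set z := (negExp a).toReal with hzdef
  have hz0 : 0 ≤ z := ENNReal.toReal_nonneg
  have hz1 : z ≤ 1 := ENNReal.toReal_mono ENNReal.one_ne_top (negExp_le_one a)
  have hza : negExp a = ENNReal.ofReal z := (ENNReal.ofReal_toReal hz).symm
  have hpow : ∀ n : ℕ, negExp (a * n) = ENNReal.ofReal z ^ n := by
    intro n
    induction n with
    | zero => simp
    | succ n ih => rw [Nat.cast_succ, mul_add, mul_one, negExp_add, ih, pow_succ, hza]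
  rw [lintegral_map (by exact measurable_negExp.comp (measurable_const.mul measurable_id))
    .of_discrete, poissonMeasure, lintegral_sum_measure]
  simp_rw [lintegral_smul_measure, lintegral_dirac, hpow, smul_eq_mul]
  have hs : HasSum (fun n : ℕ => Real.exp (-r) * r ^ n / (n.factorial) * z ^ n)
      (Real.exp (-r) * Real.exp (r * z)) := by
    have := (NormedSpace.expSeries_div_hasSum_exp ((r : ℝ) * z)).mul_left (Real.exp (-r))
    rw [← Real.exp_eq_exp_ℝ] at this
    refine this.congr_fun fun n => ?_
    rw [mul_pow]; ring
  have hterm : ∀ n : ℕ, ENNReal.ofReal (Real.exp (-r) * r ^ n / (n.factorial)) *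
      ENNReal.ofReal z ^ n = ENNReal.ofReal (Real.exp (-r) * r ^ n / (n.factorial) * z ^ n) := by
    intro n
    rw [ENNReal.ofReal_mul (by positivity), ENNReal.ofReal_pow hz0]
  simp_rw [hterm]
  rw [← ENNReal.ofReal_tsum_of_nonneg (fun n => by positivity) hs.summable, hs.tsum_eq, hza,
    ← ENNReal.ofReal_one, ← ENNReal.ofReal_sub _ hz0, ← ENNReal.ofReal_coe_nnreal,
    ← ENNReal.ofReal_mul r.coe_nonneg, negExp_ofReal (mul_nonneg r.coe_nonneg (by linarith)),
    ← Real.exp_add]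
  congr 2
  ring

namespace IsPoissonProcess

variable {Ω : Type*} [MeasurableSpace Ω] {P : Measure Ω} {η : Measure ℝ} {ρ : ℕ → Ω → ℝ}

lemma measurable_count (h : IsPoissonProcess P η ρ) {B : Set ℝ} (hB : MeasurableSet B) :
    Measurable (fun ω => ∑' l, B.indicator (1 : ℝ → ℝ≥0∞) (ρ l ω)) :=
  Measurable.tsum fun l => (measurable_one.indicator hB).comp (h.measurable l)

/-- Independence of the counts, for an arbitrary finite index type. -/
lemma lintegral_prod_count (h : IsPoissonProcess P η ρ) {ι : Type*} [Fintype ι] (B : ι → Set ℝ)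
    (hB : ∀ i, MeasurableSet (B i)) (hd : Pairwise (fun i j => Disjoint (B i) (B j)))
    (ψ : ι → ℝ≥0∞ → ℝ≥0∞) (hψ : ∀ i, Measurable (ψ i)) :
    ∫⁻ ω, ∏ i, ψ i (∑' l, (B i).indicator (1 : ℝ → ℝ≥0∞) (ρ l ω)) ∂P =
      ∏ i, ∫⁻ ω, ψ i (∑' l, (B i).indicator (1 : ℝ → ℝ≥0∞) (ρ l ω)) ∂P := by
  classical
  let e := Fintype.equivFin ι
  have hind := h.indep_count (Fintype.card ι) (fun i => B (e.symm i)) (fun i => hB _)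
    (fun i j hij => hd (e.symm.injective.ne hij))
  have h1 := lintegral_prod_eq_prod_lintegral_of_indepFun Finset.univ _
    (hind.comp (fun i => ψ (e.symm i)) (fun i => hψ _))
    (fun i => (hψ _).comp (h.measurable_count (hB _)))
  simp only [Function.comp_apply] at h1
  rw [← e.symm.prod_comp (fun i => ∫⁻ ω, ψ i (∑' l, (B i).indicator (1 : ℝ → ℝ≥0∞) (ρ l ω)) ∂P),
    ← h1]
  refine lintegral_congr fun ω => ?_
  exact (e.symm.prod_comp
    (fun i => ψ i (∑' l, (B i).indicator (1 : ℝ → ℝ≥0∞) (ρ l ω)))).symm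

lemma lintegral_negExp_count (h : IsPoissonProcess P η ρ) {B : Set ℝ} (hB : MeasurableSet B)
    (hη : η B ≠ ∞) (a : ℝ≥0∞) :
    ∫⁻ ω, negExp (a * ∑' l, B.indicator (1 : ℝ → ℝ≥0∞) (ρ l ω)) ∂P =
      negExp (η B * (1 - negExp a)) := by
  have hm : Measurable fun x : ℝ≥0∞ => negExp (a * x) :=
    measurable_negExp.comp (measurable_const.mul measurable_id)
  have := lintegral_negExp_poisson a (η B).toNNReal
  rw [← (h.hasLaw_count B hB hη).map_eq, lintegral_map hm (h.measurable_count hB),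
    ENNReal.coe_toNNReal hη] at this
  exact this

/-- The Laplace functional of a Poisson process at a simple function, jointly with the numbers of
points in sets on which the function vanishes. -/
lemma lintegral_prod_count_mul_negExp_simpleFunc (h : IsPoissonProcess P η ρ)
    {ι : Type*} [Fintype ι] (A : ι → Set ℝ)
    (hA : ∀ i, MeasurableSet (A i)) (hd : Pairwise (fun i j => Disjoint (A i) (A j)))
    (ψ : ι → ℝ≥0∞ → ℝ≥0∞) (hψ : ∀ i, Measurable (ψ i))
    (f : SimpleFunc ℝ ℝ≥0∞) (hfA : ∀ i, ∀ x ∈ A i, f x = 0)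
    (hf : ∀ c, c ≠ 0 → η (f ⁻¹' {c}) ≠ ∞) :
    ∫⁻ ω, (∏ i, ψ i (∑' l, (A i).indicator (1 : ℝ → ℝ≥0∞) (ρ l ω))) *
        negExp (∑' l, f (ρ l ω)) ∂P =
      (∏ i, ∫⁻ ω, ψ i (∑' l, (A i).indicator (1 : ℝ → ℝ≥0∞) (ρ l ω)) ∂P) *
        negExp (∫⁻ x, (1 - negExp (f x)) ∂η) := by
  classical
  let J := f.range.filter (· ≠ 0)
  have hexp : ∀ u : ℝ≥0∞ → ℝ≥0∞, u 0 = 0 → ∀ x,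
      u (f x) = ∑ c : J, u c * (f ⁻¹' {(c : ℝ≥0∞)}).indicator 1 x := by
    intro u hu x
    rw [Finset.sum_coe_sort J (fun c => u c * (f ⁻¹' {(c : ℝ≥0∞)}).indicator 1 x)]
    by_cases hx : f x = 0
    · rw [hx, hu, Finset.sum_eq_zero]
      intro c hc
      have : c ≠ 0 := (Finset.mem_filter.1 hc).2
      rw [Set.indicator_of_notMem, mul_zero]
      simp [hx, this.symm]
    · rw [Finset.sum_eq_single (f x)]
      · simp
      · intro c _ hc
        rw [Set.indicator_of_notMem, mul_zero]
        simp [hc.symm]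
      · intro hn
        exact absurd (Finset.mem_filter.2 ⟨f.mem_range_self x, hx⟩) hn
  have hmeas : ∀ c : J, MeasurableSet (f ⁻¹' {(c : ℝ≥0∞)}) := fun c => f.measurableSet_fiber _
  have hsum : ∀ ω, ∑' l, f (ρ l ω) =
      ∑ c : J, (c : ℝ≥0∞) * ∑' l, (f ⁻¹' {(c : ℝ≥0∞)}).indicator (1 : ℝ → ℝ≥0∞) (ρ l ω) := by
    intro ω
    simp_rw [← ENNReal.tsum_mul_left]
    rw [← Summable.tsum_finsetSum (fun _ _ => ENNReal.summable)]
    exact tsum_congr fun l => hexp id rfl _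
  have hint : ∫⁻ x, (1 - negExp (f x)) ∂η =
      ∑ c : J, η (f ⁻¹' {(c : ℝ≥0∞)}) * (1 - negExp c) := by
    simp_rw [hexp (fun y => 1 - negExp y) (by simp)]
    rw [lintegral_finsetSum _
      (fun c _ => (measurable_one.indicator (hmeas c)).const_mul _)]
    refine Finset.sum_congr rfl fun c _ => ?_
    rw [lintegral_const_mul _ (measurable_one.indicator (hmeas c)),
      lintegral_indicator_one (hmeas c), mul_comm]
  have key := h.lintegral_prod_count (Sum.elim A (fun c : J => f ⁻¹' {(c : ℝ≥0∞)}))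
    (by rintro (i | c); exacts [hA i, hmeas c])
    (by
      rintro (i | c) (j | d) hij
      · exact hd (fun e => hij (by rw [e]))
      · refine Set.disjoint_left.2 fun x hx hx' => ?_
        have : f x = d := hx'
        exact (Finset.mem_filter.1 d.2).2 (by rw [← this, hfA i x hx])
      · refine Set.disjoint_left.2 fun x hx' hx => ?_
        have : f x = c := hx'
        exact (Finset.mem_filter.1 c.2).2 (by rw [← this, hfA j x hx])
      · refine Set.disjoint_left.2 fun x hx hx' => hij ?_
        have h1 : f x = c := hx
        have h2 : f x = d := hx'
        rw [Subtype.ext (h1.symm.trans h2)])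
    (Sum.elim ψ (fun c x => negExp (c * x)))
    (by
      rintro (i | c)
      · exact hψ i
      · exact measurable_negExp.comp (measurable_const.mul measurable_id))
  simp only [Fintype.prod_sum_type, Sum.elim_inl, Sum.elim_inr] at key
  simp_rw [hsum, negExp_sum, key, hint, negExp_sum]
  congr 1
  refine Finset.prod_congr rfl fun c _ => ?_
  exact h.lintegral_negExp_count (hmeas c) (hf c (Finset.mem_filter.1 c.2).2) c

/-- The Laplace functional `E exp(-∑ f(ρ l)) = exp(-∫ (1 - e^{-f}) dη)` of a Poisson process,
jointly with the numbers of points in sets on which `f` vanishes. -/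
lemma lintegral_prod_count_mul_negExp [IsProbabilityMeasure P] (h : IsPoissonProcess P η ρ)
    (hη : ∀ t, η (Iic t) ≠ ∞) {ι : Type*} [Fintype ι] (A : ι → Set ℝ)
    (hA : ∀ i, MeasurableSet (A i)) (hd : Pairwise (fun i j => Disjoint (A i) (A j)))
    (ψ : ι → ℝ≥0∞ → ℝ≥0∞) (hψ : ∀ i, Measurable (ψ i)) (hψ1 : ∀ i x, ψ i x ≤ 1)
    {f : ℝ → ℝ≥0∞} (hf : Measurable f) (hfA : ∀ i, ∀ x ∈ A i, f x = 0) :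
    ∫⁻ ω, (∏ i, ψ i (∑' l, (A i).indicator (1 : ℝ → ℝ≥0∞) (ρ l ω))) *
        negExp (∑' l, f (ρ l ω)) ∂P =
      (∏ i, ∫⁻ ω, ψ i (∑' l, (A i).indicator (1 : ℝ → ℝ≥0∞) (ρ l ω)) ∂P) *
        negExp (∫⁻ x, (1 - negExp (f x)) ∂η) := by
  classical
  let F : ℕ → SimpleFunc ℝ ℝ≥0∞ := fun n =>
    (SimpleFunc.eapprox f n).restrict (Iic (n : ℝ))
  have hF : ∀ n x, F n x = (Iic (n : ℝ)).indicator (SimpleFunc.eapprox f n) x := fun n x => by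
    rw [SimpleFunc.restrict_apply _ measurableSet_Iic]
  have hmono : ∀ x, Monotone fun n => F n x := by
    intro x m n hmn
    simp only [hF]
    exact (Set.indicator_le_indicator (SimpleFunc.monotone_eapprox f hmn x)).trans
      (Set.indicator_le_indicator_of_subset
        (Iic_subset_Iic.2 (by exact_mod_cast hmn)) (fun _ => zero_le) x)
  have hle : ∀ n x, F n x ≤ f x := by
    intro n x
    rw [hF]
    refine (Set.indicator_le_self _ _ x).trans ?_
    rw [← SimpleFunc.iSup_eapprox_apply hf x]
    exact le_iSup (fun n => SimpleFunc.eapprox f n x) n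
  have htend : ∀ x, Filter.Tendsto (fun n => F n x) Filter.atTop (nhds (f x)) := by
    intro x
    have h1 : Filter.Tendsto (fun n => SimpleFunc.eapprox f n x) Filter.atTop (nhds (f x)) := by
      conv_rhs => rw [← SimpleFunc.iSup_eapprox_apply hf x]
      exact tendsto_atTop_iSup fun m n hmn => SimpleFunc.monotone_eapprox f hmn x
    refine h1.congr' ?_
    obtain ⟨N, hN⟩ := exists_nat_ge x
    filter_upwards [Filter.eventually_ge_atTop N] with n hn
    rw [hF, Set.indicator_of_mem]
    exact hN.trans (by exact_mod_cast hn)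
  have hstep : ∀ n, _ := fun n => h.lintegral_prod_count_mul_negExp_simpleFunc A hA hd ψ hψ (F n)
    (fun i x hx => le_antisymm ((hle n x).trans (hfA i x hx).le) zero_le)
    (fun c hc => ne_top_of_le_ne_top (hη n) (measure_mono fun x hx => by
      by_contra hxn
      have : F n x = c := hx
      rw [hF, Set.indicator_of_notMem hxn] at this
      exact hc this.symm))
  have hcm : Measurable fun ω => ∏ i, ψ i (∑' l, (A i).indicator (1 : ℝ → ℝ≥0∞) (ρ l ω)) :=
    Finset.measurable_fun_prod _ fun i _ => (hψ i).comp (h.measurable_count (hA i))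
  have hc1 : ∀ ω, ∏ i, ψ i (∑' l, (A i).indicator (1 : ℝ → ℝ≥0∞) (ρ l ω)) ≤ 1 :=
    fun ω => Finset.prod_le_one' fun i _ => hψ1 i _
  have hsumt : ∀ ω, Filter.Tendsto (fun n => ∑' l, F n (ρ l ω)) Filter.atTop
      (nhds (∑' l, f (ρ l ω))) := by
    intro ω
    simp_rw [← lintegral_count]
    exact lintegral_tendsto_of_tendsto_of_monotone (fun n => Measurable.of_discrete.aemeasurable)
      (ae_of_all _ fun l => hmono _) (ae_of_all _ fun l => htend _)
  have hL := tendsto_lintegral_of_dominated_convergence (μ := P)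
    (F := fun n ω => (∏ i, ψ i (∑' l, (A i).indicator (1 : ℝ → ℝ≥0∞) (ρ l ω))) *
        negExp (∑' l, F n (ρ l ω)))
    (f := fun ω => (∏ i, ψ i (∑' l, (A i).indicator (1 : ℝ → ℝ≥0∞) (ρ l ω))) *
        negExp (∑' l, f (ρ l ω))) (fun _ => 1)
    (fun n => hcm.mul (measurable_negExp.comp
      (Measurable.tsum fun l => (F n).measurable.comp (h.measurable l))))
    (fun n => ae_of_all _ fun ω => mul_le_one' (hc1 ω) (negExp_le_one _))
    (by simp)
    (ae_of_all _ fun ω => ENNReal.Tendsto.const_mul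
      ((continuous_negExp.tendsto _).comp (hsumt ω))
      (Or.inr (ne_top_of_le_ne_top ENNReal.one_ne_top (hc1 ω))))
  have hI : Filter.Tendsto (fun n => ∫⁻ x, (1 - negExp (F n x)) ∂η) Filter.atTop
      (nhds (∫⁻ x, (1 - negExp (f x)) ∂η)) := by
    refine lintegral_tendsto_of_tendsto_of_monotone
      (fun n => (measurable_const.sub
        (measurable_negExp.comp (F n).measurable)).aemeasurable)
      (ae_of_all _ fun x m n hmn => tsub_le_tsub_left (negExp_antitone (hmono x hmn)) _)
      (ae_of_all _ fun x => ?_)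
    exact ENNReal.Tendsto.sub tendsto_const_nhds ((continuous_negExp.tendsto _).comp (htend x))
      (Or.inl ENNReal.one_ne_top)
  refine tendsto_nhds_unique hL ?_
  simp_rw [hstep]
  have hp1 : ∏ i, ∫⁻ ω, ψ i (∑' l, (A i).indicator (1 : ℝ → ℝ≥0∞) (ρ l ω)) ∂P ≤ 1 := by
    refine Finset.prod_le_one' fun i _ => ?_
    calc _ ≤ ∫⁻ _, 1 ∂P := lintegral_mono fun ω => hψ1 i _
      _ = 1 := by simp
  exact ENNReal.Tendsto.const_mul ((continuous_negExp.tendsto _).comp hI)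
    (Or.inr (ne_top_of_le_ne_top ENNReal.one_ne_top hp1))

end IsPoissonProcess

/-! ### Product measures -/

/-- Tonelli's theorem for a product of functions of one coordinate each. -/
lemma lintegral_pi_prod (μ : Measure ℝ) [SigmaFinite μ] :
    ∀ {n : ℕ} (f : Fin n → ℝ → ℝ≥0∞), (∀ i, Measurable (f i)) →
      ∫⁻ x, ∏ i, f i (x i) ∂Measure.pi (fun _ => μ) = ∏ i, ∫⁻ x, f i x ∂μ
  | 0, f, _ => by simp
  | n + 1, f, hf => by
    have hmp := measurePreserving_piFinSuccAbove (fun _ : Fin (n + 1) => μ) 0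
    have hm : Measurable fun p : ℝ × (Fin n → ℝ) => f 0 p.1 * ∏ i, f i.succ (p.2 i) :=
      ((hf 0).comp measurable_fst).mul (Finset.measurable_fun_prod _ fun i _ =>
        (hf _).comp ((measurable_pi_apply i).comp measurable_snd))
    have h1 := hmp.lintegral_comp hm
    rw [Fin.prod_univ_succ, ← lintegral_pi_prod μ (fun i => f i.succ) (fun i => hf _),
      ← lintegral_prod_mul (hf 0).aemeasurable (Measurable.aemeasurable
        (Finset.measurable_fun_prod _ fun i _ => (hf i.succ).comp (measurable_pi_apply i)))]
    refine Eq.trans (lintegral_congr fun x => ?_) h1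
    rw [Fin.prod_univ_succ]
    rfl

/-! ### The exponential clock of a diffuse measure -/

lemma lintegral_exp_neg_mul_ofReal :
    ∫⁻ u : ℝ, ENNReal.ofReal (Real.exp (-u)) * ENNReal.ofReal u = 1 := by
  rw [← lintegral_gammaPDF_eq_one (a := 2) (r := 1) two_pos one_pos]
  refine lintegral_congr fun u => ?_
  rw [gammaPDF_eq]
  split_ifs with hu
  · rw [← ENNReal.ofReal_mul (Real.exp_nonneg _)]
    congr 1
    norm_num [Real.Gamma_two, mul_comm]
  · rw [ENNReal.ofReal_of_nonpos (not_le.1 hu).le]; simp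

lemma negExp_eq_lintegral {x : ℝ≥0∞} (hx : x ≠ ∞) :
    negExp x = ∫⁻ u in Ioi x.toReal, ENNReal.ofReal (Real.exp (-u)) := by
  rw [← ofReal_integral_eq_lintegral_ofReal (integrableOn_exp_neg_Ioi _)
    (ae_of_all _ fun u => Real.exp_nonneg _), integral_exp_neg_Ioi]
  simp [negExp, expNeg, hx]

/-- If a diffuse measure `ν` is finite on half-lines `(-∞, r]` and gives infinite mass to
`(t, ∞)`, then under the change of time `r ↦ ν (t, r]` it becomes Lebesgue measure on `(0, ∞)`:
`e^{-ν(t,r]} ν(dr)` is a probability on `(t, ∞)`. -/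
lemma lintegral_negExp_measure_Ioc (ν : Measure ℝ) [NullSingletonClass ν]
    (hfin : ∀ r, ν (Iic r) ≠ ∞) {t : ℝ} (hinf : ν (Ioi t) = ∞) :
    ∫⁻ r in Ioi t, negExp (ν (Ioc t r)) ∂ν = 1 := by
  have hIoc : ∀ a b, ν (Ioc a b) ≠ ∞ := fun a b =>
    ne_top_of_le_ne_top (hfin b) (measure_mono Ioc_subset_Iic_self)
  have hlf : IsLocallyFiniteMeasure ν := ⟨fun x =>
    ⟨Iic (x + 1), Iic_mem_nhds (by linarith), (hfin _).lt_top⟩⟩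
  let V : ℝ → ℝ := fun r => (ν (Ioc t r)).toReal
  have hVmono : Monotone V := fun a b hab =>
    ENNReal.toReal_mono (hIoc _ _) (measure_mono (Ioc_subset_Ioc_right hab))
  have hVt : V t = 0 := by simp [V]
  have hVcont : Continuous V := by
    have h1 : Continuous fun r => max (∫ _ in t..r, (1 : ℝ) ∂ν) 0 :=
      (intervalIntegral.continuous_primitive (μ := ν) (f := fun _ => (1 : ℝ))
        (fun a b => intervalIntegrable_const) t).max continuous_const
    refine h1.congr fun r => ?_
    rcases le_total t r with h | h
    · rw [intervalIntegral.integral_of_le h]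
      simp [V, measureReal_def]
    · rw [intervalIntegral.integral_of_ge h]
      simp [V, Ioc_eq_empty_of_le h]
  have hVtop : ∀ v, ∃ r, v ≤ V r := by
    intro v
    by_contra hcon
    push Not at hcon
    have hle : ν (Ioi t) ≤ ENNReal.ofReal v := by
      have hU : Ioi t = ⋃ n : ℕ, Ioc t n := by
        ext x
        simp only [mem_Ioi, mem_iUnion, mem_Ioc, exists_and_left, iff_self_and]
        exact fun _ => exists_nat_ge x
      rw [hU, Monotone.measure_iUnion
        (fun m n hmn => Ioc_subset_Ioc_right (by exact_mod_cast hmn))]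
      refine iSup_le fun n => ?_
      rw [← ENNReal.ofReal_toReal (hIoc t n)]
      exact ENNReal.ofReal_le_ofReal (hcon n).le
    rw [hinf] at hle
    exact absurd hle (by simp)
  have hV0 : ∀ r, 0 ≤ V r := fun r => ENNReal.toReal_nonneg
  have hofV : ∀ r, ENNReal.ofReal (V r) = ν (Ioc t r) := fun r => ENNReal.ofReal_toReal (hIoc _ _)
  -- the time change: the `ν`-measure of the part of `(t, ∞)` where the clock shows less than `u`
  have hclock : ∀ u, ν ({r | V r < u} ∩ Ioi t) = ENNReal.ofReal u := by
    intro u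
    rcases le_or_gt u 0 with hu | hu
    · rw [ENNReal.ofReal_of_nonpos hu, show {r | V r < u} = ∅ from ?_]
      · simp
      · exact eq_empty_of_forall_notMem fun r hr => absurd (hV0 r) (not_le.2 (hr.trans_le hu))
    have hval : ∀ v, 0 ≤ v → ∃ r, V r = v := fun v hv =>
      mem_range_of_exists_le_of_exists_ge hVcont ⟨t, hVt ▸ hv⟩ (hVtop v)
    apply le_antisymm
    · obtain ⟨r, hr⟩ := hval u hu.le
      rw [← hr, hofV]
      refine measure_mono fun x hx => ⟨hx.2, ?_⟩
      by_contra hxr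
      exact absurd (hVmono (not_le.1 hxr).le) (not_le.2 (hr ▸ hx.1))
    · refine le_of_forall_lt fun b hb => ?_
      have hbt : b ≠ ∞ := ne_top_of_lt hb
      have hbu : b.toReal < u := by
        rwa [← ENNReal.ofReal_toReal hbt, ENNReal.ofReal_lt_ofReal_iff hu] at hb
      obtain ⟨r, hr⟩ := hval ((b.toReal + u) / 2) (by positivity)
      calc b = ENNReal.ofReal b.toReal := (ENNReal.ofReal_toReal hbt).symm
        _ < ENNReal.ofReal (V r) :=
          (ENNReal.ofReal_lt_ofReal_iff (by rw [hr]; positivity)).2 (by rw [hr]; linarith)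
        _ = ν (Ioc t r) := hofV r
        _ ≤ ν ({r | V r < u} ∩ Ioi t) := measure_mono fun x hx =>
          ⟨(hVmono hx.2).trans_lt (by rw [hr]; linarith), hx.1⟩
  have hmV : Measurable V := hVmono.measurable
  calc ∫⁻ r in Ioi t, negExp (ν (Ioc t r)) ∂ν
      = ∫⁻ r in Ioi t, (∫⁻ u, {p : ℝ × ℝ | V p.1 < p.2}.indicator
          (fun p => ENNReal.ofReal (Real.exp (-p.2))) (r, u)) ∂ν := by
        refine lintegral_congr fun r => ?_
        rw [negExp_eq_lintegral (hIoc t r), ← lintegral_indicator measurableSet_Ioi]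
        rfl
    _ = ∫⁻ u, ∫⁻ r in Ioi t, {p : ℝ × ℝ | V p.1 < p.2}.indicator
          (fun p => ENNReal.ofReal (Real.exp (-p.2))) (r, u) ∂ν := by
        refine lintegral_lintegral_swap (Measurable.aemeasurable ?_)
        exact Measurable.indicator (by fun_prop)
          (measurableSet_lt (hmV.comp measurable_fst) measurable_snd)
    _ = ∫⁻ u, ENNReal.ofReal (Real.exp (-u)) * ENNReal.ofReal u := by
        refine lintegral_congr fun u => ?_
        have hms : MeasurableSet {r | V r < u} := measurableSet_lt hmV measurable_const
        rw [← hclock u, ← Measure.restrict_apply hms, ← lintegral_indicator_const hms]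
        rfl
    _ = 1 := lintegral_exp_neg_mul_ofReal

/-- The probability weight that a Poisson process of intensity `η`, whose points `x` beyond `t` are
weighted by `g x`, has no point up to `t`: `exp(-η(-∞, t] - ∫_{(t, ∞)} (1 - g) dη)`. -/
noncomputable def tailWeight (η : Measure ℝ) (g : ℝ → ℝ≥0∞) (t : ℝ) : ℝ≥0∞ :=
  negExp (η (Iic t) + ∫⁻ x in Ioi t, (1 - g x) ∂η)

lemma measurable_tailWeight (η : Measure ℝ) (g : ℝ → ℝ≥0∞) : Measurable (tailWeight η g) := by
  refine measurable_negExp.comp (Measurable.add ?_ ?_)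
  · exact Monotone.measurable fun a b hab => measure_mono (Iic_subset_Iic.2 hab)
  · exact Antitone.measurable fun a b hab => lintegral_mono_set (Ioi_subset_Ioi hab)

/-- Decomposition of `tailWeight` according to the location of the first point beyond `t`. -/
lemma lintegral_mul_tailWeight (η : Measure ℝ) [NullSingletonClass η]
    (hfin : ∀ r, η (Iic r) ≠ ∞) (hinf : η univ = ∞) {g : ℝ → ℝ≥0∞} (hg : Measurable g)
    (hg1 : ∀ x, g x ≤ 1) (t : ℝ) :
    ∫⁻ r in Ioi t, g r * tailWeight η g r ∂η = tailWeight η g t := by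
  have hsplit : ∀ r ∈ Ioi t, (∫⁻ x in Ioi t, (1 - g x) ∂η) =
      (∫⁻ x in Ioc t r, (1 - g x) ∂η) + ∫⁻ x in Ioi r, (1 - g x) ∂η := fun r hr => by
    rw [← Ioc_union_Ioi_eq_Ioi (le_of_lt hr), lintegral_union measurableSet_Ioi]
    exact Set.disjoint_left.2 fun x hx hx' => absurd hx.2 (not_le.2 hx')
  have hlf : IsLocallyFiniteMeasure η := ⟨fun x =>
    ⟨Iic (x + 1), Iic_mem_nhds (by linarith), (hfin _).lt_top⟩⟩
  have hone : ∀ s : Set ℝ, η s = (η.withDensity g) s + ∫⁻ x in s, (1 - g x) ∂η := by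
    intro s
    rw [withDensity_apply' _ s, ← lintegral_add_left hg]
    simp_rw [add_tsub_cancel_of_le (hg1 _)]
    simp
  have hIoc : ∀ r, η (Ioc t r) ≠ ∞ := fun r =>
    ne_top_of_le_ne_top (hfin r) (measure_mono Ioc_subset_Iic_self)
  have hle : ∀ r, ∫⁻ x in Ioc t r, (1 - g x) ∂η ≠ ∞ := fun r =>
    ne_top_of_le_ne_top (hIoc r) (by rw [hone (Ioc t r)]; exact le_add_self)
  by_cases hL : ∫⁻ x in Ioi t, (1 - g x) ∂η = ∞
  · rw [tailWeight, hL, add_top, negExp_top, setLIntegral_congr_fun (g := fun _ => 0)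
      measurableSet_Ioi, lintegral_zero]
    intro r hr
    have : ∫⁻ x in Ioi r, (1 - g x) ∂η = ∞ := by
      have := (hsplit r hr).symm.trans hL
      exact (ENNReal.add_eq_top.1 this).resolve_left (hle r)
    simp only [tailWeight, this, add_top, negExp_top, mul_zero]
  · have hnull : NullSingletonClass (η.withDensity g) := ⟨fun x =>
      withDensity_absolutelyContinuous η g (measure_singleton x)⟩
    have hle' : ∀ s, (η.withDensity g) s ≤ η s := fun s => by
      rw [hone s]; exact le_self_add
    have hmain := lintegral_negExp_measure_Ioc (η.withDensity g)
      (fun r => ne_top_of_le_ne_top (hfin r) (hle' _)) (t := t) (by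
        have h1 : η (Ioi t) = ∞ := by
          by_contra h
          have := measure_union_le (μ := η) (Iic t) (Ioi t)
          rw [Iic_union_Ioi, hinf, top_le_iff, ENNReal.add_eq_top] at this
          exact this.elim (hfin t) h
        rw [hone] at h1
        exact (ENNReal.add_eq_top.1 h1).resolve_right hL)
    have hm : Measurable fun r => negExp ((η.withDensity g) (Ioc t r)) :=
      measurable_negExp.comp
        (Monotone.measurable fun a b hab => measure_mono (Ioc_subset_Ioc_right hab))
    rw [setLIntegral_withDensity_eq_setLIntegral_mul _ hg hm measurableSet_Ioi] at hmain
    have hZ : ∀ r ∈ Ioi t, g r * tailWeight η g r =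
        tailWeight η g t * (g r * negExp ((η.withDensity g) (Ioc t r))) := by
      intro r hr
      have hdisj : Disjoint (Iic t) (Ioc t r) :=
        Set.disjoint_left.2 fun x hx hx' => absurd hx'.1 (not_lt.2 hx)
      have : tailWeight η g r = tailWeight η g t * negExp ((η.withDensity g) (Ioc t r)) := by
        rw [tailWeight, tailWeight, ← negExp_add, hsplit r hr,
          ← Iic_union_Ioc_eq_Iic (le_of_lt hr), measure_union hdisj measurableSet_Ioc,
          hone (Ioc t r)]
        congr 1
        ring
      rw [this]; ring
    rw [setLIntegral_congr_fun measurableSet_Ioi hZ, lintegral_const_mul _ (by exact hg.mul hm)]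
    simp only [Pi.mul_apply] at hmain
    rw [hmain, mul_one]

/-! ### Finite measures on the chamber of increasing vectors -/

/-- The set of the vectors whose first `m` coordinates lie in the sets `I i` and whose last
coordinate is greater than `t`. -/
def openBox {m : ℕ} (I : Fin m → Set ℝ) (t : ℝ) : Set (Fin (m + 1) → ℝ) :=
  {r | (∀ i : Fin m, r i.castSucc ∈ I i) ∧ t < r (Fin.last m)}

lemma measurableSet_openBox {m : ℕ} {I : Fin m → Set ℝ} (hI : ∀ i, MeasurableSet (I i)) (t : ℝ) :
    MeasurableSet (openBox I t) := by
  have : openBox I t = (⋂ i : Fin m, (fun r : Fin (m + 1) → ℝ => r i.castSucc) ⁻¹' I i) ∩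
      (fun r => r (Fin.last m)) ⁻¹' Ioi t := by
    ext r; simp [openBox]
  rw [this]
  have hm : ∀ k, Measurable fun r : Fin (m + 1) → ℝ => r k := fun k => measurable_pi_apply k
  exact (MeasurableSet.iInter fun i => hm i.castSucc (hI i)).inter (hm _ measurableSet_Ioi)

/-- The sets `I i` are arranged in increasing order below `t`. -/
structure IsSeparated {m : ℕ} (I : Fin m → Set ℝ) (t : ℝ) : Prop where
  measurableSet : ∀ i, MeasurableSet (I i)
  lt : ∀ i j, i < j → ∀ x ∈ I i, ∀ y ∈ I j, x < y
  le : ∀ i, ∀ x ∈ I i, x ≤ t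

lemma IsSeparated.openBox_subset {m : ℕ} {I : Fin m → Set ℝ} {t : ℝ} (h : IsSeparated I t) :
    openBox I t ⊆ {r | StrictMono r} := by
  rintro r ⟨h1, h2⟩
  intro i j hij
  obtain ⟨i, rfl⟩ := Fin.exists_castSucc_eq.2 (ne_of_lt (hij.trans_le (Fin.le_last j)))
  rcases Fin.eq_castSucc_or_eq_last j with ⟨j, rfl⟩ | rfl
  · exact h.lt i j (by simpa using hij) _ (h1 i) _ (h1 j)
  · exact (h.le i _ (h1 i)).trans_lt h2

lemma measurableSet_strictMono (n : ℕ) : MeasurableSet {r : Fin n → ℝ | StrictMono r} := by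
  have : {r : Fin n → ℝ | StrictMono r} = ⋂ i, ⋂ j, ⋂ _ : i < j, {r | r i < r j} := by
    ext r; simp [StrictMono]
  rw [this]
  exact MeasurableSet.iInter fun i => MeasurableSet.iInter fun j => MeasurableSet.iInter fun _ =>
    measurableSet_lt (measurable_pi_apply i) (measurable_pi_apply j)

/-- Two measures on `ℝ^{m+1}` agree on the chamber of increasing vectors if they agree on the boxes
with separated sides, the last side being a half-line. -/
lemma restrict_strictMono_eq {m : ℕ} (μ ν : Measure (Fin (m + 1) → ℝ)) [IsFiniteMeasure μ]
    (h : ∀ I : Fin m → Set ℝ, ∀ t, IsSeparated I t → μ (openBox I t) = ν (openBox I t)) :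
    μ.restrict {r | StrictMono r} = ν.restrict {r | StrictMono r} := by
  -- boxes cut out by rational points between consecutive coordinates cover the chamber
  let I : (Fin m → ℚ) × ℚ → Fin m → Set ℝ := fun q i =>
    Iic (q.1 i : ℝ) ∩ (⋂ j, ⋂ _ : j < i, Ioi (q.1 j : ℝ)) ∩ Iic (q.2 : ℝ)
  have hIm : ∀ q i, MeasurableSet (I q i) := fun q i =>
    (measurableSet_Iic.inter (MeasurableSet.iInter fun j => MeasurableSet.iInter fun _ =>
      measurableSet_Ioi)).inter measurableSet_Iic
  have hsep : ∀ q, ∀ s : Fin m → Set ℝ, (∀ i, MeasurableSet (s i)) → ∀ u : ℝ,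
      IsSeparated (fun i => I q i ∩ s i) (max q.2 u) := by
    intro q s hs u
    refine ⟨fun i => (hIm q i).inter (hs i), fun i j hij x hx y hy => ?_, fun i x hx =>
      hx.1.2.trans (le_max_left _ _)⟩
    have h1 : x ≤ q.1 i := hx.1.1.1
    have h2 : (q.1 i : ℝ) < y := by
      have := hy.1.1.2
      simp only [mem_iInter] at this
      exact this i hij
    exact h1.trans_lt h2
  have hcover : {r : Fin (m + 1) → ℝ | StrictMono r} = ⋃ q, openBox (I q) q.2 := by
    apply Subset.antisymm
    · intro r hr
      have hr' : StrictMono r := hr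
      have h1 : ∀ i : Fin m, ∃ a : ℚ, r i.castSucc < a ∧ (a : ℝ) < r i.succ := fun i =>
        exists_rat_btwn (hr' Fin.castSucc_lt_succ)
      choose a ha1 ha2 using h1
      have h2 : ∃ t, (∀ i : Fin m, r i.castSucc < t) ∧ t < r (Fin.last m) := by
        have hev : ∀ᶠ t in nhdsWithin (r (Fin.last m)) (Iio (r (Fin.last m))),
            (∀ i : Fin m, r i.castSucc < t) ∧ t < r (Fin.last m) := by
          refine (Filter.eventually_all.2 fun i => ?_).and self_mem_nhdsWithin
          exact mem_nhdsWithin_of_mem_nhds (Ioi_mem_nhds (hr' (Fin.castSucc_lt_last i)))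
        exact hev.exists
      obtain ⟨t, ht1, ht2⟩ := h2
      obtain ⟨b, hb1, hb2⟩ := exists_rat_btwn ht2
      refine mem_iUnion.2 ⟨(a, b), fun i => ⟨⟨(ha1 i).le, ?_⟩, ((ht1 i).trans hb1).le⟩, hb2⟩
      simp only [mem_iInter]
      intro j hj
      exact (ha2 j).trans_le (hr'.monotone (by
        rw [Fin.le_iff_val_le_val]; simpa [Nat.succ_le_iff] using hj))
    · refine iUnion_subset fun q => ?_
      have := hsep q (fun _ => univ) (fun _ => MeasurableSet.univ) q.2
      simp only [inter_univ, max_self] at this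
      exact this.openBox_subset
  rw [hcover, Measure.restrict_iUnion_congr]
  intro q
  have hgen : (inferInstance : MeasurableSpace (Fin (m + 1) → ℝ)) =
      MeasurableSpace.generateFrom (univ.pi '' univ.pi (fun _ => range Ioi)) := by
    have hsp : ∀ _ : Fin (m + 1), IsCountablySpanning (range (Ioi : ℝ → Set ℝ)) := fun _ =>
      ⟨fun n => Ioi (-(n : ℝ)), fun n => mem_range_self _, iUnion_eq_univ_iff.2 fun x => by
        obtain ⟨n, hn⟩ := exists_nat_gt (-x)
        exact ⟨n, by simp only [mem_Ioi]; linarith⟩⟩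
    have := generateFrom_pi_eq hsp
    rw [← this]
    refine congrArg (fun m' : Fin (m + 1) → MeasurableSpace ℝ => @MeasurableSpace.pi _ _ m')
      (funext fun _ => ?_)
    rw [← borel_eq_generateFrom_Ioi]
    exact BorelSpace.measurable_eq
  have hbox : ∀ x : Fin (m + 1) → ℝ, univ.pi (fun i => Ioi (x i)) ∩ openBox (I q) q.2 =
      openBox (fun i => I q i ∩ Ioi (x i.castSucc)) (max q.2 (x (Fin.last m))) := by
    intro x
    ext r
    simp only [mem_inter_iff, mem_pi, mem_univ, true_implies, Fin.forall_fin_succ', openBox,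
      mem_ofPred_eq, mem_Ioi, max_lt_iff, forall_and]
    tauto
  refine ext_of_generate_finite _ hgen (IsPiSystem.pi fun _ => isPiSystem_Ioi) ?_ ?_
  · rintro _ ⟨s, hs, rfl⟩
    choose x hx using fun i => hs i (mem_univ i)
    obtain rfl : (fun i => Ioi (x i)) = s := funext hx
    have hm : MeasurableSet (univ.pi fun i => Ioi (x i)) :=
      MeasurableSet.univ_pi fun i => measurableSet_Ioi
    rw [Measure.restrict_apply hm, Measure.restrict_apply hm, hbox]
    exact h _ _ (hsep q _ (fun i => measurableSet_Ioi) _)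
  · have := hsep q (fun _ => univ) (fun _ => MeasurableSet.univ) q.2
    simp only [inter_univ, max_self] at this
    simpa using h _ _ this

/-! ### The first points of a Poisson process -/

/-- An increasing sequence has its first `m` terms in the separated sets `I i` and its next term
beyond `t` iff each `I i` contains one term and no other term is `≤ t`. -/
lemma mem_openBox_iff {m : ℕ} {I : Fin m → Set ℝ} {t : ℝ} (h : IsSeparated I t) {σ : ℕ → ℝ}
    (hσ : StrictMono σ) :
    (fun k : Fin (m + 1) => σ k) ∈ openBox I t ↔
      (∀ i, ∑' l, (I i).indicator (1 : ℝ → ℝ≥0∞) (σ l) = 1) ∧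
        ∑' l, (Iic t \ ⋃ i, I i).indicator (1 : ℝ → ℝ≥0∞) (σ l) = 0 := by
  have hind0 : ∀ (B : Set ℝ) x, B.indicator (1 : ℝ → ℝ≥0∞) x = 0 ↔ x ∉ B := by simp
  constructor
  · rintro ⟨h1, h2⟩
    simp only [Fin.val_castSucc, Fin.val_last] at h1 h2
    have hlt : ∀ l, σ l ≤ t → ∃ i : Fin m, (i : ℕ) = l := fun l hl => by
      have : l < m := by
        by_contra hn
        exact absurd hl (not_le.2 (h2.trans_le (hσ.monotone (not_lt.1 hn))))
      exact ⟨⟨l, this⟩, rfl⟩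
    constructor
    · intro i
      rw [tsum_eq_single (i : ℕ), Set.indicator_of_mem (h1 i), Pi.one_apply]
      intro l hl
      rw [hind0]
      intro hmem
      obtain ⟨j, rfl⟩ := hlt l (h.le i _ hmem)
      rcases lt_trichotomy i j with hij | rfl | hij
      · exact absurd (h.lt i j hij _ hmem _ (h1 j)) (lt_irrefl _)
      · exact hl rfl
      · exact absurd (h.lt j i hij _ (h1 j) _ hmem) (lt_irrefl _)
    · rw [ENNReal.tsum_eq_zero]
      intro l
      rw [hind0]
      rintro ⟨hl, hn⟩
      obtain ⟨j, rfl⟩ := hlt l hl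
      exact hn (mem_iUnion.2 ⟨j, h1 j⟩)
  · rintro ⟨h1, h2⟩
    have hex : ∀ i, ∃ l, σ l ∈ I i := by
      intro i
      by_contra hn
      push Not at hn
      have : ∑' l, (I i).indicator (1 : ℝ → ℝ≥0∞) (σ l) = 0 :=
        ENNReal.tsum_eq_zero.2 fun l => (hind0 _ _).2 (hn l)
      rw [h1 i] at this
      exact one_ne_zero this
    choose L hL using hex
    have huniq : ∀ i l, σ l ∈ I i → l = L i := by
      intro i l hl
      by_contra hne
      have := ENNReal.sum_le_tsum (f := fun l => (I i).indicator (1 : ℝ → ℝ≥0∞) (σ l)) {l, L i}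
      rw [Finset.sum_pair hne, h1 i, Set.indicator_of_mem hl, Set.indicator_of_mem (hL i)] at this
      norm_num at this
    have hmono : StrictMono L := fun i j hij => hσ.lt_iff_lt.1 (h.lt i j hij _ (hL i) _ (hL j))
    have hrange : ∀ l, σ l ≤ t → ∃ i, L i = l := by
      intro l hl
      have := (hind0 _ _).1 (ENNReal.tsum_eq_zero.1 h2 l)
      simp only [mem_sdiff, mem_Iic, hl, true_and, not_not, mem_iUnion] at this
      obtain ⟨i, hi⟩ := this
      exact ⟨i, (huniq i l hi).symm⟩
    have hLi : ∀ i, L i = i := by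
      intro i
      have himg : (Finset.Iic i).image L = Finset.range (L i + 1) := by
        ext l
        simp only [Finset.mem_image, Finset.mem_Iic, Finset.mem_range, Nat.lt_succ_iff]
        constructor
        · rintro ⟨j, hj, rfl⟩
          exact hmono.monotone hj
        · intro hl
          obtain ⟨j, rfl⟩ := hrange l ((hσ.monotone hl).trans (h.le i _ (hL i)))
          exact ⟨j, hmono.le_iff_le.1 hl, rfl⟩
      have hcard := congrArg Finset.card himg
      rw [Finset.card_image_of_injective _ hmono.injective, Finset.card_range,
        Fin.card_Iic] at hcard
      omega
    refine ⟨fun i => ?_, ?_⟩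
    · have := hL i
      rw [hLi i] at this
      simpa using this
    · simp only [Fin.val_last]
      by_contra hn
      obtain ⟨i, hi⟩ := hrange m (not_lt.1 hn)
      have := hLi i
      omega

namespace IsPoissonProcess

variable {Ω : Type*} [MeasurableSpace Ω] {P : Measure Ω} {η : Measure ℝ} {ρ : ℕ → Ω → ℝ}

lemma lintegral_indicator_count (h : IsPoissonProcess P η ρ) {B : Set ℝ} (hB : MeasurableSet B)
    (hη : η B ≠ ∞) (n : ℕ) :
    ∫⁻ ω, ({(n : ℝ≥0∞)} : Set ℝ≥0∞).indicator (1 : ℝ≥0∞ → ℝ≥0∞)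
        (∑' l, B.indicator (1 : ℝ → ℝ≥0∞) (ρ l ω)) ∂P =
      η B ^ n * negExp (η B) / n.factorial := by
  have hm : MeasurableSet ({(n : ℝ≥0∞)} : Set ℝ≥0∞) := measurableSet_singleton _
  rw [← lintegral_map (measurable_one.indicator hm) (h.measurable_count hB),
    (h.hasLaw_count B hB hη).map_eq, lintegral_indicator_one hm,
    Measure.map_apply .of_discrete hm,
    show (Nat.cast : ℕ → ℝ≥0∞) ⁻¹' {(n : ℝ≥0∞)} = {n} by ext; simp, poissonMeasure_singleton]
  conv_rhs => rw [← ENNReal.ofReal_toReal hη]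
  rw [negExp_ofReal ENNReal.toReal_nonneg, ← ENNReal.ofReal_pow ENNReal.toReal_nonneg,
    ← ENNReal.ofReal_mul (by positivity), ← ENNReal.ofReal_natCast,
    ← ENNReal.ofReal_div_of_pos (by positivity), mul_comm (Real.exp _)]
  rfl

/-- The first points fall into separated sets and the next one beyond `t`: the probability of this
event, weighted by the Laplace functional of the later points. -/
lemma lintegral_openBox_mul_negExp [IsProbabilityMeasure P] (h : IsPoissonProcess P η ρ)
    (hη : ∀ t, η (Iic t) ≠ ∞) (hmono : ∀ᵐ ω ∂P, StrictMono fun l => ρ l ω) {m : ℕ}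
    {I : Fin m → Set ℝ} {t : ℝ} (hI : IsSeparated I t) {f : ℝ → ℝ≥0∞} (hf : Measurable f) :
    ∫⁻ ω, (openBox I t).indicator 1 (fun k : Fin (m + 1) => ρ k ω) *
        negExp (∑' l, f (ρ (l + m) ω)) ∂P =
      (∏ i, η (I i)) * tailWeight η (fun x => negExp (f x)) t := by
  let C : Set ℝ := Iic t \ ⋃ i, I i
  have hU : MeasurableSet (⋃ i, I i) := MeasurableSet.iUnion hI.measurableSet
  have hC : MeasurableSet C := measurableSet_Iic.diff hU
  have hIt : ∀ i, I i ⊆ Iic t := fun i x hx => hI.le i x hx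
  have hdI : Pairwise (fun i j => Disjoint (I i) (I j)) := by
    intro i j hij
    refine Set.disjoint_left.2 fun x hx hx' => ?_
    rcases lt_or_gt_of_ne hij with hij | hij
    · exact lt_irrefl _ (hI.lt _ _ hij _ hx _ hx')
    · exact lt_irrefl _ (hI.lt _ _ hij _ hx' _ hx)
  have hCI : ∀ i, Disjoint (I i) C := fun i =>
    Set.disjoint_left.2 fun x hx hx' => hx'.2 (mem_iUnion.2 ⟨i, hx⟩)
  have hfin : ∀ s ⊆ Iic t, η s ≠ ∞ := fun s hs => ne_top_of_le_ne_top (hη t) (measure_mono hs)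
  have hCt : C ⊆ Iic t := sdiff_subset
  let one : ℝ≥0∞ → ℝ≥0∞ := ({((1 : ℕ) : ℝ≥0∞)} : Set ℝ≥0∞).indicator 1
  let zero : ℝ≥0∞ → ℝ≥0∞ := ({((0 : ℕ) : ℝ≥0∞)} : Set ℝ≥0∞).indicator 1
  have h1m : Measurable one := measurable_one.indicator (measurableSet_singleton _)
  have h0m : Measurable zero := measurable_one.indicator (measurableSet_singleton _)
  have hle1 : ∀ (s : Set ℝ≥0∞) x, s.indicator (1 : ℝ≥0∞ → ℝ≥0∞) x ≤ 1 := fun s x =>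
    Set.indicator_le_self s (1 : ℝ≥0∞ → ℝ≥0∞) x
  have key := h.lintegral_prod_count_mul_negExp hη (ι := Fin m ⊕ Unit)
    (Sum.elim I (fun _ => C)) (by rintro (i | _); exacts [hI.measurableSet i, hC])
    (by
      rintro (i | _) (j | _) hij
      · exact hdI (fun e => hij (by rw [e]))
      · exact hCI i
      · exact (hCI j).symm
      · exact absurd rfl hij)
    (Sum.elim (fun _ => one) (fun _ => zero)) (by rintro (i | _); exacts [h1m, h0m])
    (by rintro (i | _) x; exacts [hle1 _ x, hle1 _ x])
    (f := (Ioi t).indicator f) (hf.indicator measurableSet_Ioi)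
    (by
      rintro (i | _) x hx
      · exact Set.indicator_of_notMem (not_lt.2 (hIt i hx)) _
      · exact Set.indicator_of_notMem (not_lt.2 (hCt hx)) _)
  simp only [Fintype.prod_sum_type, Sum.elim_inl, Sum.elim_inr, Finset.univ_unique,
    Finset.prod_const, Finset.card_singleton, pow_one] at key
  calc _ = ∫⁻ ω, ((∏ i, one (∑' l, (I i).indicator (1 : ℝ → ℝ≥0∞) (ρ l ω))) *
          zero (∑' l, C.indicator (1 : ℝ → ℝ≥0∞) (ρ l ω))) *
          negExp (∑' l, (Ioi t).indicator f (ρ l ω)) ∂P := by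
        refine lintegral_congr_ae ?_
        filter_upwards [hmono] with ω hω
        by_cases hbox : (fun k : Fin (m + 1) => ρ k ω) ∈ openBox I t
        · obtain ⟨h1, h2⟩ := (mem_openBox_iff hI hω).1 hbox
          have hs : ∑' l, f (ρ (l + m) ω) = ∑' l, (Ioi t).indicator f (ρ l ω) := by
            rw [← Summable.sum_add_tsum_nat_add' (k := m)
              (f := fun l => (Ioi t).indicator f (ρ l ω)) ENNReal.summable, Finset.sum_eq_zero,
              zero_add]
            · refine tsum_congr fun l => (Set.indicator_of_mem ?_ _).symm
              exact hbox.2.trans_le (hω.monotone (by simp))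
            · intro l hl
              exact Set.indicator_of_notMem
                (not_lt.2 (hI.le _ _ (hbox.1 ⟨l, Finset.mem_range.1 hl⟩))) _
          have hC0 : ∑' l, C.indicator (1 : ℝ → ℝ≥0∞) (ρ l ω) = 0 := h2
          rw [Set.indicator_of_mem hbox, hs, hC0]
          simp [h1, one, zero]
        · rw [Set.indicator_of_notMem hbox, zero_mul]
          rw [mem_openBox_iff hI hω, not_and_or] at hbox
          rcases hbox with hb | hb
          · push Not at hb
            obtain ⟨i, hi⟩ := hb
            rw [Finset.prod_eq_zero (Finset.mem_univ i), zero_mul, zero_mul]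
            exact Set.indicator_of_notMem (by simpa using hi) _
          · have : zero (∑' l, C.indicator (1 : ℝ → ℝ≥0∞) (ρ l ω)) = 0 :=
              Set.indicator_of_notMem (by simpa [-ENNReal.tsum_eq_zero] using hb) _
            rw [this, mul_zero, zero_mul]
    _ = _ := by
        rw [key]
        have e1 : ∀ i, ∫⁻ ω, one (∑' l, (I i).indicator (1 : ℝ → ℝ≥0∞) (ρ l ω)) ∂P =
            η (I i) * negExp (η (I i)) := fun i => by
          have := h.lintegral_indicator_count (hI.measurableSet i) (hfin _ (hIt i)) 1
          rw [pow_one, Nat.factorial_one, Nat.cast_one, div_one] at this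
          simpa only [one, Nat.cast_one] using this
        have e0 : ∫⁻ ω, zero (∑' l, C.indicator (1 : ℝ → ℝ≥0∞) (ρ l ω)) ∂P = negExp (η C) := by
          have := h.lintegral_indicator_count hC (hfin _ hCt) 0
          rw [pow_zero, Nat.factorial_zero, Nat.cast_one, div_one, one_mul] at this
          exact this
        have e2 : η (Iic t) = ∑ i, η (I i) + η C := by
          have hsub : ⋃ i, I i ⊆ Iic t := iUnion_subset hIt
          have := measure_add_sdiff hU.nullMeasurableSet (Iic t) (μ := η)
          rw [union_eq_self_of_subset_left hsub, measure_iUnion hdI hI.measurableSet,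
            tsum_fintype] at this
          exact this.symm
        have e3 : ∫⁻ x, (1 - negExp ((Ioi t).indicator f x)) ∂η =
            ∫⁻ x in Ioi t, (1 - negExp (f x)) ∂η := by
          rw [← lintegral_indicator measurableSet_Ioi]
          refine lintegral_congr fun x => ?_
          by_cases hx : x ∈ Ioi t <;> simp [hx]
        simp_rw [e1]
        rw [e0, e3, tailWeight, e2, negExp_add, negExp_add, negExp_sum, Finset.prod_mul_distrib]
        ring

/-- The joint law of the first `m + 1` points `r` of a Poisson process on the line and of the
remaining points: the first points have, with respect to `η^{m+1}` on increasing vectors, the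
density `exp(-η(-∞, r_m])`, and given these the remaining points form a Poisson process of
intensity `η` on `(r_m, ∞)`, with its Laplace functional.

Both sides are compared on boxes after multiplication by `e^{-f(r_m)}`; this makes the `m`-th point
one of the remaining points, so that the two parts of the box event are independent. -/
theorem lintegral_first_mul_negExp [IsProbabilityMeasure P] (h : IsPoissonProcess P η ρ)
    [NullSingletonClass η] [SigmaFinite η] (hη : ∀ t, η (Iic t) ≠ ∞) (hinf : η univ = ∞)
    (hmono : ∀ᵐ ω ∂P, StrictMono fun l => ρ l ω) (m : ℕ) {f : ℝ → ℝ≥0∞} (hf : Measurable f)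
    (hft : ∀ x, f x ≠ ∞) {Φ : (Fin (m + 1) → ℝ) → ℝ≥0∞} (hΦ : Measurable Φ) :
    ∫⁻ ω, Φ (fun k => ρ k ω) * negExp (∑' l, f (ρ (l + (m + 1)) ω)) ∂P =
      ∫⁻ r in {r | StrictMono r}, Φ r * tailWeight η (fun x => negExp (f x)) (r (Fin.last m))
        ∂Measure.pi (fun _ => η) := by
  set g : ℝ → ℝ≥0∞ := fun x => negExp (f x) with hgdef
  have hg : Measurable g := measurable_negExp.comp hf
  have hg1 : ∀ x, g x ≤ 1 := fun x => negExp_le_one _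
  have hg0 : ∀ x, g x ≠ 0 := fun x => negExp_ne_zero (hft x)
  have hgt : ∀ x, g x ≠ ∞ := fun x => negExp_ne_top _
  have hZ := measurable_tailWeight η g
  have hlast : Measurable fun r : Fin (m + 1) → ℝ => r (Fin.last m) := measurable_pi_apply _
  let R : Ω → Fin (m + 1) → ℝ := fun ω k => ρ k ω
  have hR : Measurable R := measurable_pi_lambda _ fun k => h.measurable k
  let w : Ω → ℝ≥0∞ := fun ω => negExp (∑' l, f (ρ (l + m) ω))
  have hw : Measurable w := measurable_negExp.comp
    (Measurable.tsum fun l => hf.comp (h.measurable _))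
  let U : Set (Fin (m + 1) → ℝ) := {r | StrictMono r}
  have hU : MeasurableSet U := measurableSet_strictMono _
  let μ : Measure (Fin (m + 1) → ℝ) := (P.withDensity w).map R
  let v : (Fin (m + 1) → ℝ) → ℝ≥0∞ := fun r => g (r (Fin.last m)) * tailWeight η g (r (Fin.last m))
  have hv : Measurable v := (hg.comp hlast).mul (hZ.comp hlast)
  let ν : Measure (Fin (m + 1) → ℝ) := (Measure.pi (fun _ => η)).withDensity v
  have hfinP : IsFiniteMeasure (P.withDensity w) := isFiniteMeasure_withDensity
    (ne_top_of_le_ne_top ENNReal.one_ne_top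
      ((lintegral_mono fun ω => negExp_le_one _).trans (by simp)))
  have hμ : ∀ Ψ : (Fin (m + 1) → ℝ) → ℝ≥0∞, Measurable Ψ →
      ∫⁻ r, Ψ r ∂μ = ∫⁻ ω, Ψ (R ω) * w ω ∂P := by
    intro Ψ hΨ
    have hΨR : Measurable fun ω => Ψ (R ω) := hΨ.comp hR
    rw [lintegral_map hΨ hR, lintegral_withDensity_eq_lintegral_mul _ hw hΨR]
    exact lintegral_congr fun ω => mul_comm _ _
  have hμν : μ.restrict U = ν.restrict U := by
    refine restrict_strictMono_eq μ ν fun I t hI => ?_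
    have hbm := measurableSet_openBox hI.measurableSet t
    rw [← lintegral_indicator_one hbm, hμ _ (measurable_one.indicator hbm)]
    rw [withDensity_apply _ hbm, h.lintegral_openBox_mul_negExp hη hmono hI hf,
      ← lintegral_mul_tailWeight η hη hinf hg hg1 t, ← lintegral_indicator hbm]
    let F : Fin (m + 1) → ℝ → ℝ≥0∞ := Fin.snoc (fun i => (I i).indicator 1)
      ((Ioi t).indicator fun x => g x * tailWeight η g x)
    have hF : ∀ i, Measurable (F i) := by
      refine Fin.forall_fin_succ'.2 ⟨fun i => ?_, ?_⟩
      · simp only [F, Fin.snoc_castSucc]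
        exact measurable_one.indicator (hI.measurableSet i)
      · simp only [F, Fin.snoc_last]
        exact (hg.mul hZ).indicator measurableSet_Ioi
    have hpi := lintegral_pi_prod η F hF
    simp only [Fin.prod_univ_castSucc] at hpi
    simp only [F, Fin.snoc_castSucc, Fin.snoc_last] at hpi
    simp only [lintegral_indicator_one (hI.measurableSet _), lintegral_indicator measurableSet_Ioi]
      at hpi
    rw [← hpi]
    refine lintegral_congr fun r => ?_
    by_cases hr : r ∈ openBox I t
    · rw [Set.indicator_of_mem hr, Set.indicator_of_mem (show r (Fin.last m) ∈ Ioi t from hr.2),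
        Finset.prod_eq_one, one_mul]
      intro i _
      rw [Set.indicator_of_mem (hr.1 i), Pi.one_apply]
    · rw [Set.indicator_of_notMem hr]
      by_cases hl : t < r (Fin.last m)
      · have : ∃ i : Fin m, r i.castSucc ∉ I i := by
          by_contra hcon
          push Not at hcon
          exact hr ⟨hcon, hl⟩
        obtain ⟨i, hi⟩ := this
        rw [Finset.prod_eq_zero (Finset.mem_univ i) (Set.indicator_of_notMem hi _), zero_mul]
      · rw [Set.indicator_of_notMem (show r (Fin.last m) ∉ Ioi t from hl), mul_zero]
  have hmU : ∀ᵐ ω ∂P, R ω ∈ U := by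
    filter_upwards [hmono] with ω hω
    exact fun i j hij => hω hij
  have hginv : Measurable fun r : Fin (m + 1) → ℝ => (g (r (Fin.last m)))⁻¹ :=
    (hg.comp hlast).inv
  have hΦg : Measurable fun r : Fin (m + 1) → ℝ => Φ r * (g (r (Fin.last m)))⁻¹ := hΦ.mul hginv
  calc _ = ∫⁻ ω, U.indicator (fun r => Φ r * (g (r (Fin.last m)))⁻¹) (R ω) * w ω ∂P := by
        refine lintegral_congr_ae ?_
        filter_upwards [hmU] with ω hω
        have hsum : ∑' l, f (ρ (l + m) ω) = f (ρ m ω) + ∑' l, f (ρ (l + (m + 1)) ω) := by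
          rw [tsum_eq_zero_add' ENNReal.summable]
          simp only [zero_add]
          congr 1
          exact tsum_congr fun l => by rw [add_right_comm, add_assoc]
        rw [Set.indicator_of_mem hω]
        simp only [w, hsum, negExp_add]
        rw [mul_assoc, ← mul_assoc (g _)⁻¹]
        have : g (R ω (Fin.last m)) = negExp (f (ρ m ω)) := rfl
        rw [← this, ENNReal.inv_mul_cancel (hg0 _) (hgt _), one_mul]
    _ = ∫⁻ r in U, Φ r * (g (r (Fin.last m)))⁻¹ ∂μ := by
        rw [← hμ _ (hΦg.indicator hU), lintegral_indicator hU]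
    _ = _ := by
        rw [hμν, setLIntegral_withDensity_eq_setLIntegral_mul _ hv hΦg hU]
        refine lintegral_congr fun r => ?_
        simp only [Pi.mul_apply, v]
        calc _ = Φ r * tailWeight η g (r (Fin.last m)) *
              (g (r (Fin.last m)) * (g (r (Fin.last m)))⁻¹) := by ring
          _ = _ := by rw [ENNReal.mul_inv_cancel (hg0 _) (hgt _), mul_one]

end IsPoissonProcess

/-! ### Distances of a planar Poisson process -/

/-- The measure `2πλ r dr` on the half-line `r > 0`: the image of `λ` times the area under the
distance to the origin. -/
noncomputable def radialIntensity (lam : ℝ) : Measure ℝ :=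
  (volume.restrict (Ioi 0)).withDensity fun r => ENNReal.ofReal (2 * Real.pi * lam * r)

lemma measurable_radialDensity (lam : ℝ) :
    Measurable fun r : ℝ => ENNReal.ofReal (2 * Real.pi * lam * r) := by fun_prop

instance (lam : ℝ) : SigmaFinite (radialIntensity lam) := by
  unfold radialIntensity; infer_instance

instance (lam : ℝ) : NullSingletonClass (radialIntensity lam) :=
  ⟨fun x => withDensity_absolutelyContinuous _ _ (measure_singleton x)⟩

lemma radialIntensity_Iic {lam : ℝ} (hlam : 0 < lam) (t : ℝ) :
    radialIntensity lam (Iic t) = ENNReal.ofReal (Real.pi * lam * max t 0 ^ 2) := by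
  rw [radialIntensity, withDensity_apply _ measurableSet_Iic,
    Measure.restrict_restrict measurableSet_Iic]
  rcases le_or_gt t 0 with ht | ht
  · rw [max_eq_right ht, show Iic t ∩ Ioi 0 = ∅ from ?_]
    · simp
    · exact eq_empty_of_forall_notMem fun x hx => absurd (hx.2 : 0 < x) (not_lt.2 (hx.1.trans ht))
  · rw [max_eq_left ht.le, inter_comm, Ioi_inter_Iic, ← ofReal_integral_eq_lintegral_ofReal,
      ← intervalIntegral.integral_of_le ht.le, intervalIntegral.integral_const_mul, integral_id]
    · congr 1; ring
    · exact (Continuous.integrableOn_Icc (by fun_prop)).mono_set Ioc_subset_Icc_self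
    · filter_upwards [ae_restrict_mem measurableSet_Ioc] with x hx
      have := hx.1
      have := Real.pi_pos
      positivity

lemma radialIntensity_Iic_ne_top {lam : ℝ} (hlam : 0 < lam) (t : ℝ) :
    radialIntensity lam (Iic t) ≠ ∞ := by
  rw [radialIntensity_Iic hlam]; exact ENNReal.ofReal_ne_top

lemma radialIntensity_univ {lam : ℝ} (hlam : 0 < lam) : radialIntensity lam univ = ∞ := by
  refine ENNReal.eq_top_of_forall_nnreal_le fun v => ?_
  have hpos : 0 < Real.pi * lam := mul_pos Real.pi_pos hlam
  refine le_trans ?_ (measure_mono (subset_univ (Iic (Real.sqrt (v / (Real.pi * lam))))))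
  rw [radialIntensity_Iic hlam, max_eq_left (Real.sqrt_nonneg _), Real.sq_sqrt (by positivity),
    mul_div_cancel₀ _ hpos.ne', ENNReal.ofReal_coe_nnreal]

/-- Polar coordinates for radial functions. -/
lemma map_norm_volume_plane {lam : ℝ} (hlam : 0 < lam) :
    (ENNReal.ofReal lam • (volume : Measure Plane)).map (fun x => ‖x‖) = radialIntensity lam := by
  have hI : ∀ t, (ENNReal.ofReal lam • (volume : Measure Plane)).map (fun x => ‖x‖) (Iic t) =
      radialIntensity lam (Iic t) := by
    intro t
    have hpre : (fun x : Plane => ‖x‖) ⁻¹' Iic t = Metric.closedBall 0 t := by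
      ext x; simp
    rw [Measure.map_apply measurable_norm measurableSet_Iic, hpre, radialIntensity_Iic hlam,
      Measure.smul_apply, EuclideanSpace.volume_closedBall_fin_two, smul_eq_mul]
    rw [mul_comm (_ ^ 2), ← mul_assoc, mul_comm Real.pi,
      ENNReal.ofReal_mul (mul_pos hlam Real.pi_pos).le, ENNReal.ofReal_mul hlam.le,
      ENNReal.ofReal_pow (le_max_right _ _)]
    congr 2
    · rw [ENNReal.ofReal_max, ENNReal.ofReal_zero, max_eq_left zero_le]
  have hfin : ∀ t, (ENNReal.ofReal lam • (volume : Measure Plane)).map (fun x => ‖x‖) (Iic t) ≠ ∞ :=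
    fun t => by rw [hI]; exact radialIntensity_Iic_ne_top hlam t
  have : IsLocallyFiniteMeasure
      ((ENNReal.ofReal lam • (volume : Measure Plane)).map (fun x => ‖x‖)) := ⟨fun x =>
    ⟨Iic (x + 1), Iic_mem_nhds (by linarith), (hfin _).lt_top⟩⟩
  refine Measure.ext_of_Ioc _ _ fun a b hab => ?_
  rw [← Iic_sdiff_Iic, measure_sdiff (Iic_subset_Iic.2 hab.le) measurableSet_Iic.nullMeasurableSet
    (hfin a), measure_sdiff (Iic_subset_Iic.2 hab.le) measurableSet_Iic.nullMeasurableSet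
    (radialIntensity_Iic_ne_top hlam a), hI, hI]

/-- The distances to the origin of a homogeneous planar Poisson process. -/
lemma IsHomogeneousPPP.isPoissonProcess_norm {Ω : Type*} [MeasurableSpace Ω] {P : Measure Ω}
    {lam : ℝ} (hlam : 0 < lam) {X : ℕ → Ω → Plane} (h : IsHomogeneousPPP P lam X) :
    IsPoissonProcess P (radialIntensity lam) fun l ω => ‖X l ω‖ := by
  have hcount : ∀ B : Set ℝ, (fun ω => ∑' l, B.indicator (1 : ℝ → ℝ≥0∞) ‖X l ω‖) =
      pointCount X ((fun x => ‖x‖) ⁻¹' B) := fun B => rfl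
  have hη : ∀ B, MeasurableSet B → radialIntensity lam B =
      ENNReal.ofReal lam * volume ((fun x : Plane => ‖x‖) ⁻¹' B) := fun B hB => by
    rw [← map_norm_volume_plane hlam, Measure.map_apply measurable_norm hB, Measure.smul_apply,
      smul_eq_mul]
  refine ⟨fun l => (h.measurable l).norm, fun B hB hBt => ?_, fun n B hB hd => ?_⟩
  · rw [hη B hB] at hBt
    rw [hcount, hη B hB]
    refine h.hasLaw_count _ (measurable_norm hB) fun htop => hBt ?_
    rw [htop, ENNReal.mul_top (by simpa using hlam)]
  · exact h.indep_count n (fun i => (fun x => ‖x‖) ⁻¹' B i) (fun i => measurable_norm (hB i))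
      (fun i j hij => (hd hij).preimage _)

/-- The product of the radial measures has the product density. -/
lemma pi_radialIntensity (lam : ℝ) (n : ℕ) :
    Measure.pi (fun _ : Fin n => radialIntensity lam) =
      (volume.restrict (univ.pi fun _ => Ioi 0)).withDensity
        fun r => ∏ k, ENNReal.ofReal (2 * Real.pi * lam * r k) := by
  refine (Measure.pi_eq fun s hs => ?_)
  rw [withDensity_apply _ (MeasurableSet.univ_pi hs), volume_pi, Measure.restrict_pi_pi,
    ← lintegral_indicator (MeasurableSet.univ_pi hs)]
  have h := lintegral_pi_prod (volume.restrict (Ioi 0))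
    (fun i => (s i).indicator fun r => ENNReal.ofReal (2 * Real.pi * lam * r))
    (fun i => (measurable_radialDensity lam).indicator (hs i))
  simp_rw [radialIntensity, withDensity_apply _ (hs _), ← lintegral_indicator (hs _)]
  rw [← h]
  refine lintegral_congr fun r => ?_
  by_cases hr : r ∈ univ.pi s
  · rw [Set.indicator_of_mem hr]
    refine Finset.prod_congr rfl fun i _ => ?_
    rw [Set.indicator_of_mem (hr i (mem_univ i))]
  · rw [Set.indicator_of_notMem hr]
    simp only [mem_pi, mem_univ, true_implies, not_forall] at hr
    obtain ⟨i, hi⟩ := hr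
    exact (Finset.prod_eq_zero (Finset.mem_univ i) (Set.indicator_of_notMem hi _)).symm

/-- Two coordinates of a vector of `ℝ^n` are almost everywhere different. -/
lemma ae_injective (n : ℕ) : ∀ᵐ r : Fin n → ℝ, Function.Injective r := by
  have h : ∀ i j : Fin n, i ≠ j → ∀ᵐ r : Fin n → ℝ, r i ≠ r j := by
    intro i j hij
    let S : Submodule ℝ (Fin n → ℝ) :=
      LinearMap.ker ((LinearMap.proj i : (Fin n → ℝ) →ₗ[ℝ] ℝ) - LinearMap.proj j)
    have hS : S ≠ ⊤ := by
      intro htop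
      have : Pi.single i (1 : ℝ) ∈ S := htop ▸ Submodule.mem_top
      simp [S, hij.symm] at this
    have h0 := Measure.addHaar_submodule volume S hS
    refine (measure_eq_zero_iff_ae_notMem.1 h0).mono fun r hr he => hr ?_
    simp [S, he]
  filter_upwards [ae_all_iff.2 fun i => ae_all_iff.2 fun j => ae_all_iff.2 fun hij => h i j hij]
    with r hr i j hij
  by_contra hne
  exact hr i j hne hij

lemma orderedDistances_ae_eq (n : ℕ) :
    ((univ.pi fun _ => Ioi 0) ∩ {r | StrictMono r} : Set (Fin n → ℝ)) =ᵐ[volume]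
      orderedDistances n := by
  filter_upwards [ae_injective n] with r hr
  apply propext
  show (r ∈ univ.pi (fun _ => Ioi 0) ∧ StrictMono r) ↔ ((∀ k, 0 < r k) ∧ Monotone r)
  simp only [mem_pi, mem_univ, true_implies, mem_Ioi]
  exact and_congr_right fun _ => ⟨fun h => h.monotone, fun h => h.strictMono_of_injective hr⟩

lemma measurableSet_orderedDistances (n : ℕ) : MeasurableSet (orderedDistances n) := by
  have : orderedDistances n = (⋂ k, {r | 0 < r k}) ∩ ⋂ i, ⋂ j, ⋂ _ : i ≤ j, {r | r i ≤ r j} := by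
    ext r; simp [orderedDistances, Monotone]
  rw [this]
  exact (MeasurableSet.iInter fun k => measurableSet_lt measurable_const
    (measurable_pi_apply k)).inter (MeasurableSet.iInter fun i => MeasurableSet.iInter fun j =>
      MeasurableSet.iInter fun _ => measurableSet_le (measurable_pi_apply i)
        (measurable_pi_apply j))

/-! ### Laplace transforms of Nakagami fading -/

lemma one_sub_nakagamiF (N x : ℝ) : 1 - nakagamiF N x = 1 / (1 + x / N) ^ N := by
  unfold nakagamiF; ring

lemma nakagamiF_le_one {N x : ℝ} (hN : 0 < N) (hx : 0 ≤ x) : nakagamiF N x ≤ 1 := by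
  have : 0 ≤ 1 / (1 + x / N) ^ N := by positivity
  unfold nakagamiF; linarith

lemma nakagamiF_lt_one {N x : ℝ} (hN : 0 < N) (hx : 0 ≤ x) : nakagamiF N x < 1 := by
  have : 0 < 1 / (1 + x / N) ^ N := by positivity
  unfold nakagamiF; linarith

lemma nakagamiF_nonneg {N x : ℝ} (hN : 0 < N) (hx : 0 ≤ x) : 0 ≤ nakagamiF N x := by
  have h1 : 1 ≤ (1 + x / N) ^ N := Real.one_le_rpow (by simp; positivity) hN.le
  have : 1 / (1 + x / N) ^ N ≤ 1 := by
    rw [div_le_one (by positivity)]; exact h1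
  unfold nakagamiF; linarith

lemma nakagamiF_le_self {N x : ℝ} (hN : 0 < N) (hx : 0 ≤ x) : nakagamiF N x ≤ x := by
  have h1 : (1 + x / N) ^ N ≤ Real.exp x := by
    calc (1 + x / N) ^ N ≤ Real.exp (x / N) ^ N :=
          Real.rpow_le_rpow (by positivity) (by linarith [Real.add_one_le_exp (x / N)]) hN.le
      _ = Real.exp x := by rw [← Real.exp_mul, div_mul_cancel₀ _ hN.ne']
  have h2 : Real.exp (-x) ≤ 1 / (1 + x / N) ^ N := by
    rw [Real.exp_neg, ← one_div]
    exact one_div_le_one_div_of_le (by positivity) h1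
  have h3 := Real.add_one_le_exp (-x)
  unfold nakagamiF; linarith

lemma nakagamiF_le_rpow {N x δ : ℝ} (hN : 0 < N) (hx : 0 ≤ x) (hδ : 0 ≤ δ) (hδ1 : δ ≤ 1) :
    nakagamiF N x ≤ x ^ δ := by
  rcases le_total x 1 with h | h
  · refine (nakagamiF_le_self hN hx).trans ?_
    rcases hx.eq_or_lt with rfl | hx'
    · positivity
    · simpa using Real.rpow_le_rpow_of_exponent_ge hx' h hδ1
  · exact (nakagamiF_le_one hN hx).trans (Real.one_le_rpow h hδ)

lemma measurable_nakagamiF (N : ℝ) : Measurable (nakagamiF N) := by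
  unfold nakagamiF; fun_prop

/-- The Laplace transform of the Gamma law of shape `N` and rate `N`: multiplication by `e^{-ay}`
turns its density into a multiple of the Gamma density of rate `N + a`. -/
lemma lintegral_negExp_gammaMeasure {N a : ℝ} (hN : 0 < N) (ha : 0 ≤ a) :
    ∫⁻ y, negExp (ENNReal.ofReal (a * y)) ∂gammaMeasure N N =
      ENNReal.ofReal (1 - nakagamiF N a) := by
  have hm : Measurable fun y : ℝ => negExp (ENNReal.ofReal (a * y)) :=
    measurable_negExp.comp (by fun_prop)
  have hpdf : ∀ r, Measurable (gammaPDF N r) := fun r =>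
    (measurable_gammaPDFReal N r).ennreal_ofReal
  rw [gammaMeasure, lintegral_withDensity_eq_lintegral_mul _ (hpdf N) hm]
  have hpt : ∀ y, (gammaPDF N N * fun y => negExp (ENNReal.ofReal (a * y))) y =
      ENNReal.ofReal (1 - nakagamiF N a) * gammaPDF N (N + a) y := by
    intro y
    simp only [Pi.mul_apply]
    rcases lt_or_ge y 0 with hy | hy
    · rw [gammaPDF_of_neg hy, gammaPDF_of_neg hy]; simp
    · rw [gammaPDF_of_nonneg hy, gammaPDF_of_nonneg hy, negExp_ofReal (by positivity),
        one_sub_nakagamiF]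
      have hG := Real.Gamma_pos_of_pos hN
      rw [← ENNReal.ofReal_mul (by positivity), ← ENNReal.ofReal_mul (by positivity)]
      congr 1
      have h1 : (1 + a / N) ^ N = (N + a) ^ N / N ^ N := by
        rw [← Real.div_rpow (by positivity) hN.le, add_div, div_self hN.ne']
      have h2 : Real.exp (-((N + a) * y)) = Real.exp (-(N * y)) * Real.exp (-(a * y)) := by
        rw [← Real.exp_add]; congr 1; ring
      have h3 : 0 < (N + a) ^ N := by positivity
      have h4 : 0 < N ^ N := by positivity
      rw [h1, h2]
      field_simp
  rw [lintegral_congr hpt, lintegral_const_mul _ (hpdf _),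
    lintegral_gammaPDF_eq_one hN (by positivity), mul_one]

lemma gammaMeasure_ae_nonneg (N : ℝ) : ∀ᵐ y ∂gammaMeasure N N, 0 ≤ y := by
  have hpdf : Measurable (gammaPDF N N) := (measurable_gammaPDFReal N N).ennreal_ofReal
  rw [gammaMeasure, ae_withDensity_iff hpdf]
  refine ae_of_all _ fun y hy => ?_
  by_contra hn
  exact hy (gammaPDF_of_neg (not_le.1 hn))

/-! ### The logarithm as a mixture of exponentials -/

lemma lintegral_exp_neg_mul {u : ℝ} (hu : 0 < u) :
    ∫⁻ s in Ioi (0 : ℝ), ENNReal.ofReal (Real.exp (-(s * u))) = ENNReal.ofReal u⁻¹ := by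
  have h : ∀ s : ℝ, Real.exp (-(s * u)) = Real.exp (-u * s) := fun s => by congr 1; ring
  simp_rw [h]
  rw [← ofReal_integral_eq_lintegral_ofReal (integrableOn_exp_mul_Ioi (neg_lt_zero.2 hu) 0)
    (ae_of_all _ fun s => Real.exp_nonneg _), integral_exp_mul_Ioi (neg_lt_zero.2 hu)]
  simp [neg_div_neg_eq]

/-- Frullani's integral `∫ e^{-sJ} (1 - e^{-sS}) ds / s = log (1 + S / J)`. -/
lemma lintegral_frullani {S J : ℝ} (hS : 0 ≤ S) (hJ : 0 < J) :
    ∫⁻ s in Ioi (0 : ℝ), ENNReal.ofReal (Real.exp (-(s * J)) * (1 - Real.exp (-(s * S))) / s) =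
      ENNReal.ofReal (Real.log (1 + S / J)) := by
  have h1 : ∀ s ∈ Ioi (0 : ℝ),
      ENNReal.ofReal (Real.exp (-(s * J)) * (1 - Real.exp (-(s * S))) / s) =
        ∫⁻ u in Ioc J (J + S), ENNReal.ofReal (Real.exp (-(s * u))) := by
    intro s hs
    have hs' : (0 : ℝ) < s := hs
    rw [← ofReal_integral_eq_lintegral_ofReal
      ((Continuous.integrableOn_Icc (by fun_prop)).mono_set Ioc_subset_Icc_self)
      (ae_of_all _ fun u => Real.exp_nonneg _), ← intervalIntegral.integral_of_le (by linarith)]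
    congr 1
    rw [intervalIntegral.integral_eq_sub_of_hasDerivAt
      (f := fun u => -Real.exp (-(s * u)) / s)
      (fun u _ => by
        have := (((hasDerivAt_id u).const_mul s).neg.exp.neg).div_const s
        refine this.congr_deriv ?_
        simp only [id_eq, mul_one]
        field_simp
        rfl)
      (Continuous.intervalIntegrable (by fun_prop) _ _)]
    rw [mul_add, neg_add, Real.exp_add]
    ring
  rw [setLIntegral_congr_fun measurableSet_Ioi h1, lintegral_lintegral_swap (by fun_prop)]
  have h2 : ∀ u ∈ Ioc J (J + S), ∫⁻ s in Ioi (0 : ℝ), ENNReal.ofReal (Real.exp (-(s * u))) =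
      ENNReal.ofReal u⁻¹ := fun u hu => lintegral_exp_neg_mul (hJ.trans hu.1)
  rw [setLIntegral_congr_fun measurableSet_Ioc h2, ← ofReal_integral_eq_lintegral_ofReal,
    ← intervalIntegral.integral_of_le (by linarith), integral_inv_of_pos hJ (by linarith)]
  · congr 2
    field_simp
  · refine (ContinuousOn.integrableOn_Icc ?_).mono_set Ioc_subset_Icc_self
    exact continuousOn_inv₀.mono fun u hu => (hJ.trans_le hu.1).ne'
  · filter_upwards [ae_restrict_mem measurableSet_Ioc] with u hu
    exact inv_nonneg.2 (hJ.trans hu.1).le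

/-- The logarithmic rate as a mixture of Laplace transforms of signal and interference, also for
infinite interference, where both sides vanish. -/
lemma ofReal_log_one_add_sinr {S σ : ℝ} (hS : 0 ≤ S) (hσ : 0 < σ) (I : ℝ≥0∞) :
    ENNReal.ofReal (Real.log (1 + (ENNReal.ofReal S / (I + ENNReal.ofReal σ)).toReal)) =
      ∫⁻ s in Ioi (0 : ℝ), ENNReal.ofReal (Real.exp (-s * σ) / s) *
        (negExp (ENNReal.ofReal s * I) * (1 - negExp (ENNReal.ofReal (s * S)))) := by
  by_cases hI : I = ∞
  · rw [setLIntegral_congr_fun (g := fun _ => 0) measurableSet_Ioi]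
    · simp [hI]
    · intro s hs
      have : ENNReal.ofReal s ≠ 0 := by simpa using hs
      simp [hI, ENNReal.mul_top this]
  · have hJ : 0 < I.toReal + σ := by positivity
    have hJe : I + ENNReal.ofReal σ = ENNReal.ofReal (I.toReal + σ) := by
      rw [ENNReal.ofReal_add ENNReal.toReal_nonneg hσ.le, ENNReal.ofReal_toReal hI]
    rw [hJe, ← ENNReal.ofReal_div_of_pos hJ, ENNReal.toReal_ofReal (by positivity),
      ← lintegral_frullani hS hJ]
    refine setLIntegral_congr_fun measurableSet_Ioi fun s hs => ?_
    have hs' : (0 : ℝ) < s := hs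
    have hle : Real.exp (-(s * S)) ≤ 1 := Real.exp_le_one_iff.2 (by
      have := mul_nonneg hs'.le hS; linarith)
    have e1 : ENNReal.ofReal s * I = ENNReal.ofReal (s * I.toReal) := by
      rw [ENNReal.ofReal_mul hs'.le, ENNReal.ofReal_toReal hI]
    rw [e1, negExp_ofReal (by positivity), negExp_ofReal (by positivity), ← ENNReal.ofReal_one,
      ← ENNReal.ofReal_sub _ (Real.exp_nonneg _), ← ENNReal.ofReal_mul (Real.exp_nonneg _),
      ← ENNReal.ofReal_mul (by positivity)]
    congr 1
    rw [mul_add, neg_add, Real.exp_add, neg_mul]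
    ring

/-! ### Independent marks -/

/-- Fubini's theorem for independent marks: given the points, the expectation of a finite product
of functions of one mark each is the product of the integrals over the mark laws. The factors may
depend on the whole point configuration. Functions of the mark are introduced one point at a time,
in place of the indicators of the sets `B l`. -/
lemma IsIndependentMarking.setLIntegral_prod_mul {Ω E : Type*} [MeasurableSpace Ω]
    [MeasurableSpace E] {P : Measure Ω} [IsProbabilityMeasure P] {κ : Kernel Plane E}
    [IsMarkovKernel κ] {X : ℕ → Ω → Plane} {mark : ℕ → Ω → E} (hX : ∀ l, Measurable (X l))
    (h : IsIndependentMarking P (fun x => κ x) X mark) (u : ℕ → (ℕ → Plane) → E → ℝ≥0∞)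
    (hu : ∀ l, Measurable (Function.uncurry (u l))) (hu1 : ∀ l x y, u l x y ≤ 1) (s : Finset ℕ) :
    ∀ (t : Finset ℕ) (B : ℕ → Set E) (A : Set (ℕ → Plane)), Disjoint s t →
      (∀ l, MeasurableSet (B l)) → MeasurableSet A →
      ∫⁻ ω in {ω | (fun l => X l ω) ∈ A}, (∏ l ∈ s, u l (fun l => X l ω) (mark l ω)) *
          ∏ l ∈ t, (B l).indicator 1 (mark l ω) ∂P =
        ∫⁻ ω in {ω | (fun l => X l ω) ∈ A},
          (∏ l ∈ s, ∫⁻ y, u l (fun l => X l ω) y ∂κ (X l ω)) *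
            ∏ l ∈ t, κ (X l ω) (B l) ∂P := by
  classical
  have hXm : Measurable fun ω l => X l ω := measurable_pi_lambda _ hX
  have hmark := h.measurable
  have hind1 : ∀ (C : Set E) y, C.indicator (1 : E → ℝ≥0∞) y ≤ 1 := fun C y =>
    Set.indicator_le_self C (1 : E → ℝ≥0∞) y
  have hum : ∀ l, Measurable fun ω => u l (fun l => X l ω) (mark l ω) := fun l =>
    (hu l).comp (hXm.prodMk (hmark l))
  have hκu : ∀ l, Measurable fun x : ℕ → Plane => ∫⁻ y, u l x y ∂κ (x l) := fun l =>
    Measurable.lintegral_kernel_prod_right (κ := κ.comap (fun x : ℕ → Plane => x l)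
      (measurable_pi_apply l)) (hu l)
  have hκu1 : ∀ l (x : ℕ → Plane), ∫⁻ y, u l x y ∂κ (x l) ≤ 1 := fun l x =>
    (lintegral_mono fun y => hu1 l x y).trans (by simp)
  induction s using Finset.induction_on with
  | empty =>
    intro t B A _ hB hA
    simp only [Finset.prod_empty, one_mul]
    rw [← h.law A t B hA hB]
    have hAm : MeasurableSet {ω | (fun l => X l ω) ∈ A} := hXm hA
    have hBm : MeasurableSet (⋂ l ∈ t, mark l ⁻¹' B l) :=
      t.measurableSet_biInter fun l _ => hmark l (hB l)
    rw [inter_comm, ← Measure.restrict_apply hBm, ← lintegral_indicator_one hBm]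
    refine lintegral_congr fun ω => ?_
    by_cases hω : ω ∈ ⋂ l ∈ t, mark l ⁻¹' B l
    · rw [Set.indicator_of_mem hω]
      refine Finset.prod_eq_one fun l hl => Set.indicator_of_mem ?_ _
      simp only [mem_iInter] at hω
      exact hω l hl
    · rw [Set.indicator_of_notMem hω]
      simp only [mem_iInter, not_forall] at hω
      obtain ⟨l, hl, hlB⟩ := hω
      exact Finset.prod_eq_zero hl (Set.indicator_of_notMem (show mark l ω ∉ B l from hlB) _)
  | insert k s hks ih =>
    intro t B A hst hB hA
    have hkt : k ∉ t := Finset.disjoint_left.1 hst (Finset.mem_insert_self k s)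
    have hst' : Disjoint s t := hst.mono_left (Finset.subset_insert k s)
    have hskt : Disjoint s (insert k t) :=
      Finset.disjoint_insert_right.2 ⟨hks, hst'⟩
    let v : Ω → ℝ≥0∞ := fun ω => (∏ l ∈ s, u l (fun l => X l ω) (mark l ω)) *
          ∏ l ∈ t, (B l).indicator 1 (mark l ω)
    let w : (ℕ → Plane) → ℝ≥0∞ := fun x => (∏ l ∈ s, ∫⁻ y, u l x y ∂κ (x l)) *
            ∏ l ∈ t, κ (x l) (B l)
    have hv : Measurable v := (Finset.measurable_fun_prod _ fun l _ => hum l).mul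
      (Finset.measurable_fun_prod _ fun l _ => (measurable_one.indicator (hB l)).comp (hmark l))
    have hw : Measurable w := (Finset.measurable_fun_prod _ fun l _ => hκu l).mul
      (Finset.measurable_fun_prod _ fun l _ =>
        (κ.measurable_coe (hB l)).comp (measurable_pi_apply l))
    have hv1 : ∀ ω, v ω ≤ 1 := fun ω => mul_le_one' (Finset.prod_le_one' fun l _ => hu1 l _ _)
      (Finset.prod_le_one' fun l _ => hind1 _ _)
    have hw1 : ∀ x, w x ≤ 1 := fun x => mul_le_one' (Finset.prod_le_one' fun l _ => hκu1 l _)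
      (Finset.prod_le_one' fun l _ => prob_le_one)
    have hwX : Measurable fun ω => w (fun l => X l ω) := hw.comp hXm
    let κk : Kernel (ℕ → Plane) E := κ.comap (fun x => x k) (measurable_pi_apply k)
    have fin1 : IsFiniteMeasure (P.withDensity v) := isFiniteMeasure_withDensity
      (ne_top_of_le_ne_top ENNReal.one_ne_top ((lintegral_mono hv1).trans (by simp)))
    have fin2 : IsFiniteMeasure (P.withDensity fun ω => w (fun l => X l ω)) :=
      isFiniteMeasure_withDensity
      (ne_top_of_le_ne_top ENNReal.one_ne_top ((lintegral_mono fun ω => hw1 _).trans (by simp)))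
    have hpair : Measurable fun ω => ((fun l => X l ω), mark k ω) := hXm.prodMk (hmark k)
    have hM : (P.withDensity v).map (fun ω => ((fun l => X l ω), mark k ω)) =
        ((P.withDensity fun ω => w (fun l => X l ω)).map fun ω l => X l ω) ⊗ₘ κk := by
      refine Measure.ext_prod fun {A' C} hA' hC => ?_
      have hih := ih (insert k t) (Function.update B k C) A' hskt
        (fun l => by
          rcases eq_or_ne l k with rfl | hl
          · simpa using hC
          · simpa [hl] using hB l) hA'
      have e1 : ∀ ω, ∏ l ∈ insert k t, (Function.update B k C l).indicator
          (1 : E → ℝ≥0∞) (mark l ω) =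
          C.indicator 1 (mark k ω) * ∏ l ∈ t, (B l).indicator 1 (mark l ω) := fun ω => by
        rw [Finset.prod_insert hkt, Function.update_self]
        congr 1
        refine Finset.prod_congr rfl fun l hl => ?_
        rw [Function.update_of_ne (ne_of_mem_of_not_mem hl hkt)]
      have e2 : ∀ ω, ∏ l ∈ insert k t, κ (X l ω) (Function.update B k C l) =
          κ (X k ω) C * ∏ l ∈ t, κ (X l ω) (B l) := fun ω => by
        rw [Finset.prod_insert hkt, Function.update_self]
        congr 1
        refine Finset.prod_congr rfl fun l hl => ?_
        rw [Function.update_of_ne (ne_of_mem_of_not_mem hl hkt)]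
      simp only [e1, e2] at hih
      have hCm : MeasurableSet (mark k ⁻¹' C) := hmark k hC
      have hAm : MeasurableSet {ω | (fun l => X l ω) ∈ A'} := hXm hA'
      rw [Measure.map_apply hpair (hA'.prod hC), Measure.compProd_apply_prod hA' hC,
        setLIntegral_map hA' (κk.measurable_coe hC) hXm]
      have hκX : Measurable fun ω => κk (fun l => X l ω) C := (κk.measurable_coe hC).comp hXm
      rw [setLIntegral_withDensity_eq_setLIntegral_mul _ hwX hκX (hXm hA')]
      have hpre : (fun ω => ((fun l => X l ω), mark k ω)) ⁻¹' A' ×ˢ C =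
          mark k ⁻¹' C ∩ {ω | (fun l => X l ω) ∈ A'} := by
        ext ω; simp [and_comm]
      rw [hpre, withDensity_apply _ (hCm.inter hAm), ← Measure.restrict_restrict hCm,
        ← lintegral_indicator hCm]
      refine Eq.trans (lintegral_congr fun ω => ?_) (hih.trans (lintegral_congr fun ω => ?_))
      · by_cases hω : mark k ω ∈ C
        · rw [Set.indicator_of_mem hω, Set.indicator_of_mem (show ω ∈ mark k ⁻¹' C from hω)]
          simp [v]
        · rw [Set.indicator_of_notMem hω, Set.indicator_of_notMem (show ω ∉ mark k ⁻¹' C from hω)]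
          simp
      · simp only [w, Pi.mul_apply, κk, Kernel.comap_apply]
        ring
    have hΨ : Measurable fun p : (ℕ → Plane) × E => A.indicator 1 p.1 * u k p.1 p.2 :=
      ((measurable_one.indicator hA).comp measurable_fst).mul (hu k)
    have hint := congrArg (fun M => ∫⁻ p, A.indicator 1 p.1 * u k p.1 p.2 ∂M) hM
    rw [lintegral_map hΨ hpair, Measure.lintegral_compProd hΨ,
      lintegral_map hΨ.lintegral_kernel_prod_right' hXm] at hint
    have hAm : MeasurableSet {ω | (fun l => X l ω) ∈ A} := hXm hA
    have hΨ1 : Measurable fun ω =>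
        A.indicator 1 (fun l => X l ω) * u k (fun l => X l ω) (mark k ω) := hΨ.comp hpair
    have hΨ2 : Measurable fun ω => ∫⁻ y, A.indicator 1 (fun l => X l ω) *
        u k (fun l => X l ω) y ∂κk (fun l => X l ω) := hΨ.lintegral_kernel_prod_right'.comp hXm
    dsimp only at hint
    rw [lintegral_withDensity_eq_lintegral_mul _ hv hΨ1,
      lintegral_withDensity_eq_lintegral_mul _ hwX hΨ2] at hint
    rw [← lintegral_indicator hAm, ← lintegral_indicator hAm]
    refine Eq.trans (lintegral_congr fun ω => ?_) (hint.trans (lintegral_congr fun ω => ?_))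
    · by_cases hω : (fun l => X l ω) ∈ A
      · rw [Set.indicator_of_mem (show ω ∈ {ω | (fun l => X l ω) ∈ A} from hω)]
        simp only [Pi.mul_apply, Set.indicator_of_mem hω, Pi.one_apply, v,
          Finset.prod_insert hks]
        ring
      · rw [Set.indicator_of_notMem (show ω ∉ {ω | (fun l => X l ω) ∈ A} from hω)]
        simp [Set.indicator_of_notMem hω]
    · by_cases hω : (fun l => X l ω) ∈ A
      · rw [Set.indicator_of_mem (show ω ∈ {ω | (fun l => X l ω) ∈ A} from hω)]
        simp only [Pi.mul_apply, Set.indicator_of_mem hω, Pi.one_apply, w,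
          Finset.prod_insert hks, one_mul, κk, Kernel.comap_apply]
        ring
      · rw [Set.indicator_of_notMem (show ω ∉ {ω | (fun l => X l ω) ∈ A} from hω)]
        simp [Set.indicator_of_notMem hω]

/-- Averaging over independent marks inside a Laplace functional: given the points, the mark of the
`l`-th point may be replaced by its Laplace exponent `F l`. -/
lemma IsIndependentMarking.lintegral_mul_negExp_tsum {Ω E : Type*} [MeasurableSpace Ω]
    [MeasurableSpace E] {P : Measure Ω} [IsProbabilityMeasure P] {κ : Kernel Plane E}
    [IsMarkovKernel κ] {X : ℕ → Ω → Plane} {mark : ℕ → Ω → E} (hX : ∀ l, Measurable (X l))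
    (h : IsIndependentMarking P (fun x => κ x) X mark) (U : ℕ → (ℕ → Plane) → E → ℝ≥0∞)
    (hU : ∀ l, Measurable (Function.uncurry (U l))) (F : ℕ → (ℕ → Plane) → ℝ≥0∞)
    (hF : ∀ l x, ∫⁻ y, negExp (U l x y) ∂κ (x l) = negExp (F l x)) (hFm : ∀ l, Measurable (F l))
    {Φ : (ℕ → Plane) → ℝ≥0∞} (hΦ : Measurable Φ) (hΦ1 : ∀ x, Φ x ≤ 1) :
    ∫⁻ ω, Φ (fun l => X l ω) * negExp (∑' l, U l (fun l => X l ω) (mark l ω)) ∂P =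
      ∫⁻ ω, Φ (fun l => X l ω) * negExp (∑' l, F l (fun l => X l ω)) ∂P := by
  have hXm : Measurable fun ω l => X l ω := measurable_pi_lambda _ hX
  have hUm : ∀ l, Measurable fun ω => negExp (U l (fun l => X l ω) (mark l ω)) := fun l =>
    measurable_negExp.comp ((hU l).comp (hXm.prodMk (h.measurable l)))
  have hFX : ∀ l, Measurable fun ω => negExp (F l (fun l => X l ω)) := fun l =>
    measurable_negExp.comp ((hFm l).comp hXm)
  have hfin : ∀ s : Finset ℕ,
      ∫⁻ ω, Φ (fun l => X l ω) * ∏ l ∈ s, negExp (U l (fun l => X l ω) (mark l ω)) ∂P =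
        ∫⁻ ω, Φ (fun l => X l ω) * ∏ l ∈ s, negExp (F l (fun l => X l ω)) ∂P := by
    intro s
    have hv : Measurable fun ω => ∏ l ∈ s, negExp (U l (fun l => X l ω) (mark l ω)) :=
      Finset.measurable_fun_prod _ fun l _ => hUm l
    have hw : Measurable fun ω => ∏ l ∈ s, negExp (F l (fun l => X l ω)) :=
      Finset.measurable_fun_prod _ fun l _ => hFX l
    have hM : (P.withDensity fun ω => ∏ l ∈ s, negExp (U l (fun l => X l ω) (mark l ω))).map
        (fun ω l => X l ω) =
        (P.withDensity fun ω => ∏ l ∈ s, negExp (F l (fun l => X l ω))).map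
        (fun ω l => X l ω) := by
      ext A hA
      rw [Measure.map_apply hXm hA, Measure.map_apply hXm hA, withDensity_apply _ (hXm hA),
        withDensity_apply _ (hXm hA)]
      have := h.setLIntegral_prod_mul hX (fun l x y => negExp (U l x y))
        (fun l => measurable_negExp.comp (hU l)) (fun l x y => negExp_le_one _) s ∅ (fun _ => ∅) A
        (Finset.disjoint_empty_right s) (fun _ => MeasurableSet.empty) hA
      simp only [Finset.prod_empty, mul_one] at this
      refine Eq.trans this (lintegral_congr fun ω => Finset.prod_congr rfl fun l _ => ?_)
      exact hF l (fun l => X l ω)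
    have hint := congrArg (fun M => ∫⁻ x, Φ x ∂M) hM
    have hΦX : Measurable fun ω => Φ (fun l => X l ω) := hΦ.comp hXm
    rw [lintegral_map hΦ hXm, lintegral_map hΦ hXm,
      lintegral_withDensity_eq_lintegral_mul _ hv hΦX,
      lintegral_withDensity_eq_lintegral_mul _ hw hΦX] at hint
    simp only [Pi.mul_apply] at hint
    simp_rw [mul_comm (Φ _)]
    exact hint
  have hlim : ∀ G : ℕ → Ω → ℝ≥0∞, (∀ l, Measurable fun ω => negExp (G l ω)) →
      Filter.Tendsto (fun n => ∫⁻ ω, Φ (fun l => X l ω) *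
        ∏ l ∈ Finset.range n, negExp (G l ω) ∂P) Filter.atTop
        (nhds (∫⁻ ω, Φ (fun l => X l ω) * negExp (∑' l, G l ω) ∂P)) := by
    intro G hG
    refine tendsto_lintegral_of_dominated_convergence (fun _ => 1)
      (fun n => (hΦ.comp hXm).mul (Finset.measurable_fun_prod _ fun l _ => hG l))
      (fun n => ae_of_all _ fun ω => mul_le_one' (hΦ1 _)
        (Finset.prod_le_one' fun l _ => negExp_le_one _)) (by simp) (ae_of_all _ fun ω => ?_)
    exact ENNReal.Tendsto.const_mul (tendsto_prod_negExp _)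
      (Or.inr (ne_top_of_le_ne_top ENNReal.one_ne_top (hΦ1 _)))
  refine tendsto_nhds_unique (hlim _ hUm) ?_
  simp_rw [hfin]
  exact hlim _ hFX

namespace NetworkParams

variable (c : NetworkParams)

/-! ### The interference of one link -/

lemma b_nonneg (n : Fin 2) : 0 ≤ c.b n := by
  have h := c.beamwidth_mem
  have hpi := Real.pi_pos
  fin_cases n
  · simp only [b]; exact div_nonneg h.1 (by positivity)
  · simp only [b]
    have : c.beamwidth / (2 * Real.pi) ≤ 1 := by
      rw [div_le_one (by positivity)]; exact h.2
    simpa using this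

lemma sum_b : ∑ n, c.b n = 1 := by simp [b]

lemma a_nonneg (n : Fin 2) : 0 ≤ c.a n := by
  fin_cases n
  · exact c.mainGain_pos.le
  · exact c.sideGain_nonneg

instance : IsProbabilityMeasure (gammaMeasure c.NL c.NL) :=
  isProbabilityMeasure_gammaMeasure c.NL_pos c.NL_pos

instance : IsProbabilityMeasure (gammaMeasure c.NN c.NN) :=
  isProbabilityMeasure_gammaMeasure c.NN_pos c.NN_pos

lemma lintegral_gainLaw {f : ℝ → ℝ≥0∞} (hf : Measurable f) :
    ∫⁻ y, f y ∂c.gainLaw = ∑ n, ENNReal.ofReal (c.b n) * f (c.a n) := by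
  rw [gainLaw, lintegral_finsetSum_measure]
  refine Finset.sum_congr rfl fun n _ => ?_
  rw [lintegral_smul_measure, lintegral_dirac' _ hf, smul_eq_mul]

instance : IsProbabilityMeasure c.gainLaw := ⟨by
  rw [← lintegral_one, c.lintegral_gainLaw measurable_const]
  simp only [mul_one]
  rw [← ENNReal.ofReal_sum_of_nonneg fun n _ => c.b_nonneg n, c.sum_b, ENNReal.ofReal_one]⟩

lemma lintegral_linkLaw (x : Plane) {f : Bool × ℝ × ℝ → ℝ≥0∞} (hf : Measurable f) :
    ∫⁻ y, f y ∂c.linkLaw x =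
      ENNReal.ofReal (c.losProb ‖x‖) * ∑ n, ENNReal.ofReal (c.b n) *
        ∫⁻ y, f (true, c.a n, y) ∂gammaMeasure c.NL c.NL +
      ENNReal.ofReal (1 - c.losProb ‖x‖) * ∑ n, ENNReal.ofReal (c.b n) *
        ∫⁻ y, f (false, c.a n, y) ∂gammaMeasure c.NN c.NN := by
  have key : ∀ (i : Bool) (ν : Measure ℝ) [IsProbabilityMeasure ν],
      ∫⁻ y, f y ∂(Measure.dirac i).prod (c.gainLaw.prod ν) =
        ∑ n, ENNReal.ofReal (c.b n) * ∫⁻ y, f (i, c.a n, y) ∂ν := by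
    intro i ν _
    have h1 : Measurable fun p : ℝ × ℝ => f (i, p) := hf.comp measurable_prodMk_left
    rw [Measure.dirac_prod, lintegral_map hf measurable_prodMk_left,
      lintegral_prod _ h1.aemeasurable, c.lintegral_gainLaw h1.lintegral_prod_right']
  rw [linkLaw, lintegral_add_measure, lintegral_smul_measure, lintegral_smul_measure, key, key,
    smul_eq_mul, smul_eq_mul]

instance (x : Plane) : IsProbabilityMeasure (c.linkLaw x) := ⟨by
  have hp := c.losProb_mem ‖x‖ (norm_nonneg x)
  rw [← lintegral_one, c.lintegral_linkLaw x measurable_const]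
  simp only [lintegral_one, measure_univ, mul_one]
  rw [← ENNReal.ofReal_sum_of_nonneg fun n _ => c.b_nonneg n, c.sum_b, ENNReal.ofReal_one,
    mul_one, mul_one, ← ENNReal.ofReal_add hp.1 (by linarith [hp.2])]
  simp⟩

/-- The law of a link, as a Markov kernel of the location of the access point. -/
noncomputable def linkKernel : Kernel Plane (Bool × ℝ × ℝ) where
  toFun := c.linkLaw
  measurable' := by
    refine Measure.measurable_of_measurable_coe _ fun B hB => ?_
    have hp : Measurable fun x : Plane => c.losProb ‖x‖ := c.measurable_losProb.comp measurable_norm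
    simp only [linkLaw, Measure.add_apply, Measure.smul_apply, smul_eq_mul]
    exact (hp.ennreal_ofReal.mul_const _).add ((measurable_const.sub hp).ennreal_ofReal.mul_const _)

instance : IsMarkovKernel c.linkKernel := ⟨fun x => by
  show IsProbabilityMeasure (c.linkLaw x); infer_instance⟩

/-- The power received over a link with LOS indicator, gain and fading `y` from an interfering
access point at `x`. -/
noncomputable def linkPower (x : Plane) (y : Bool × ℝ × ℝ) : ℝ≥0∞ :=
  if y.1 = true then ENNReal.ofReal (y.2.1 * c.CL * ‖x‖ ^ (-c.alphaL) * y.2.2)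
  else ENNReal.ofReal (y.2.1 * c.CN * ‖x‖ ^ (-c.alphaN) * y.2.2)

lemma measurable_linkPower :
    Measurable fun p : Plane × (Bool × ℝ × ℝ) => c.linkPower p.1 p.2 := by
  refine Measurable.ite ?_ (by fun_prop) (by fun_prop)
  exact (measurable_fst.comp measurable_snd) (measurableSet_singleton true)

/-- `1 - E e^{-s W}`, where `W` is the power received from an interferer at distance `r`. -/
noncomputable def linkF (s r : ℝ) : ℝ :=
  c.losProb r * ∑ n, c.b n * nakagamiF c.NL (s * c.a n * c.CL * r ^ (-c.alphaL)) +
    (1 - c.losProb r) * ∑ n, c.b n * nakagamiF c.NN (s * c.a n * c.CN * r ^ (-c.alphaN))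

lemma measurable_linkF (s : ℝ) : Measurable (c.linkF s) := by
  have hp := c.measurable_losProb
  have h1 := measurable_nakagamiF c.NL
  have h2 := measurable_nakagamiF c.NN
  unfold linkF
  fun_prop

variable {c}

lemma argL_nonneg {s r : ℝ} (hs : 0 ≤ s) (hr : 0 ≤ r) (n : Fin 2) :
    0 ≤ s * c.a n * c.CL * r ^ (-c.alphaL) := by
  have := c.a_nonneg n
  have := c.CL_pos
  positivity

lemma argN_nonneg {s r : ℝ} (hs : 0 ≤ s) (hr : 0 ≤ r) (n : Fin 2) :
    0 ≤ s * c.a n * c.CN * r ^ (-c.alphaN) := by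
  have := c.a_nonneg n
  have := c.CN_pos
  positivity

lemma one_sub_linkF (s r : ℝ) : 1 - c.linkF s r =
    c.losProb r * ∑ n, c.b n * (1 - nakagamiF c.NL (s * c.a n * c.CL * r ^ (-c.alphaL))) +
    (1 - c.losProb r) *
      ∑ n, c.b n * (1 - nakagamiF c.NN (s * c.a n * c.CN * r ^ (-c.alphaN))) := by
  simp only [mul_sub, Finset.sum_sub_distrib, mul_one, c.sum_b, linkF]
  ring

lemma linkF_nonneg {s r : ℝ} (hs : 0 ≤ s) (hr : 0 ≤ r) : 0 ≤ c.linkF s r := by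
  have hp := c.losProb_mem r hr
  refine add_nonneg (mul_nonneg hp.1 (Finset.sum_nonneg fun n _ => ?_))
    (mul_nonneg (by linarith [hp.2]) (Finset.sum_nonneg fun n _ => ?_))
  · exact mul_nonneg (c.b_nonneg n) (nakagamiF_nonneg c.NL_pos (argL_nonneg hs hr n))
  · exact mul_nonneg (c.b_nonneg n) (nakagamiF_nonneg c.NN_pos (argN_nonneg hs hr n))

lemma linkF_lt_one {s r : ℝ} (hs : 0 ≤ s) (hr : 0 ≤ r) : c.linkF s r < 1 := by
  have hp := c.losProb_mem r hr
  have key : ∀ F : Fin 2 → ℝ, (∀ n, F n < 1) → ∑ n, c.b n * F n < 1 := by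
    intro F hF
    have hb := c.sum_b
    have h0 := c.b_nonneg 0
    have h1 := c.b_nonneg 1
    rw [Fin.sum_univ_two] at hb ⊢
    rcases h0.eq_or_lt with h | h
    · rw [← h] at hb ⊢
      nlinarith [hF 1]
    · nlinarith [hF 0, hF 1]
  have hL := key _ fun n => nakagamiF_lt_one c.NL_pos (argL_nonneg (c := c) hs hr n)
  have hN := key _ fun n => nakagamiF_lt_one c.NN_pos (argN_nonneg (c := c) hs hr n)
  unfold linkF
  rcases hp.1.eq_or_lt with h | h
  · rw [← h]; linarith
  · nlinarith [hp.2]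

/-- The Laplace transform of the power received from an interferer at `x`. -/
lemma lintegral_negExp_linkPower {s : ℝ} (hs : 0 ≤ s) (x : Plane) :
    ∫⁻ y, negExp (ENNReal.ofReal s * c.linkPower x y) ∂c.linkLaw x =
      ENNReal.ofReal (1 - c.linkF s ‖x‖) := by
  have hp := c.losProb_mem ‖x‖ (norm_nonneg x)
  have hm : Measurable fun y => negExp (ENNReal.ofReal s * c.linkPower x y) :=
    measurable_negExp.comp ((c.measurable_linkPower.comp measurable_prodMk_left).const_mul _)
  have hL : ∀ n, ∫⁻ y, negExp (ENNReal.ofReal s * c.linkPower x (true, c.a n, y))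
      ∂gammaMeasure c.NL c.NL =
      ENNReal.ofReal (1 - nakagamiF c.NL (s * c.a n * c.CL * ‖x‖ ^ (-c.alphaL))) := fun n => by
    rw [← lintegral_negExp_gammaMeasure c.NL_pos (argL_nonneg hs (norm_nonneg x) n)]
    refine lintegral_congr fun y => ?_
    simp only [linkPower, if_true]
    rw [← ENNReal.ofReal_mul hs]
    congr 2; ring
  have hN : ∀ n, ∫⁻ y, negExp (ENNReal.ofReal s * c.linkPower x (false, c.a n, y))
      ∂gammaMeasure c.NN c.NN =
      ENNReal.ofReal (1 - nakagamiF c.NN (s * c.a n * c.CN * ‖x‖ ^ (-c.alphaN))) := fun n => by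
    rw [← lintegral_negExp_gammaMeasure c.NN_pos (argN_nonneg hs (norm_nonneg x) n)]
    refine lintegral_congr fun y => ?_
    simp only [linkPower, Bool.false_eq_true, if_false]
    rw [← ENNReal.ofReal_mul hs]
    congr 2; ring
  have h1 : ∀ n, 0 ≤ 1 - nakagamiF c.NL (s * c.a n * c.CL * ‖x‖ ^ (-c.alphaL)) := fun n =>
    sub_nonneg.2 (nakagamiF_le_one c.NL_pos (argL_nonneg hs (norm_nonneg x) n))
  have h2 : ∀ n, 0 ≤ 1 - nakagamiF c.NN (s * c.a n * c.CN * ‖x‖ ^ (-c.alphaN)) := fun n =>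
    sub_nonneg.2 (nakagamiF_le_one c.NN_pos (argN_nonneg hs (norm_nonneg x) n))
  rw [c.lintegral_linkLaw x hm, one_sub_linkF]
  simp_rw [hL, hN, ← ENNReal.ofReal_mul (c.b_nonneg _)]
  rw [← ENNReal.ofReal_sum_of_nonneg fun n _ => mul_nonneg (c.b_nonneg n) (h1 n),
    ← ENNReal.ofReal_sum_of_nonneg fun n _ => mul_nonneg (c.b_nonneg n) (h2 n),
    ← ENNReal.ofReal_mul hp.1, ← ENNReal.ofReal_mul (by linarith [hp.2]), ENNReal.ofReal_add
      (mul_nonneg hp.1 (Finset.sum_nonneg fun n _ => mul_nonneg (c.b_nonneg n) (h1 n)))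
      (mul_nonneg (by linarith [hp.2])
        (Finset.sum_nonneg fun n _ => mul_nonneg (c.b_nonneg n) (h2 n)))]

variable (c) in
/-- The Laplace exponent of the power received from an interferer at distance `r`. -/
noncomputable def linkExponent (s r : ℝ) : ℝ≥0∞ := ENNReal.ofReal (-Real.log (1 - c.linkF s r))

lemma measurable_linkExponent (s : ℝ) : Measurable (c.linkExponent s) := by
  have := c.measurable_linkF s
  unfold linkExponent
  fun_prop

lemma negExp_linkExponent {s r : ℝ} (hs : 0 ≤ s) (hr : 0 ≤ r) :
    negExp (c.linkExponent s r) = ENNReal.ofReal (1 - c.linkF s r) := by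
  have h0 := linkF_nonneg (c := c) hs hr
  have h1 := linkF_lt_one (c := c) hs hr
  rw [linkExponent, negExp_ofReal, neg_neg, Real.exp_log (by linarith)]
  rw [neg_nonneg]
  exact Real.log_nonpos (by linarith) (by linarith)

/-- `Q_L + Q_N` is the exponent of the Laplace functional of the interference from beyond `t`. -/
lemma lintegral_one_sub_negExp_linkExponent {s t : ℝ} (hs : 0 ≤ s) (ht : 0 ≤ t) :
    ∫⁻ x in Ioi t, (1 - negExp (c.linkExponent s x)) ∂radialIntensity c.lam =
      c.QL t s + c.QN t s := by
  have hlam := c.lam_pos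
  have hpi := Real.pi_pos
  have hm : Measurable fun x => 1 - negExp (c.linkExponent s x) :=
    measurable_const.sub (measurable_negExp.comp (measurable_linkExponent s))
  have h1 := measurable_nakagamiF c.NL
  have h2 := measurable_nakagamiF c.NN
  have hp := c.measurable_losProb
  have hmL : ∀ n, Measurable fun x => ENNReal.ofReal
      (nakagamiF c.NL (s * c.a n * c.CL * x ^ (-c.alphaL)) * c.losProb x * x) := by
    intro n; fun_prop
  have hmN : ∀ n, Measurable fun x => ENNReal.ofReal
      (nakagamiF c.NN (s * c.a n * c.CN * x ^ (-c.alphaN)) * (1 - c.losProb x) * x) := by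
    intro n; fun_prop
  have hmLN : ∀ n, Measurable fun x => ENNReal.ofReal
      (nakagamiF c.NL (s * c.a n * c.CL * x ^ (-c.alphaL)) * c.losProb x * x) + ENNReal.ofReal
      (nakagamiF c.NN (s * c.a n * c.CN * x ^ (-c.alphaN)) * (1 - c.losProb x) * x) :=
    fun n => (hmL n).add (hmN n)
  rw [radialIntensity, setLIntegral_withDensity_eq_setLIntegral_mul _
    (measurable_radialDensity _) hm measurableSet_Ioi, Measure.restrict_restrict measurableSet_Ioi,
    inter_eq_left.2 (Ioi_subset_Ioi ht), QL, QN, ← mul_add, ← Finset.sum_add_distrib]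
  simp_rw [← mul_add, ← lintegral_add_left (hmL _)]
  simp_rw [← lintegral_const_mul _ (hmLN _)]
  rw [← lintegral_finsetSum _ (fun n _ => (hmLN n).const_mul _),
    ← lintegral_const_mul _ (Finset.measurable_fun_sum _
      (fun n _ => (hmLN n).const_mul _))]
  refine setLIntegral_congr_fun measurableSet_Ioi fun x hx => ?_
  have hx0 : 0 ≤ x := ht.trans (le_of_lt hx)
  have hpx := c.losProb_mem x hx0
  have hF := linkF_nonneg (c := c) hs hx0
  have hF1 := linkF_lt_one (c := c) hs hx0
  have hq : 0 ≤ 1 - c.losProb x := by linarith [hpx.2]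
  have hA : ∀ n, 0 ≤ nakagamiF c.NL (s * c.a n * c.CL * x ^ (-c.alphaL)) * c.losProb x * x :=
    fun n => mul_nonneg (mul_nonneg (nakagamiF_nonneg c.NL_pos (argL_nonneg hs hx0 n)) hpx.1) hx0
  have hB : ∀ n, 0 ≤ nakagamiF c.NN (s * c.a n * c.CN * x ^ (-c.alphaN)) *
      (1 - c.losProb x) * x :=
    fun n => mul_nonneg (mul_nonneg (nakagamiF_nonneg c.NN_pos (argN_nonneg hs hx0 n)) hq) hx0
  simp only [Pi.mul_apply]
  rw [negExp_linkExponent hs hx0, ← ENNReal.ofReal_one, ← ENNReal.ofReal_sub _ (by linarith),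
    sub_sub_cancel, ← ENNReal.ofReal_mul (by positivity)]
  simp_rw [← ENNReal.ofReal_add (hA _) (hB _), ← ENNReal.ofReal_mul (c.b_nonneg _)]
  rw [← ENNReal.ofReal_sum_of_nonneg
    fun n _ => mul_nonneg (c.b_nonneg n) (add_nonneg (hA n) (hB n)),
    ← ENNReal.ofReal_mul (by positivity), linkF]
  congr 1
  simp only [Fin.sum_univ_two]
  ring

end NetworkParams

/-! ### The expected rate as an integral of Laplace transforms -/

namespace NetworkParams

variable {c : NetworkParams} {K : ℕ}

variable (c) in
/-- The Laplace transform of the signal power when the serving access points are at distances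
`r k`. -/
noncomputable def signalLaplace (s : ℝ) (r : Fin K → ℝ) : ℝ :=
  ∏ k, (1 - nakagamiF c.NL (s * c.mainGain * c.CL * r k ^ (-c.alphaL)))

lemma argS_nonneg {s x : ℝ} (hs : 0 ≤ s) (hx : 0 ≤ x) :
    0 ≤ s * c.mainGain * c.CL * x ^ (-c.alphaL) := by
  have := c.mainGain_pos
  have := c.CL_pos
  positivity

lemma signalLaplace_nonneg {s : ℝ} (hs : 0 ≤ s) {r : Fin K → ℝ} (hr : ∀ k, 0 ≤ r k) :
    0 ≤ c.signalLaplace s r :=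
  Finset.prod_nonneg fun k _ =>
    sub_nonneg.2 (nakagamiF_le_one c.NL_pos (argS_nonneg hs (hr k)))

lemma signalLaplace_le_one {s : ℝ} (hs : 0 ≤ s) {r : Fin K → ℝ} (hr : ∀ k, 0 ≤ r k) :
    c.signalLaplace s r ≤ 1 :=
  Finset.prod_le_one
    (fun k _ => sub_nonneg.2 (nakagamiF_le_one c.NL_pos (argS_nonneg hs (hr k))))
    (fun k _ => sub_le_self _ (nakagamiF_nonneg c.NL_pos (argS_nonneg hs (hr k))))

lemma measurable_signalLaplace {α : Type*} [MeasurableSpace α] {s : α → ℝ} {r : α → Fin K → ℝ}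
    (hs : Measurable s) (hr : Measurable r) :
    Measurable fun x => c.signalLaplace (s x) (r x) := by
  refine Finset.measurable_fun_prod _ fun k _ => measurable_const.sub ?_
  refine (measurable_nakagamiF c.NL).comp ?_
  have hk : Measurable fun x => r x k := (measurable_pi_apply k).comp hr
  fun_prop

variable (c) in
/-- The signal power for serving distances `r` and power fadings `z`. -/
noncomputable def signalPower (r z : Fin K → ℝ) : ℝ≥0∞ :=
  ∑ k, ENNReal.ofReal (c.mainGain * c.CL * r k ^ (-c.alphaL) * z k)

lemma measurable_signalPower {α : Type*} [MeasurableSpace α] {r z : α → Fin K → ℝ}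
    (hr : Measurable r) (hz : Measurable z) :
    Measurable fun x => c.signalPower (r x) (z x) := by
  refine Finset.measurable_fun_sum _ fun k _ => ?_
  have hk : Measurable fun x => r x k := (measurable_pi_apply k).comp hr
  have hzk : Measurable fun x => z x k := (measurable_pi_apply k).comp hz
  fun_prop

lemma lintegral_one_sub_negExp_signalPower {s : ℝ} (hs : 0 ≤ s) {r : Fin K → ℝ}
    (hr : ∀ k, 0 ≤ r k) :
    ∫⁻ z, (1 - negExp (ENNReal.ofReal s * c.signalPower r z))
        ∂Measure.pi (fun _ => gammaMeasure c.NL c.NL) =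
      ENNReal.ofReal (1 - c.signalLaplace s r) := by
  have hm : Measurable fun z : Fin K → ℝ => negExp (ENNReal.ofReal s * c.signalPower r z) :=
    measurable_negExp.comp ((measurable_signalPower measurable_const measurable_id).const_mul _)
  have hprod : ∫⁻ z, negExp (ENNReal.ofReal s * c.signalPower r z)
      ∂Measure.pi (fun _ => gammaMeasure c.NL c.NL) = ENNReal.ofReal (c.signalLaplace s r) := by
    have h := lintegral_pi_prod (gammaMeasure c.NL c.NL)
      (fun (k : Fin K) y =>
        negExp (ENNReal.ofReal (s * c.mainGain * c.CL * r k ^ (-c.alphaL) * y)))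
      (fun k => measurable_negExp.comp (by fun_prop))
    simp_rw [lintegral_negExp_gammaMeasure c.NL_pos (argS_nonneg hs (hr _))] at h
    rw [signalLaplace, ENNReal.ofReal_prod_of_nonneg (fun k _ =>
      sub_nonneg.2 (nakagamiF_le_one c.NL_pos (argS_nonneg hs (hr k)))), ← h]
    refine lintegral_congr fun z => ?_
    rw [signalPower, Finset.mul_sum, negExp_sum]
    refine Finset.prod_congr rfl fun k _ => ?_
    rw [← ENNReal.ofReal_mul hs]
    congr 2; ring
  rw [lintegral_sub hm (by rw [hprod]; exact ENNReal.ofReal_ne_top)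
    (ae_of_all _ fun z => negExp_le_one _), hprod, lintegral_one, measure_univ,
    ENNReal.ofReal_sub _ (signalLaplace_nonneg hs hr), ENNReal.ofReal_one]

end NetworkParams

namespace NetworkModel

variable {c : NetworkParams} {K : ℕ} {Ω : Type*} [MeasurableSpace Ω] {P : Measure Ω}
  (N : NetworkModel c K P)

lemma measurable_X : Measurable fun ω l => N.X l ω := measurable_pi_lambda _ N.ppp.measurable

lemma measurable_links : Measurable fun ω => ((fun l => N.X l ω), fun l => N.link l ω) :=
  N.measurable_X.prodMk (measurable_pi_lambda _ N.marking.measurable)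

lemma measurable_fading : Measurable fun ω k => N.servingFading k ω :=
  measurable_pi_lambda _ N.measurable_servingFading

/-- The interference power, when the access points `l` with `X ∈ T l` interfere. -/
lemma interference_eq (T : ℕ → Set (ℕ → Plane)) (ω : Ω) :
    N.losInterference {l | (fun l => N.X l ω) ∈ T l} ω +
        N.nlosInterference {l | (fun l => N.X l ω) ∈ T l} ω =
      ∑' l, (T l).indicator (fun x => c.linkPower (x l) (N.link l ω)) (fun l => N.X l ω) := by
  rw [losInterference, nlosInterference, ← ENNReal.tsum_add]
  refine tsum_congr fun l => ?_
  by_cases hT : (fun l => N.X l ω) ∈ T l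
  · rw [Set.indicator_of_mem hT]
    cases hl : (N.link l ω).1 <;> simp [NetworkParams.linkPower, Set.indicator, hT, hl]
  · rw [Set.indicator_of_notMem hT]
    simp [Set.indicator, hT]

lemma ofReal_signal_ae (r : Ω → Fin K → ℝ) (hr : ∀ ω k, 0 ≤ r ω k) :
    ∀ᵐ ω ∂P, 0 ≤ N.signal (r ω) ω ∧ ENNReal.ofReal (N.signal (r ω) ω) =
      c.signalPower (r ω) (fun k => N.servingFading k ω) := by
  have h : ∀ᵐ ω ∂P, ∀ k, 0 ≤ N.servingFading k ω := by
    refine ae_all_iff.2 fun k => ?_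
    have := gammaMeasure_ae_nonneg c.NL
    rw [← (N.servingFading_law k).map_eq] at this
    exact ae_of_ae_map (N.measurable_servingFading k).aemeasurable this
  filter_upwards [h] with ω hω
  have hpos : ∀ k, 0 ≤ c.mainGain * c.CL * r ω k ^ (-c.alphaL) * N.servingFading k ω := fun k => by
    have := c.mainGain_pos
    have := c.CL_pos
    have := hr ω k
    have := hω k
    positivity
  exact ⟨Finset.sum_nonneg fun k _ => hpos k,
    ENNReal.ofReal_sum_of_nonneg fun k _ => hpos k⟩

/-- The serving fadings are independent of points and links, with the product Gamma law. -/
lemma lintegral_fading_links [IsProbabilityMeasure P]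
    {Ψ : (Fin K → ℝ) × ((ℕ → Plane) × (ℕ → Bool × ℝ × ℝ)) → ℝ≥0∞} (hΨ : Measurable Ψ) :
    ∫⁻ ω, Ψ (fun k => N.servingFading k ω, ((fun l => N.X l ω), fun l => N.link l ω)) ∂P =
      ∫⁻ ω, ∫⁻ z, Ψ (z, ((fun l => N.X l ω), fun l => N.link l ω))
        ∂Measure.pi (fun _ => gammaMeasure c.NL c.NL) ∂P := by
  have hlaw : P.map (fun ω k => N.servingFading k ω) =
      Measure.pi (fun _ => gammaMeasure c.NL c.NL) := by
    rw [(iIndepFun_iff_map_fun_eq_pi_map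
      (fun k => (N.measurable_servingFading k).aemeasurable)).1 N.servingFading_indep]
    congr 1
    exact funext fun k => (N.servingFading_law k).map_eq
  have hind := (indepFun_iff_map_prod_eq_prod_map_map N.measurable_fading.aemeasurable
    N.measurable_links.aemeasurable).1 N.servingFading_indep_links
  rw [hlaw] at hind
  rw [← lintegral_map (f := Ψ) hΨ (N.measurable_fading.prodMk N.measurable_links), hind,
    lintegral_prod_symm _ hΨ.aemeasurable, lintegral_map hΨ.lintegral_prod_left' N.measurable_links]

/-- The interference power as a function of points `p.1` and links `p.2`, when the access points
`l` with `p.1 ∈ T l` interfere. -/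
noncomputable def _root_.NetworkParams.totalInterference (c : NetworkParams)
    (T : ℕ → Set (ℕ → Plane)) (p : (ℕ → Plane) × (ℕ → Bool × ℝ × ℝ)) : ℝ≥0∞ :=
  ∑' l, (T l).indicator (fun x => c.linkPower (x l) (p.2 l)) p.1

lemma _root_.NetworkParams.measurable_totalInterference (c : NetworkParams)
    {T : ℕ → Set (ℕ → Plane)} (hT : ∀ l, MeasurableSet (T l)) :
    Measurable (c.totalInterference T) := by
  refine Measurable.tsum fun l => ?_
  have h0 : Measurable fun p : (ℕ → Plane) × (ℕ → Bool × ℝ × ℝ) => (p.1 l, p.2 l) :=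
    ((measurable_pi_apply l).comp measurable_fst).prodMk
      ((measurable_pi_apply l).comp measurable_snd)
  have h1 : Measurable fun p : (ℕ → Plane) × (ℕ → Bool × ℝ × ℝ) =>
      c.linkPower (p.1 l) (p.2 l) := c.measurable_linkPower.comp h0
  exact h1.indicator (measurable_fst (hT l))

/-- The Laplace transforms of signal and interference: averages over the serving fadings and over
the links, given the locations of the access points. -/
lemma lintegral_mul_negExp_interference [IsProbabilityMeasure P] {r : (ℕ → Plane) → Fin K → ℝ}
    (hr : Measurable r) (hr0 : ∀ x k, 0 ≤ r x k) {T : ℕ → Set (ℕ → Plane)}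
    (hT : ∀ l, MeasurableSet (T l)) {Φ : (ℕ → Plane) → ℝ≥0∞} (hΦ : Measurable Φ)
    (hΦ1 : ∀ x, Φ x ≤ 1) {s : ℝ} (hs : 0 ≤ s) :
    ∫⁻ ω, Φ (fun l => N.X l ω) *
        negExp (ENNReal.ofReal s *
          c.totalInterference T ((fun l => N.X l ω), fun l => N.link l ω)) *
        (1 - negExp (ENNReal.ofReal s *
          c.signalPower (r fun l => N.X l ω) (fun k => N.servingFading k ω))) ∂P =
      ∫⁻ ω, Φ (fun l => N.X l ω) * ENNReal.ofReal (1 - c.signalLaplace s (r fun l => N.X l ω)) *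
          negExp (∑' l, (T l).indicator (fun x => c.linkExponent s ‖x l‖) (fun l => N.X l ω))
          ∂P := by
  have hev : ∀ l, Measurable fun x : ℕ → Plane => x l := fun l => measurable_pi_apply l
  have hI := c.measurable_totalInterference hT
  have hΨ : Measurable fun q : (Fin K → ℝ) × ((ℕ → Plane) × (ℕ → Bool × ℝ × ℝ)) =>
      Φ q.2.1 * negExp (ENNReal.ofReal s * c.totalInterference T q.2) *
        (1 - negExp (ENNReal.ofReal s * c.signalPower (r q.2.1) q.1)) := by
    have h1 : Measurable fun q : (Fin K → ℝ) × ((ℕ → Plane) × (ℕ → Bool × ℝ × ℝ)) => q.2.1 :=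
      measurable_fst.comp measurable_snd
    have h2 := NetworkParams.measurable_signalPower (c := c) (hr.comp h1) measurable_fst
    have h3 : Measurable fun q : (Fin K → ℝ) × ((ℕ → Plane) × (ℕ → Bool × ℝ × ℝ)) =>
        c.totalInterference T q.2 := hI.comp measurable_snd
    exact ((hΦ.comp h1).mul (measurable_negExp.comp (h3.const_mul _))).mul
      (measurable_const.sub (measurable_negExp.comp (h2.const_mul _)))
  rw [N.lintegral_fading_links hΨ]
  have hfade : ∀ ω, ∫⁻ z, Φ (fun l => N.X l ω) *
        negExp (ENNReal.ofReal s *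
          c.totalInterference T ((fun l => N.X l ω), fun l => N.link l ω)) *
        (1 - negExp (ENNReal.ofReal s * c.signalPower (r fun l => N.X l ω) z))
        ∂Measure.pi (fun _ => gammaMeasure c.NL c.NL) =
      (Φ (fun l => N.X l ω) * ENNReal.ofReal (1 - c.signalLaplace s (r fun l => N.X l ω))) *
        negExp (∑' l, (T l).indicator (fun x => ENNReal.ofReal s * c.linkPower (x l) (N.link l ω))
          (fun l => N.X l ω)) := by
    intro ω
    have hm : Measurable fun z : Fin K → ℝ =>
        1 - negExp (ENNReal.ofReal s * c.signalPower (r fun l => N.X l ω) z) :=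
      measurable_const.sub (measurable_negExp.comp
        ((NetworkParams.measurable_signalPower measurable_const measurable_id).const_mul _))
    rw [lintegral_const_mul _ hm,
      NetworkParams.lintegral_one_sub_negExp_signalPower hs (fun k => hr0 _ k),
      mul_right_comm, NetworkParams.totalInterference, ← ENNReal.tsum_mul_left]
    congr 3
    funext l
    by_cases hx : (fun l => N.X l ω) ∈ T l
    · simp only [Set.indicator_of_mem hx]
    · simp only [Set.indicator_of_notMem hx, mul_zero]
  simp_rw [hfade]
  have hLm : Measurable fun x : ℕ → Plane => ENNReal.ofReal (1 - c.signalLaplace s (r x)) :=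
    (measurable_const.sub
      (NetworkParams.measurable_signalLaplace measurable_const hr)).ennreal_ofReal
  exact IsIndependentMarking.lintegral_mul_negExp_tsum (κ := c.linkKernel)
    N.ppp.measurable N.marking
    (fun l x y => (T l).indicator (fun x => ENNReal.ofReal s * c.linkPower (x l) y) x)
    (fun l => by
      have h3 : Measurable fun p : (ℕ → Plane) × (Bool × ℝ × ℝ) =>
          ENNReal.ofReal s * c.linkPower (p.1 l) p.2 :=
        (c.measurable_linkPower.comp
          (((hev l).comp measurable_fst).prodMk measurable_snd)).const_mul _
      exact h3.indicator (measurable_fst (hT l)))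
    (fun l => (T l).indicator fun x => c.linkExponent s ‖x l‖)
    (fun l x => by
      by_cases hx : x ∈ T l
      · simp only [Set.indicator_of_mem hx]
        rw [NetworkParams.negExp_linkExponent hs (norm_nonneg _)]
        exact NetworkParams.lintegral_negExp_linkPower hs (x l)
      · simp [Set.indicator_of_notMem hx])
    (fun l => ((NetworkParams.measurable_linkExponent s).comp (hev l).norm).indicator (hT l))
    (Φ := fun x => Φ x * ENNReal.ofReal (1 - c.signalLaplace s (r x))) (hΦ.mul hLm)
    (fun x => mul_le_one' (hΦ1 x) (by
      rw [← ENNReal.ofReal_one]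
      exact ENNReal.ofReal_le_ofReal (sub_le_self _
        (NetworkParams.signalLaplace_nonneg hs (hr0 x)))))

/-- The expected rate as an integral of Laplace transforms, for serving distances and interfering
access points that may depend on the locations of all access points. -/
lemma lintegral_mul_log_sinrOf [IsProbabilityMeasure P] {r : (ℕ → Plane) → Fin K → ℝ}
    (hr : Measurable r) (hr0 : ∀ x k, 0 ≤ r x k) {T : ℕ → Set (ℕ → Plane)}
    (hT : ∀ l, MeasurableSet (T l)) {Φ : (ℕ → Plane) → ℝ≥0∞} (hΦ : Measurable Φ)
    (hΦ1 : ∀ x, Φ x ≤ 1) :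
    ∫⁻ ω, Φ (fun l => N.X l ω) * ENNReal.ofReal (Real.log (1 +
        N.sinrOf (r (fun l => N.X l ω)) {l | (fun l => N.X l ω) ∈ T l} ω)) ∂P =
      ∫⁻ s in Ioi (0 : ℝ), ENNReal.ofReal (Real.exp (-s * c.noise) / s) *
        ∫⁻ ω, Φ (fun l => N.X l ω) * ENNReal.ofReal (1 - c.signalLaplace s (r fun l => N.X l ω)) *
          negExp (∑' l, (T l).indicator (fun x => c.linkExponent s ‖x l‖) (fun l => N.X l ω))
          ∂P := by
  have hXm := N.measurable_X
  obtain ⟨I, hIdef⟩ : ∃ I : Ω → ℝ≥0∞, I = fun ω =>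
    c.totalInterference T ((fun l => N.X l ω), fun l => N.link l ω) := ⟨_, rfl⟩
  have hI : Measurable I := by
    rw [hIdef]; exact (c.measurable_totalInterference hT).comp N.measurable_links
  obtain ⟨S, hSdef⟩ : ∃ S : Ω → ℝ≥0∞, S = fun ω =>
    c.signalPower (r fun l => N.X l ω) (fun k => N.servingFading k ω) := ⟨_, rfl⟩
  have hS : Measurable S := by
    rw [hSdef]; exact NetworkParams.measurable_signalPower (hr.comp hXm) N.measurable_fading
  have hW : Measurable fun s : ℝ => ENNReal.ofReal (Real.exp (-s * c.noise) / s) := by fun_prop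
  have hH : Measurable fun p : Ω × ℝ =>
      negExp (ENNReal.ofReal p.2 * I p.1) * (1 - negExp (ENNReal.ofReal p.2 * S p.1)) := by
    have hs : Measurable fun p : Ω × ℝ => ENNReal.ofReal p.2 := measurable_snd.ennreal_ofReal
    exact (measurable_negExp.comp (hs.mul (hI.comp measurable_fst))).mul
      (measurable_const.sub (measurable_negExp.comp (hs.mul (hS.comp measurable_fst))))
  have hHω : ∀ ω, Measurable fun s : ℝ =>
      negExp (ENNReal.ofReal s * I ω) * (1 - negExp (ENNReal.ofReal s * S ω)) := fun ω =>
    (measurable_negExp.comp (ENNReal.measurable_ofReal.mul_const _)).mul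
      (measurable_const.sub (measurable_negExp.comp (ENNReal.measurable_ofReal.mul_const _)))
  have hΦX : Measurable fun ω => Φ (fun l => N.X l ω) := hΦ.comp hXm
  calc _ = ∫⁻ ω, (∫⁻ s in Ioi (0 : ℝ), Φ (fun l => N.X l ω) *
          (ENNReal.ofReal (Real.exp (-s * c.noise) / s) *
            (negExp (ENNReal.ofReal s * I ω) * (1 - negExp (ENNReal.ofReal s * S ω))))) ∂P := by
        refine lintegral_congr_ae ?_
        filter_upwards [N.ofReal_signal_ae (fun ω => r fun l => N.X l ω) (fun ω k => hr0 _ k)]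
          with ω hω
        have hHm : Measurable fun s => ENNReal.ofReal (Real.exp (-s * c.noise) / s) *
            (negExp (ENNReal.ofReal s * I ω) * (1 - negExp (ENNReal.ofReal s * S ω))) :=
          hW.mul (hHω ω)
        rw [sinrOf, N.interference_eq T ω, ofReal_log_one_add_sinr hω.1 c.noise_pos,
          lintegral_const_mul _ hHm]
        congr 1
        refine setLIntegral_congr_fun measurableSet_Ioi fun s hs => ?_
        have hs' : (0 : ℝ) < s := hs
        rw [ENNReal.ofReal_mul hs'.le, hω.2, hIdef, hSdef]
        rfl
    _ = ∫⁻ s in Ioi (0 : ℝ), (∫⁻ ω, Φ (fun l => N.X l ω) *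
          (ENNReal.ofReal (Real.exp (-s * c.noise) / s) *
            (negExp (ENNReal.ofReal s * I ω) * (1 - negExp (ENNReal.ofReal s * S ω)))) ∂P) := by
        refine lintegral_lintegral_swap (Measurable.aemeasurable ?_)
        exact (hΦX.comp measurable_fst).mul ((hW.comp measurable_snd).mul hH)
    _ = _ := by
        refine setLIntegral_congr_fun measurableSet_Ioi fun s hs => ?_
        have hs' : (0 : ℝ) < s := hs
        have hHs : Measurable fun ω =>
            negExp (ENNReal.ofReal s * I ω) * (1 - negExp (ENNReal.ofReal s * S ω)) :=
          (measurable_negExp.comp (hI.const_mul _)).mul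
            (measurable_const.sub (measurable_negExp.comp (hS.const_mul _)))
        simp only [mul_left_comm (Φ _) (ENNReal.ofReal (Real.exp (-s * c.noise) / s))]
        rw [lintegral_const_mul _ (by exact hΦX.mul hHs),
          ← N.lintegral_mul_negExp_interference hr hr0 hT hΦ hΦ1 hs'.le, hIdef, hSdef]
        simp only [mul_assoc]

end NetworkModel

/-! ### The conditional capacity as a function of the serving distances -/

namespace NetworkParams

variable {c : NetworkParams} {m : ℕ}

lemma measurable_setLIntegral_Ioi {g : ℝ → ℝ → ℝ≥0∞} (hg : Measurable (Function.uncurry g)) :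
    Measurable fun p : ℝ × ℝ => ∫⁻ x in Ioi p.1, g p.2 x := by
  have h : ∀ p : ℝ × ℝ, ∫⁻ x in Ioi p.1, g p.2 x =
      ∫⁻ x, {q : (ℝ × ℝ) × ℝ | q.1.1 < q.2}.indicator (fun q => g q.1.2 q.2) (p, x) := fun p => by
    rw [← lintegral_indicator measurableSet_Ioi]; rfl
  simp_rw [h]
  have h1 : Measurable fun q : (ℝ × ℝ) × ℝ => g q.1.2 q.2 :=
    hg.comp ((measurable_snd.comp measurable_fst).prodMk measurable_snd)
  exact (h1.indicator (measurableSet_lt (measurable_fst.comp measurable_fst)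
    measurable_snd)).lintegral_prod_right'

variable (c) in
lemma measurable_QL : Measurable fun p : ℝ × ℝ => c.QL p.1 p.2 := by
  have h1 := measurable_nakagamiF c.NL
  have hp := c.measurable_losProb
  have h : ∀ n, Measurable fun p : ℝ × ℝ => ENNReal.ofReal (c.b n) *
      ∫⁻ x in Ioi p.1, ENNReal.ofReal
        (nakagamiF c.NL (p.2 * c.a n * c.CL * x ^ (-c.alphaL)) * c.losProb x * x) := fun n => by
    refine (measurable_setLIntegral_Ioi (g := fun s x => ENNReal.ofReal
      (nakagamiF c.NL (s * c.a n * c.CL * x ^ (-c.alphaL)) * c.losProb x * x)) ?_).const_mul _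
    unfold Function.uncurry
    fun_prop
  unfold QL
  exact (Finset.measurable_fun_sum _ fun n _ => h n).const_mul _

variable (c) in
lemma measurable_QN : Measurable fun p : ℝ × ℝ => c.QN p.1 p.2 := by
  have h1 := measurable_nakagamiF c.NN
  have hp := c.measurable_losProb
  have h : ∀ n, Measurable fun p : ℝ × ℝ => ENNReal.ofReal (c.b n) *
      ∫⁻ x in Ioi p.1, ENNReal.ofReal
        (nakagamiF c.NN (p.2 * c.a n * c.CN * x ^ (-c.alphaN)) * (1 - c.losProb x) * x) :=
      fun n => by
    refine (measurable_setLIntegral_Ioi (g := fun s x => ENNReal.ofReal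
      (nakagamiF c.NN (s * c.a n * c.CN * x ^ (-c.alphaN)) * (1 - c.losProb x) * x)) ?_).const_mul _
    unfold Function.uncurry
    fun_prop
  unfold QN
  exact (Finset.measurable_fun_sum _ fun n _ => h n).const_mul _

lemma capacityIntegrand_eq (r : Fin (m + 1) → ℝ) (s : ℝ) : c.capacityIntegrand r s =
    Real.exp (-s * c.noise) / s *
      (negExp (c.QL (r (Fin.last m)) s + c.QN (r (Fin.last m)) s)).toReal *
      (1 - c.signalLaplace s r) := by
  rw [toReal_negExp]; rfl

lemma measurable_negExp_QL_add_QN {α : Type*} [MeasurableSpace α] {ρ s : α → ℝ}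
    (hρ : Measurable ρ) (hs : Measurable s) :
    Measurable fun x => negExp (c.QL (ρ x) (s x) + c.QN (ρ x) (s x)) := by
  have h : ∀ g : ℝ → ℝ → ℝ≥0∞, (Measurable fun q : ℝ × ℝ => g q.1 q.2) →
      Measurable fun x => g (ρ x) (s x) := fun g hg => by
    have hp : Measurable fun x => (ρ x, s x) := hρ.prodMk hs
    exact hg.comp hp
  exact h (fun ρ s => negExp (c.QL ρ s + c.QN ρ s))
    (measurable_negExp.comp (c.measurable_QL.add c.measurable_QN))

lemma measurable_capacityIntegrand {α : Type*} [MeasurableSpace α] {r : α → Fin (m + 1) → ℝ}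
    {s : α → ℝ} (hr : Measurable r) (hs : Measurable s) :
    Measurable fun x => c.capacityIntegrand (r x) (s x) := by
  have hl : Measurable fun x => r x (Fin.last m) := (measurable_pi_apply _).comp hr
  have hN := (measurable_negExp_QL_add_QN (c := c) hl hs).ennreal_toReal
  have hE : Measurable fun x => Real.exp (-s x * c.noise) / s x := by fun_prop
  have hS : Measurable fun x => c.signalLaplace (s x) (r x) := measurable_signalLaplace hs hr
  simp only [capacityIntegrand_eq]
  exact (hE.mul hN).mul (measurable_const.sub hS)

lemma capacityIntegrand_nonneg {r : Fin (m + 1) → ℝ} (hr : ∀ k, 0 ≤ r k) {s : ℝ} (hs : 0 ≤ s) :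
    0 ≤ c.capacityIntegrand r s := by
  rw [capacityIntegrand_eq]
  exact mul_nonneg (mul_nonneg (by positivity) ENNReal.toReal_nonneg)
    (sub_nonneg.2 (signalLaplace_le_one hs hr))

lemma ofReal_capacityIntegrand {r : Fin (m + 1) → ℝ} (hr : ∀ k, 0 ≤ r k) {s : ℝ} (hs : 0 ≤ s) :
    ENNReal.ofReal (c.capacityIntegrand r s) = ENNReal.ofReal (Real.exp (-s * c.noise) / s) *
      (ENNReal.ofReal (1 - c.signalLaplace s r) *
        negExp (c.QL (r (Fin.last m)) s + c.QN (r (Fin.last m)) s)) := by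
  rw [capacityIntegrand_eq, ENNReal.ofReal_mul' (sub_nonneg.2 (signalLaplace_le_one hs hr)),
    ENNReal.ofReal_mul' ENNReal.toReal_nonneg, ENNReal.ofReal_toReal (negExp_ne_top _)]
  ring

variable (c) in
/-- The integral over `s` of the integrand of the conditional capacity, in `[0, ∞]`. -/
noncomputable def capacityLIntegral (r : Fin (m + 1) → ℝ) : ℝ≥0∞ :=
  ∫⁻ s in Ioi (0 : ℝ), ENNReal.ofReal (c.capacityIntegrand r s)

lemma measurable_capacityLIntegral : Measurable fun r : Fin (m + 1) → ℝ => c.capacityLIntegral r :=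
  (measurable_capacityIntegrand measurable_fst measurable_snd).ennreal_ofReal.lintegral_prod_right'

lemma integral_capacityIntegrand {r : Fin (m + 1) → ℝ} (hr : ∀ k, 0 ≤ r k) :
    ∫ s in Ioi (0 : ℝ), c.capacityIntegrand r s = (c.capacityLIntegral r).toReal := by
  refine integral_eq_lintegral_of_nonneg_ae ?_
    (measurable_capacityIntegrand measurable_const measurable_id).aestronglyMeasurable
  filter_upwards [ae_restrict_mem measurableSet_Ioi] with s hs
  exact capacityIntegrand_nonneg hr (le_of_lt hs)

lemma integrableOn_capacityIntegrand {r : Fin (m + 1) → ℝ} (hr : ∀ k, 0 ≤ r k)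
    (hfin : c.capacityLIntegral r ≠ ∞) : IntegrableOn (c.capacityIntegrand r) (Ioi 0) := by
  refine ⟨(measurable_capacityIntegrand measurable_const measurable_id).aestronglyMeasurable, ?_⟩
  rw [hasFiniteIntegral_iff_ofReal]
  · exact hfin.lt_top
  · filter_upwards [ae_restrict_mem measurableSet_Ioi] with s hs
    exact capacityIntegrand_nonneg hr (le_of_lt hs)

lemma one_sub_prod_one_sub_le {ι : Type*} (t : Finset ι) (F : ι → ℝ) (h0 : ∀ i, 0 ≤ F i)
    (h1 : ∀ i, F i ≤ 1) : 1 - ∏ i ∈ t, (1 - F i) ≤ ∑ i ∈ t, F i := by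
  classical
  induction t using Finset.induction_on with
  | empty => simp
  | insert i t hi ih =>
    rw [Finset.prod_insert hi, Finset.sum_insert hi]
    have hp : ∏ j ∈ t, (1 - F j) ≤ 1 :=
      Finset.prod_le_one (fun j _ => sub_nonneg.2 (h1 j)) fun j _ => sub_le_self _ (h0 j)
    nlinarith [h0 i]

variable (c) in
/-- An exponent `p < 1` with which `c.capacityLIntegral` is bounded by powers `r k ^ (-p)`. -/
noncomputable def boundExponent : ℝ := c.alphaL / (1 + c.alphaL)

lemma boundExponent_lt_one : c.boundExponent < 1 := by
  have := c.alphaL_pos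
  rw [boundExponent, div_lt_one (by positivity)]; linarith

lemma boundExponent_pos : 0 < c.boundExponent := by
  have := c.alphaL_pos
  unfold boundExponent; positivity

/-- With `δ = 1 / (1 + α_L)` and `F(N, x) ≤ x ^ δ`, the noise factor makes the integral over `s`
converge both at `0` and at `∞`. -/
lemma exists_capacityLIntegral_le (c : NetworkParams) : ∃ C : ℝ≥0∞, C ≠ ∞ ∧
    ∀ (m : ℕ) (r : Fin (m + 1) → ℝ), (∀ k, 0 < r k) →
      c.capacityLIntegral r ≤ C * ∑ k, ENNReal.ofReal (r k ^ (-c.boundExponent)) := by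
  have hα := c.alphaL_pos
  have hM := c.mainGain_pos
  have hC := c.CL_pos
  set δ : ℝ := 1 / (1 + c.alphaL) with hδ
  have hδ0 : 0 < δ := by positivity
  have hδ1 : δ ≤ 1 := by rw [hδ, div_le_one (by positivity)]; linarith
  let A : ℝ := (c.mainGain * c.CL) ^ δ
  have hA : 0 ≤ A := by positivity
  let w : ℝ → ℝ := fun s => A * (s ^ (δ - 1) * Real.exp (-c.noise * s))
  have hw : IntegrableOn w (Ioi 0) := by
    have := integrableOn_rpow_mul_exp_neg_mul_rpow (p := 1) (s := δ - 1) (b := c.noise)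
      (by linarith) zero_lt_one c.noise_pos
    simp only [Real.rpow_one] at this
    exact this.const_mul A
  have hw0 : ∀ᵐ s ∂volume.restrict (Ioi (0 : ℝ)), 0 ≤ w s := by
    filter_upwards [ae_restrict_mem measurableSet_Ioi] with s hs
    have : (0 : ℝ) < s := hs
    positivity
  refine ⟨∫⁻ s in Ioi (0 : ℝ), ENNReal.ofReal (w s), ?_, fun m r hr => ?_⟩
  · exact ((hasFiniteIntegral_iff_ofReal hw0).1 hw.2).ne
  have hwm : Measurable fun s => ENNReal.ofReal (w s) := by fun_prop
  rw [mul_comm, ← lintegral_const_mul _ hwm]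
  refine setLIntegral_mono (hwm.const_mul _) fun s hs => ?_
  have hs' : (0 : ℝ) < s := hs
  rw [← ENNReal.ofReal_sum_of_nonneg fun k _ => Real.rpow_nonneg (hr k).le _,
    ← ENNReal.ofReal_mul (Finset.sum_nonneg fun k _ => Real.rpow_nonneg (hr k).le _)]
  refine ENNReal.ofReal_le_ofReal ?_
  have hF : 1 - c.signalLaplace s r ≤ A * s ^ δ * ∑ k, r k ^ (-c.boundExponent) := by
    refine (one_sub_prod_one_sub_le _ _
      (fun k => nakagamiF_nonneg c.NL_pos (argS_nonneg hs'.le (hr k).le))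
      (fun k => nakagamiF_le_one c.NL_pos (argS_nonneg hs'.le (hr k).le))).trans ?_
    rw [Finset.mul_sum]
    refine Finset.sum_le_sum fun k _ => ?_
    refine (nakagamiF_le_rpow c.NL_pos (argS_nonneg hs'.le (hr k).le) hδ0.le hδ1).trans_eq ?_
    have hrk := hr k
    rw [show s * c.mainGain * c.CL * r k ^ (-c.alphaL) =
      (c.mainGain * c.CL) * s * r k ^ (-c.alphaL) by ring,
      Real.mul_rpow (by positivity) (by positivity), Real.mul_rpow (by positivity) hs'.le,
      ← Real.rpow_mul hrk.le]
    congr 2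
    rw [boundExponent, hδ]; ring
  have hE : (negExp (c.QL (r (Fin.last m)) s + c.QN (r (Fin.last m)) s)).toReal ≤ 1 :=
    ENNReal.toReal_mono ENNReal.one_ne_top (negExp_le_one _)
  have hL := sub_nonneg.2 (signalLaplace_le_one (c := c) hs'.le fun k => (hr k).le)
  rw [capacityIntegrand_eq]
  calc _ ≤ Real.exp (-s * c.noise) / s * 1 * (A * s ^ δ * ∑ k, r k ^ (-c.boundExponent)) := by
        gcongr
    _ = _ := by
        simp only [w]
        rw [Real.rpow_sub_one hs'.ne', show -s * c.noise = -c.noise * s by ring]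
        ring

end NetworkParams

/-! ### Averages over the locations of the access points -/

/-- The increasing vectors, under the product of the radial measures. -/
lemma setLIntegral_strictMono_radialIntensity (lam : ℝ) {n : ℕ} {Ψ : (Fin n → ℝ) → ℝ≥0∞}
    (hΨ : Measurable Ψ) :
    ∫⁻ r in {r | StrictMono r}, Ψ r ∂Measure.pi (fun _ => radialIntensity lam) =
      ∫⁻ r in orderedDistances n, (∏ k, ENNReal.ofReal (2 * Real.pi * lam * r k)) * Ψ r := by
  have hd : Measurable fun r : Fin n → ℝ => ∏ k, ENNReal.ofReal (2 * Real.pi * lam * r k) :=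
    Finset.measurable_fun_prod _ fun k _ =>
      (measurable_radialDensity lam).comp (measurable_pi_apply k)
  rw [pi_radialIntensity, setLIntegral_withDensity_eq_setLIntegral_mul _ hd hΨ
    (measurableSet_strictMono n), Measure.restrict_restrict (measurableSet_strictMono n),
    inter_comm, Measure.restrict_congr_set (orderedDistances_ae_eq n)]
  rfl

lemma NetworkParams.ofReal_distDensity (c : NetworkParams) {m : ℕ} {r : Fin (m + 1) → ℝ}
    (hr : r ∈ orderedDistances (m + 1)) :
    ENNReal.ofReal (c.distDensity r) = (∏ k, ENNReal.ofReal (2 * Real.pi * c.lam * r k)) *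
      negExp (radialIntensity c.lam (Iic (r (Fin.last m)))) := by
  have hlam := c.lam_pos
  have hpi := Real.pi_pos
  have h0 : ∀ k, 0 ≤ 2 * Real.pi * c.lam * r k := fun k => by
    have := hr.1 k
    positivity
  rw [radialIntensity_Iic hlam, max_eq_left (hr.1 _).le, negExp_ofReal (by positivity),
    ← ENNReal.ofReal_prod_of_nonneg fun k _ => h0 k,
    ← ENNReal.ofReal_mul (Finset.prod_nonneg fun k _ => h0 k), Finset.prod_mul_distrib,
    Finset.prod_const, Finset.card_univ, Fintype.card_fin, NetworkParams.distDensity]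
  congr 3
  show -Real.pi * c.lam * r (Fin.last m) ^ 2 = _
  ring

lemma tailWeight_one (η : Measure ℝ) (t : ℝ) :
    tailWeight η (fun _ => 1) t = negExp (η (Iic t)) := by
  simp [tailWeight]

lemma NetworkParams.measurable_distDensity (c : NetworkParams) {m : ℕ} :
    Measurable fun r : Fin (m + 1) → ℝ => ENNReal.ofReal (c.distDensity r) := by
  unfold NetworkParams.distDensity
  fun_prop

/-- The joint law of the first distances of a planar Poisson process. -/
lemma IsHomogeneousPPP.hasLaw_norm {c : NetworkParams} {Ω : Type*} [MeasurableSpace Ω]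
    {P : Measure Ω} [IsProbabilityMeasure P] {X : ℕ → Ω → Plane} (h : IsHomogeneousPPP P c.lam X)
    (hmono : ∀ᵐ ω ∂P, StrictMono fun l => ‖X l ω‖) (m : ℕ) :
    HasLaw (fun ω (k : Fin (m + 1)) => ‖X k ω‖)
      ((volume.restrict (orderedDistances (m + 1))).withDensity
        fun r => ENNReal.ofReal (c.distDensity r)) P := by
  have hR : Measurable fun ω (k : Fin (m + 1)) => ‖X k ω‖ :=
    measurable_pi_lambda _ fun k => (h.measurable k).norm
  refine ⟨hR.aemeasurable, Measure.ext fun B hB => ?_⟩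
  have hind : Measurable (B.indicator (1 : (Fin (m + 1) → ℝ) → ℝ≥0∞)) := measurable_one.indicator hB
  have hlam := c.lam_pos
  have hproc := (h.isPoissonProcess_norm hlam).lintegral_first_mul_negExp
    (radialIntensity_Iic_ne_top hlam) (radialIntensity_univ hlam) hmono m
    (f := fun _ => 0) measurable_const (by simp) hind
  have hZ : Measurable fun r : Fin (m + 1) → ℝ =>
      tailWeight (radialIntensity c.lam) (fun _ => 1) (r (Fin.last m)) :=
    (measurable_tailWeight _ _).comp (measurable_pi_apply _)
  have hΨ : Measurable fun r : Fin (m + 1) → ℝ => B.indicator 1 r *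
      tailWeight (radialIntensity c.lam) (fun _ => 1) (r (Fin.last m)) := hind.mul hZ
  simp only [tsum_zero, negExp_zero, mul_one] at hproc
  rw [← lintegral_indicator_one hB, lintegral_map hind hR, hproc,
    setLIntegral_strictMono_radialIntensity c.lam hΨ, withDensity_apply _ hB,
    ← lintegral_indicator hB]
  refine setLIntegral_congr_fun (measurableSet_orderedDistances _) fun r hr => ?_
  simp only [tailWeight_one]
  by_cases hrB : r ∈ B
  · simp only [Set.indicator_of_mem hrB, Pi.one_apply, one_mul, c.ofReal_distDensity hr]
  · simp only [Set.indicator_of_notMem hrB, zero_mul, mul_zero]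

/-! ### The expected rate given the serving distances -/

namespace NetworkModel

variable {c : NetworkParams} {m : ℕ} {Ω : Type*} [MeasurableSpace Ω] {P : Measure Ω}
  (N : NetworkModel c (m + 1) P)

lemma measurable_servingDist : Measurable N.servingDist :=
  measurable_pi_lambda _ fun k => (N.ppp.measurable k).norm

/-- Fixed serving distances: the conditional capacity, in `[0, ∞]`. -/
lemma lintegral_log_sinrGiven [IsProbabilityMeasure P] {r : Fin (m + 1) → ℝ}
    (hr : ∀ k, 0 ≤ r k) :
    ∫⁻ ω, ENNReal.ofReal (Real.log (1 + N.sinrGiven r ω)) ∂P = c.capacityLIntegral r := by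
  have hlam := c.lam_pos
  have h := N.lintegral_mul_log_sinrOf (r := fun _ => r) measurable_const (fun _ => hr)
    (T := fun l => {x | r (Fin.last m) < ‖x l‖})
    (fun l => measurableSet_lt measurable_const (measurable_pi_apply l).norm)
    (Φ := fun _ => 1) measurable_const (fun _ => le_rfl)
  simp only [one_mul] at h
  refine Eq.trans h (setLIntegral_congr_fun measurableSet_Ioi fun s hs => ?_)
  have hs' : (0 : ℝ) < s := hs
  have hf : Measurable ((Ioi (r (Fin.last m))).indicator (c.linkExponent s)) :=
    (NetworkParams.measurable_linkExponent s).indicator measurableSet_Ioi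
  have hlap := (N.ppp.isPoissonProcess_norm hlam).lintegral_prod_count_mul_negExp
    (radialIntensity_Iic_ne_top hlam) (ι := Fin 0) (fun _ => ∅) (fun _ => MeasurableSet.empty)
    (fun i => i.elim0) (fun _ _ => 0) (fun _ => measurable_const) (fun _ _ => zero_le_one) hf
    (fun i => i.elim0)
  simp only [Finset.univ_eq_empty, Finset.prod_empty, one_mul] at hlap
  have hint : ∫⁻ x, (1 - negExp ((Ioi (r (Fin.last m))).indicator (c.linkExponent s) x))
      ∂radialIntensity c.lam = c.QL (r (Fin.last m)) s + c.QN (r (Fin.last m)) s := by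
    rw [← NetworkParams.lintegral_one_sub_negExp_linkExponent hs'.le (hr _),
      ← lintegral_indicator measurableSet_Ioi]
    refine lintegral_congr fun x => ?_
    by_cases hx : x ∈ Ioi (r (Fin.last m))
    · simp only [Set.indicator_of_mem hx]
    · simp only [Set.indicator_of_notMem hx, negExp_zero, tsub_self]
  have hm : Measurable fun ω =>
      negExp (∑' l, (Ioi (r (Fin.last m))).indicator (c.linkExponent s) ‖N.X l ω‖) :=
    measurable_negExp.comp (Measurable.tsum fun l => hf.comp (N.ppp.measurable l).norm)
  rw [NetworkParams.ofReal_capacityIntegrand hr hs'.le, ← hint, ← hlap,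
    ← lintegral_const_mul _ hm]
  rfl

/-- The interference from all but the nearest access points, given the distances of the latter. -/
lemma lintegral_servingDist_mul_negExp [IsProbabilityMeasure P] {Φ : (Fin (m + 1) → ℝ) → ℝ≥0∞}
    (hΦ : Measurable Φ) {s : ℝ} (hs : 0 ≤ s) :
    ∫⁻ ω, Φ (N.servingDist ω) *
        negExp (∑' l, c.linkExponent s ‖N.X (l + (m + 1)) ω‖) ∂P =
      ∫⁻ ω, Φ (N.servingDist ω) * negExp (c.QL (N.servingDist ω (Fin.last m)) s +
        c.QN (N.servingDist ω (Fin.last m)) s) ∂P := by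
  have hlam := c.lam_pos
  have hΦQ : Measurable fun r : Fin (m + 1) → ℝ =>
      Φ r * negExp (c.QL (r (Fin.last m)) s + c.QN (r (Fin.last m)) s) :=
    hΦ.mul (NetworkParams.measurable_negExp_QL_add_QN (measurable_pi_apply (Fin.last m))
      measurable_const)
  have hpp := N.ppp.isPoissonProcess_norm hlam
  have h1 := hpp.lintegral_first_mul_negExp (radialIntensity_Iic_ne_top hlam)
    (radialIntensity_univ hlam) N.ordered m (NetworkParams.measurable_linkExponent (c := c) s)
    (fun x => ENNReal.ofReal_ne_top) hΦ
  have h2 := hpp.lintegral_first_mul_negExp (radialIntensity_Iic_ne_top hlam)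
    (radialIntensity_univ hlam) N.ordered m (f := fun _ => 0) measurable_const (by simp) hΦQ
  simp only [tsum_zero, negExp_zero, mul_one] at h2
  have hW : ∀ g : ℝ → ℝ≥0∞, Measurable fun r : Fin (m + 1) → ℝ =>
      tailWeight (radialIntensity c.lam) g (r (Fin.last m)) := fun g =>
    (measurable_tailWeight _ g).comp (measurable_pi_apply (Fin.last m))
  refine (h1.trans (setLIntegral_strictMono_radialIntensity _ (hΦ.mul (hW _)))).trans
    (Eq.trans ?_ (h2.trans (setLIntegral_strictMono_radialIntensity _ (hΦQ.mul (hW _)))).symm)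
  refine setLIntegral_congr_fun (measurableSet_orderedDistances _) fun r hr => ?_
  simp only [tailWeight_one]
  rw [tailWeight, NetworkParams.lintegral_one_sub_negExp_linkExponent hs (hr.1 _).le, negExp_add]
  ring

/-- The strong Markov property at the last serving access point: given the serving distances, the
expected rate is the conditional capacity. -/
lemma lintegral_servingDist_mul_log_sinr [IsProbabilityMeasure P] {Φ : (Fin (m + 1) → ℝ) → ℝ≥0∞}
    (hΦ : Measurable Φ) (hΦ1 : ∀ r, Φ r ≤ 1) :
    ∫⁻ ω, Φ (N.servingDist ω) * ENNReal.ofReal (Real.log (1 + N.sinr ω)) ∂P =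
      ∫⁻ ω, Φ (N.servingDist ω) * c.capacityLIntegral (N.servingDist ω) ∂P := by
  have hR := N.measurable_servingDist
  have hr : Measurable fun (x : ℕ → Plane) (k : Fin (m + 1)) => ‖x k‖ :=
    measurable_pi_lambda _ fun k => (measurable_pi_apply (k : ℕ)).norm
  have h := N.lintegral_mul_log_sinrOf hr (fun x k => norm_nonneg _)
    (T := fun l => {_x | m + 1 ≤ l}) (fun l => MeasurableSet.const _)
    (Φ := fun x => Φ fun k => ‖x k‖) (hΦ.comp hr) (fun x => hΦ1 _)
  refine Eq.trans h ?_
  have hcap : Measurable fun p : Ω × ℝ =>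
      ENNReal.ofReal (c.capacityIntegrand (N.servingDist p.1) p.2) :=
    (NetworkParams.measurable_capacityIntegrand (hR.comp measurable_fst)
      measurable_snd).ennreal_ofReal
  have hcapω : ∀ ω, Measurable fun s =>
      ENNReal.ofReal (c.capacityIntegrand (N.servingDist ω) s) := fun ω =>
    (NetworkParams.measurable_capacityIntegrand measurable_const measurable_id).ennreal_ofReal
  have hΦR : Measurable fun ω => Φ (N.servingDist ω) := hΦ.comp hR
  calc _ = ∫⁻ s in Ioi (0 : ℝ), ∫⁻ ω, Φ (N.servingDist ω) *
        ENNReal.ofReal (c.capacityIntegrand (N.servingDist ω) s) ∂P := by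
        refine setLIntegral_congr_fun measurableSet_Ioi fun s hs => ?_
        have hs' : (0 : ℝ) < s := hs
        have hL : Measurable fun r : Fin (m + 1) → ℝ =>
            ENNReal.ofReal (1 - c.signalLaplace s r) :=
          (measurable_const.sub
            (NetworkParams.measurable_signalLaplace measurable_const measurable_id)).ennreal_ofReal
        have hWΦ : Measurable fun r => ENNReal.ofReal (Real.exp (-s * c.noise) / s) *
            (Φ r * ENNReal.ofReal (1 - c.signalLaplace s r)) := (hΦ.mul hL).const_mul _
        have hsum : ∀ ω, ∑' l, {_x : ℕ → Plane | m + 1 ≤ l}.indicator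
            (fun x => c.linkExponent s ‖x l‖) (fun l => N.X l ω) =
            ∑' l, c.linkExponent s ‖N.X (l + (m + 1)) ω‖ := fun ω => by
          rw [← Summable.sum_add_tsum_nat_add' (k := m + 1) ENNReal.summable,
            Finset.sum_eq_zero, zero_add]
          · refine tsum_congr fun l => Set.indicator_of_mem ?_ _
            exact Nat.le_add_left _ _
          · intro l hl
            refine Set.indicator_of_notMem ?_ _
            exact not_le.2 (Finset.mem_range.1 hl)
        have hneg : Measurable fun ω =>
            negExp (∑' l, c.linkExponent s ‖N.X (l + (m + 1)) ω‖) :=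
          measurable_negExp.comp (Measurable.tsum fun l =>
            (NetworkParams.measurable_linkExponent s).comp (N.ppp.measurable _).norm)
        have hkey := N.lintegral_servingDist_mul_negExp hWΦ hs'.le
        simp only [hsum]
        rw [← lintegral_const_mul _ (by exact (hΦR.mul (hL.comp hR)).mul hneg)]
        refine Eq.trans (lintegral_congr fun ω => ?_) (hkey.trans (lintegral_congr fun ω => ?_))
        · rw [← mul_assoc]; rfl
        · rw [NetworkParams.ofReal_capacityIntegrand (r := N.servingDist ω)
            (fun k => norm_nonneg _) hs'.le]
          ring
    _ = ∫⁻ ω, (∫⁻ s in Ioi (0 : ℝ), Φ (N.servingDist ω) *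
        ENNReal.ofReal (c.capacityIntegrand (N.servingDist ω) s)) ∂P :=
      (lintegral_lintegral_swap ((hΦR.comp measurable_fst).mul hcap).aemeasurable).symm
    _ = _ := lintegral_congr fun ω => lintegral_const_mul _ (hcapω ω)

/-! ### Integrability -/

lemma servingDist_ae_mem [IsProbabilityMeasure P] :
    ∀ᵐ ω ∂P, N.servingDist ω ∈ orderedDistances (m + 1) := by
  have h := N.ppp.hasLaw_norm N.ordered m
  refine ae_of_ae_map N.measurable_servingDist.aemeasurable (p := (· ∈ orderedDistances (m + 1))) ?_
  have h' : P.map N.servingDist = _ := h.map_eq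
  rw [h']
  exact (withDensity_absolutelyContinuous _ _).ae_le
    (ae_restrict_mem (measurableSet_orderedDistances _))

/-- The distance `d` of the nearest access point has density `2πλ x e^{-πλx²}`, so that
`E[d^(-p)] < ∞` for `p < 2`. -/
lemma lintegral_rpow_norm_zero_ne_top [IsProbabilityMeasure P] {p : ℝ} (hp : p < 2) :
    ∫⁻ ω, ENNReal.ofReal (‖N.X 0 ω‖ ^ (-p)) ∂P ≠ ∞ := by
  have hlam := c.lam_pos
  have hpi := Real.pi_pos
  have h := N.ppp.hasLaw_norm N.ordered 0
  have hg : Measurable fun r : Fin 1 → ℝ => ENNReal.ofReal (r 0 ^ (-p)) := by fun_prop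
  have h1 := h.lintegral_comp hg.aemeasurable
  have hb : 0 < Real.pi * c.lam := by positivity
  have hint := (integrableOn_rpow_mul_exp_neg_mul_sq hb (s := 1 - p) (by linarith)).const_mul
    (2 * Real.pi * c.lam)
  rw [show (∫⁻ ω, ENNReal.ofReal (‖N.X 0 ω‖ ^ (-p)) ∂P) = _ from h1,
    lintegral_withDensity_eq_lintegral_mul _ c.measurable_distDensity hg]
  have hle : ∫⁻ r in orderedDistances 1,
      ENNReal.ofReal (c.distDensity r) * ENNReal.ofReal (r 0 ^ (-p)) ≤
      ∫⁻ r : Fin 1 → ℝ, (Ioi (0 : ℝ)).indicator (fun x => ENNReal.ofReal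
        (2 * Real.pi * c.lam * (x ^ (1 - p) * Real.exp (-(Real.pi * c.lam) * x ^ 2)))) (r 0) := by
    rw [← lintegral_indicator (measurableSet_orderedDistances _)]
    refine lintegral_mono fun r => Set.indicator_apply_le' (fun hr => ?_) (fun _ => zero_le)
    have hr0 : 0 < r 0 := hr.1 0
    rw [Set.indicator_of_mem (show r 0 ∈ Ioi (0 : ℝ) from hr0),
      ← ENNReal.ofReal_mul' (Real.rpow_nonneg hr0.le _)]
    refine le_of_eq (congrArg _ ?_)
    simp only [NetworkParams.distDensity, Finset.univ_unique, Finset.prod_singleton, pow_one,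
      Fin.default_eq_zero]
    rw [show (1 : ℝ) - p = 1 + -p by ring, Real.rpow_add hr0, Real.rpow_one]
    rw [show -Real.pi * c.lam = -(Real.pi * c.lam) by ring]
    show 2 * Real.pi * c.lam * r 0 * Real.exp (-(Real.pi * c.lam) * r 0 ^ 2) * r 0 ^ (-p) = _
    ring
  refine ne_top_of_le_ne_top ?_ hle
  have hmp := volume_preserving_funUnique (Fin 1) ℝ
  have hm : Measurable ((Ioi (0 : ℝ)).indicator (fun x => ENNReal.ofReal
      (2 * Real.pi * c.lam * (x ^ (1 - p) * Real.exp (-(Real.pi * c.lam) * x ^ 2))))) :=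
    Measurable.indicator (by fun_prop) measurableSet_Ioi
  refine ne_of_eq_of_ne (hmp.lintegral_comp hm) ?_
  rw [lintegral_indicator measurableSet_Ioi]
  refine ((hasFiniteIntegral_iff_ofReal ?_).1 hint.2).ne
  filter_upwards [ae_restrict_mem measurableSet_Ioi] with x hx
  have : (0 : ℝ) < x := hx
  positivity

lemma lintegral_capacityLIntegral_ne_top [IsProbabilityMeasure P] :
    ∫⁻ ω, c.capacityLIntegral (N.servingDist ω) ∂P ≠ ∞ := by
  obtain ⟨C, hC, hle⟩ := c.exists_capacityLIntegral_le
  have hp := c.boundExponent_lt_one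
  have hp0 := c.boundExponent_pos
  have hm : Measurable fun ω => ENNReal.ofReal (‖N.X 0 ω‖ ^ (-c.boundExponent)) := by
    have := N.ppp.measurable 0
    fun_prop
  have hbound : ∀ᵐ ω ∂P, c.capacityLIntegral (N.servingDist ω) ≤
      C * (m + 1 : ℕ) * ENNReal.ofReal (‖N.X 0 ω‖ ^ (-c.boundExponent)) := by
    filter_upwards [N.servingDist_ae_mem] with ω hω
    refine (hle m _ hω.1).trans ?_
    rw [mul_assoc]
    gcongr
    have h0 : N.servingDist ω 0 = ‖N.X 0 ω‖ := by simp [servingDist]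
    have hk : ∀ k : Fin (m + 1), k ∈ Finset.univ →
        ENNReal.ofReal (N.servingDist ω k ^ (-c.boundExponent)) ≤
          ENNReal.ofReal (‖N.X 0 ω‖ ^ (-c.boundExponent)) := fun k _ => by
      rw [← h0]
      exact ENNReal.ofReal_le_ofReal (Real.rpow_le_rpow_of_nonpos (hω.1 0)
        (hω.2 (Fin.zero_le k)) (by linarith))
    calc _ ≤ ∑ _k : Fin (m + 1), ENNReal.ofReal (‖N.X 0 ω‖ ^ (-c.boundExponent)) :=
          Finset.sum_le_sum hk
      _ = _ := by rw [Finset.sum_const, Finset.card_univ, Fintype.card_fin, nsmul_eq_mul]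
  refine ne_top_of_le_ne_top ?_ (lintegral_mono_ae hbound)
  rw [lintegral_const_mul _ hm]
  exact ENNReal.mul_ne_top (ENNReal.mul_ne_top hC (ENNReal.natCast_ne_top _))
    (N.lintegral_rpow_norm_zero_ne_top (by linarith))

lemma _root_.NetworkParams.capacityLIntegral_ne_top (c : NetworkParams) {r : Fin (m + 1) → ℝ}
    (hr : ∀ k, 0 < r k) : c.capacityLIntegral r ≠ ∞ := by
  obtain ⟨C, hC, hle⟩ := c.exists_capacityLIntegral_le
  exact ne_top_of_le_ne_top (ENNReal.mul_ne_top hC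
    (ENNReal.sum_ne_top.2 fun k _ => ENNReal.ofReal_ne_top)) (hle m r hr)

lemma measurable_sinrOf {r : (ℕ → Plane) → Fin (m + 1) → ℝ} (hr : Measurable r)
    {T : ℕ → Set (ℕ → Plane)} (hT : ∀ l, MeasurableSet (T l)) :
    Measurable fun ω => N.sinrOf (r fun l => N.X l ω) {l | (fun l => N.X l ω) ∈ T l} ω := by
  have hI : Measurable fun ω => N.losInterference {l | (fun l => N.X l ω) ∈ T l} ω +
      N.nlosInterference {l | (fun l => N.X l ω) ∈ T l} ω := by
    simp only [N.interference_eq T]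
    exact (c.measurable_totalInterference hT).comp N.measurable_links
  have hS : Measurable fun ω => N.signal (r fun l => N.X l ω) ω := by
    refine Finset.measurable_fun_sum _ fun k _ => ?_
    have h1 : Measurable fun ω => r (fun l => N.X l ω) k :=
      (measurable_pi_apply k).comp (hr.comp N.measurable_X)
    exact ((h1.pow_const _).const_mul _).mul (N.measurable_servingFading k)
  exact (hS.ennreal_ofReal.div (hI.add_const _)).ennreal_toReal

lemma measurable_sinr : Measurable N.sinr :=
  N.measurable_sinrOf (r := fun x k => ‖x k‖)
    (measurable_pi_lambda _ fun k => (measurable_pi_apply (k : ℕ)).norm)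
    (T := fun l => {_x | m + 1 ≤ l}) (fun _ => MeasurableSet.const _)

lemma measurable_sinrGiven (r : Fin (m + 1) → ℝ) : Measurable (N.sinrGiven r) :=
  N.measurable_sinrOf (r := fun _ => r) measurable_const
    (T := fun l => {x | r (Fin.last m) < ‖x l‖})
    (fun l => measurableSet_lt measurable_const (measurable_pi_apply l).norm)

lemma log_one_add_sinr_nonneg (ω : Ω) : 0 ≤ Real.log (1 + N.sinr ω) :=
  Real.log_nonneg (le_add_of_nonneg_right ENNReal.toReal_nonneg)

lemma log_one_add_sinrGiven_nonneg (r : Fin (m + 1) → ℝ) (ω : Ω) :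
    0 ≤ Real.log (1 + N.sinrGiven r ω) :=
  Real.log_nonneg (le_add_of_nonneg_right ENNReal.toReal_nonneg)

lemma integrable_log_one_add_sinrGiven [IsProbabilityMeasure P] {r : Fin (m + 1) → ℝ}
    (hr : ∀ k, 0 < r k) : Integrable (fun ω => Real.log (1 + N.sinrGiven r ω)) P := by
  refine ⟨(((N.measurable_sinrGiven r).const_add 1).log).aestronglyMeasurable, ?_⟩
  rw [hasFiniteIntegral_iff_ofReal (ae_of_all _ (N.log_one_add_sinrGiven_nonneg r)),
    N.lintegral_log_sinrGiven fun k => (hr k).le]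
  exact (c.capacityLIntegral_ne_top hr).lt_top

lemma integral_log_one_add_sinrGiven [IsProbabilityMeasure P] {r : Fin (m + 1) → ℝ}
    (hr : ∀ k, 0 ≤ r k) : ∫ ω, Real.log (1 + N.sinrGiven r ω) ∂P =
      ∫ s in Ioi (0 : ℝ), c.capacityIntegrand r s := by
  rw [integral_eq_lintegral_of_nonneg_ae
    (ae_of_all _ (N.log_one_add_sinrGiven_nonneg r))
    ((N.measurable_sinrGiven r).const_add 1).log.aestronglyMeasurable,
    N.lintegral_log_sinrGiven hr, NetworkParams.integral_capacityIntegrand hr]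

lemma integrable_log_one_add_sinr [IsProbabilityMeasure P] :
    Integrable (fun ω => Real.log (1 + N.sinr ω)) P := by
  refine ⟨((N.measurable_sinr.const_add 1).log).aestronglyMeasurable, ?_⟩
  rw [hasFiniteIntegral_iff_ofReal (ae_of_all _ N.log_one_add_sinr_nonneg)]
  have h := N.lintegral_servingDist_mul_log_sinr (Φ := fun _ => 1) measurable_const fun _ => le_rfl
  simp only [one_mul] at h
  rw [h]
  exact N.lintegral_capacityLIntegral_ne_top.lt_top

lemma integrable_capacity_servingDist [IsProbabilityMeasure P] :
    Integrable (fun ω => ∫ s in Ioi (0 : ℝ), c.capacityIntegrand (N.servingDist ω) s) P := by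
  have hm : Measurable fun ω => c.capacityLIntegral (N.servingDist ω) :=
    NetworkParams.measurable_capacityLIntegral.comp N.measurable_servingDist
  refine (integrable_toReal_of_lintegral_ne_top hm.aemeasurable
    N.lintegral_capacityLIntegral_ne_top).congr (ae_of_all _ fun ω => ?_)
  exact (NetworkParams.integral_capacityIntegrand fun k => norm_nonneg _).symm

/-- The conditional expectation of the rate on events that depend on the serving distances. -/
lemma setIntegral_capacity_servingDist [IsProbabilityMeasure P] {B : Set (Fin (m + 1) → ℝ)}
    (hB : MeasurableSet B) :
    ∫ ω in N.servingDist ⁻¹' B, (∫ s in Ioi (0 : ℝ), c.capacityIntegrand (N.servingDist ω) s) ∂P =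
      ∫ ω in N.servingDist ⁻¹' B, Real.log (1 + N.sinr ω) ∂P := by
  have hB' := N.measurable_servingDist hB
  have hm : Measurable fun ω => c.capacityLIntegral (N.servingDist ω) :=
    NetworkParams.measurable_capacityLIntegral.comp N.measurable_servingDist
  have hind : Measurable (B.indicator (1 : (Fin (m + 1) → ℝ) → ℝ≥0∞)) := measurable_one.indicator hB
  have h := N.lintegral_servingDist_mul_log_sinr hind
    fun r => Set.indicator_le_self' (fun _ _ => zero_le) r
  have hset : ∀ f : Ω → ℝ≥0∞, ∫⁻ ω, B.indicator 1 (N.servingDist ω) * f ω ∂P =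
      ∫⁻ ω in N.servingDist ⁻¹' B, f ω ∂P := fun f => by
    rw [← lintegral_indicator hB']
    refine lintegral_congr fun ω => ?_
    by_cases hω : N.servingDist ω ∈ B
    · rw [Set.indicator_of_mem hω, Set.indicator_of_mem (show ω ∈ N.servingDist ⁻¹' B from hω),
        Pi.one_apply, one_mul]
    · rw [Set.indicator_of_notMem hω,
        Set.indicator_of_notMem (show ω ∉ N.servingDist ⁻¹' B from hω), zero_mul]
  rw [hset, hset] at h
  rw [integral_eq_lintegral_of_nonneg_ae
    (ae_of_all _ N.log_one_add_sinr_nonneg)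
    (N.measurable_sinr.const_add 1).log.aestronglyMeasurable]
  have hG : ∀ ω, ∫ s in Ioi (0 : ℝ), c.capacityIntegrand (N.servingDist ω) s =
      (c.capacityLIntegral (N.servingDist ω)).toReal := fun ω =>
    NetworkParams.integral_capacityIntegrand fun k => norm_nonneg _
  simp only [hG]
  rw [integral_toReal hm.aemeasurable, ← h]
  exact ae_restrict_of_ae (ae_lt_top hm N.lintegral_capacityLIntegral_ne_top)

end NetworkModel

/-! ### Ergodic capacity -/

lemma NetworkParams.measurable_integral_capacityIntegrand (c : NetworkParams) {m : ℕ} :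
    Measurable fun r : Fin (m + 1) → ℝ => ∫ s in Ioi (0 : ℝ), c.capacityIntegrand r s :=
  (StronglyMeasurable.integral_prod_right'
    (measurable_capacityIntegrand measurable_fst measurable_snd).stronglyMeasurable).measurable

theorem theorem1 (c : NetworkParams) (K : ℕ) [NeZero K] {Ω : Type*} [mΩ : MeasurableSpace Ω]
    (P : Measure Ω) [IsProbabilityMeasure P] (N : NetworkModel c K P) :
    -- the conditional capacity at fixed serving distances
    (∀ r ∈ orderedDistances K,
      Integrable (N.rateGiven r) P ∧
      IntegrableOn (c.capacityIntegrand r) (Ioi 0) ∧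
      N.condCapacity r = 1 / Real.log 2 * ∫ s in Ioi 0, c.capacityIntegrand r s) ∧
    -- it is the conditional expectation of the rate given the serving distances
    Integrable N.rate P ∧
    P[N.rate | MeasurableSpace.comap N.servingDist inferInstance] =ᵐ[P]
      (fun ω => 1 / Real.log 2 * ∫ s in Ioi 0, c.capacityIntegrand (N.servingDist ω) s) ∧
    -- the joint density of the serving distances
    HasLaw N.servingDist
      ((volume.restrict (orderedDistances K)).withDensity
        (fun r => ENNReal.ofReal (c.distDensity r))) P ∧
    -- the unconditional capacity
    IntegrableOn (fun r => (∏ k, r k) *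
        Real.exp (-Real.pi * c.lam * r ⟨K - 1, Nat.sub_one_lt (NeZero.ne K)⟩ ^ 2) *
          ∫ s in Ioi 0, c.capacityIntegrand r s) (orderedDistances K) ∧
    N.capacity = (2 * Real.pi * c.lam) ^ K / Real.log 2 *
      ∫ r in orderedDistances K, (∏ k, r k) *
        Real.exp (-Real.pi * c.lam * r ⟨K - 1, Nat.sub_one_lt (NeZero.ne K)⟩ ^ 2) *
          ∫ s in Ioi 0, c.capacityIntegrand r s := by
  obtain ⟨m, rfl⟩ : ∃ m, K = m + 1 := Nat.exists_eq_succ_of_ne_zero (NeZero.ne K)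
  have hlam := c.lam_pos
  have hpi := Real.pi_pos
  have hR := N.measurable_servingDist
  have hlaw : HasLaw N.servingDist ((volume.restrict (orderedDistances (m + 1))).withDensity
      fun r => ENNReal.ofReal (c.distDensity r)) P := N.ppp.hasLaw_norm N.ordered m
  have hGm := c.measurable_integral_capacityIntegrand (m := m)
  have hrate : N.rate = fun ω => 1 / Real.log 2 * Real.log (1 + N.sinr ω) :=
    funext fun ω => by rw [NetworkModel.rate, Real.logb]; ring
  have hrate_int : Integrable N.rate P := by
    rw [hrate]; exact N.integrable_log_one_add_sinr.const_mul _
  have hG_int := N.integrable_capacity_servingDist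
  have hcond : P[N.rate | MeasurableSpace.comap N.servingDist inferInstance] =ᵐ[P]
      (fun ω => 1 / Real.log 2 * ∫ s in Ioi 0, c.capacityIntegrand (N.servingDist ω) s) := by
    refine (ae_eq_condExp_of_forall_setIntegral_eq hR.comap_le hrate_int
      (fun s _ _ => (hG_int.const_mul _).integrableOn) ?_ ?_).symm
    · rintro s ⟨B, hB, rfl⟩ -
      rw [hrate, integral_const_mul, integral_const_mul, N.setIntegral_capacity_servingDist hB]
    · exact ((hGm.comp (comap_measurable N.servingDist)).const_mul
        _).stronglyMeasurable.aestronglyMeasurable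
  -- the density of the serving distances, up to its constant factor
  have hdens : ∀ r ∈ orderedDistances (m + 1), (ENNReal.ofReal (c.distDensity r)).toReal •
      ∫ s in Ioi 0, c.capacityIntegrand r s = (2 * Real.pi * c.lam) ^ (m + 1) * ((∏ k, r k) *
        Real.exp (-Real.pi * c.lam * r ⟨m + 1 - 1, Nat.sub_one_lt (NeZero.ne (m + 1))⟩ ^ 2) *
          ∫ s in Ioi 0, c.capacityIntegrand r s) := fun r hr => by
    have hprod : 0 ≤ ∏ k, r k := Finset.prod_nonneg fun k _ => (hr.1 k).le
    rw [NetworkParams.distDensity, ENNReal.toReal_ofReal (by positivity), smul_eq_mul]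
    ring
  have hlt : ∀ᵐ r ∂volume.restrict (orderedDistances (m + 1)),
      ENNReal.ofReal (c.distDensity r) < ∞ := ae_of_all _ fun r => ENNReal.ofReal_lt_top
  have hD := measurableSet_orderedDistances (m + 1)
  refine ⟨fun r hr => ⟨?_, ?_, ?_⟩, hrate_int, hcond, hlaw, ?_, ?_⟩
  · have h : N.rateGiven r = fun ω => 1 / Real.log 2 * Real.log (1 + N.sinrGiven r ω) :=
      funext fun ω => by rw [NetworkModel.rateGiven, Real.logb]; ring
    rw [h]
    exact (N.integrable_log_one_add_sinrGiven hr.1).const_mul _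
  · exact NetworkParams.integrableOn_capacityIntegrand (fun k => (hr.1 k).le)
      (c.capacityLIntegral_ne_top hr.1)
  · rw [← N.integral_log_one_add_sinrGiven fun k => (hr.1 k).le, ← integral_const_mul]
    exact integral_congr_ae (ae_of_all _ fun ω => by
      simp only [NetworkModel.rateGiven, Real.logb]; ring)
  · have h1 : Integrable (fun r => ∫ s in Ioi (0 : ℝ), c.capacityIntegrand r s)
        (P.map N.servingDist) :=
      (integrable_map_measure hGm.aestronglyMeasurable hR.aemeasurable).2 hG_int
    rw [hlaw.map_eq, integrable_withDensity_iff_integrable_smul' c.measurable_distDensity hlt] at h1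
    have h2 := (integrableOn_congr_fun hdens hD).1 h1
    exact (integrable_const_mul_iff (IsUnit.mk0 _ (by positivity)) _).1 h2
  · have h1 := hlaw.integral_comp hGm.aestronglyMeasurable
    rw [integral_withDensity_eq_integral_toReal_smul c.measurable_distDensity hlt,
      setIntegral_congr_fun hD hdens, integral_const_mul] at h1
    rw [NetworkModel.capacity, ← integral_condExp hR.comap_le, integral_congr_ae hcond,
      integral_const_mul]
    refine (congrArg _ h1).trans ?_
    ring
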